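/- **Theorem 3.13.** Let $p$ be an odd prime. Let $A,B$ be symmetric positive definite integral $4\times4$ matrices that are even (i.e. have even diagonal entries), have determinant $p^2$, and are such that $pA^{-1}$ and $pB^{-1}$ are also even integral matrices. Let $Q=A\oplus B$, an $8\times 8$ matrix, and let $$\vartheta^Q(\Omega)=\sum_{N\in\mathbb Z^{8\times2}}e\bigl(\tfrac12\operatorname{tr}(N'QN\,\Omega)\bigr),\qquad e(z)=e^{2\pi i z},$$ be its theta series on the Siegel upper half space $\mathcal H_2$ of degree two, a Siegel modular form of weight $4$ for $\Gamma_0(p)\subseteq \mathrm{Sp}_2(\mathbb Z)$. Let $$K(p)=\mathrm{Sp}_2(\mathbb Q)\cap\begin{pmatrix} *&*&*/p&*\\ p*&*&*&*\\ p*&p*&*&p*\\ p*&*&*&*\end{pmatrix},\qquad B(p)=\mathrm{Sp}_2(\mathbb Z)\cap\begin{pmatrix} *&*&*&*\\ p*&*&*&*\\ p*&p*&*&p*\\ p*&p*&*&*\end{pmatrix}\qquad(*\in\mathbb Z)$$ be the paramodular group and its Iwahori subgroup, and let $\Gamma_0'(p)=K(p)\cap \mathrm{Sp}_2(\mathbb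 Z)$. For $f$ of weight $k$ put $(f|\gamma)(\Omega)=\det(C\Omega+D)^{-k}f\bigl((A'\Omega+B')(C\Omega+D)^{-1}\bigr)$ for $\gamma=\begin{pmatrix}A'&B'\\C&D\end{pmatrix}\in \mathrm{Sp}_2(\mathbb Q)$, and let $\operatorname{Tr}(f)=f\,|\,[B(p)\Gamma_0'(p)]\,|\,[\Gamma_0'(p)K(p)]$, where $f|[\Gamma\Gamma']=\sum_i f|g_i$ for a disjoint union $\Gamma\Gamma'=\bigcup_i\Gamma g_i$. Then $\operatorname{Tr}(\vartheta^Q)$ belongs to the space $M_2^4(K(p))$ of Siegel modular forms of degree two and weight $4$ for $K(p)$, and it has a Fourier expansion $$\operatorname{Tr}(\vartheta^Q)(\Omega)=\sum_T a(T)\,e(\operatorname{tr}(T\Omega)),$$ where $T=\begin{pmatrix}n&r/2\\r/2&m\end{pmatrix}$ runs over the positive semidefinite matrices with $n,r,m\in\mathbb Z$ and $p\mid n$, and all of whose Fourier coefficients $a(T)$ are integers divisible by $4$. -/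

import Mathlib

open Matrix

noncomputable section

/-! ## Groups -/

/-- The index set of the rows and columns of `4 × 4` matrices in `2 × 2` blocks:
`inl 0, inl 1, inr 0, inr 1` are the indices `1, 2, 3, 4`. -/
abbrev Idx : Type := Fin 2 ⊕ Fin 2

/-- The group `Sp₂(ℚ)` of `4 × 4` rational symplectic matrices. -/
abbrev Sp2Q : Type := Matrix.symplecticGroup (Fin 2) ℚ

/-- The subgroup of `Sp₂(ℚ)` of the matrices whose `(i, j)` entry lies in `ℤ · w i j`; the
hypotheses on the pattern `w` say exactly what makes this closed under products and inverses. -/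
def patternSubgroup (w : Matrix Idx Idx ℚ)
    (h_one : ∀ i, ∃ m : ℤ, (1 : ℚ) = m * w i i)
    (h_mul : ∀ i j k, ∃ m : ℤ, w i j * w j k = m * w i k)
    (h_inv : ∀ i j, w j.swap i.swap = w i j) : Subgroup Sp2Q where
  carrier := {g | ∀ i j, ∃ m : ℤ, (g : Matrix Idx Idx ℚ) i j = m * w i j}
  one_mem' := by
    intro i j
    by_cases h : i = j
    · subst h
      simpa using h_one i
    · exact ⟨0, by simp [Matrix.one_apply_ne h]⟩
  mul_mem' := by
    intro a b ha hb i k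
    have key : ∀ j, ∃ m : ℤ, (a : Matrix Idx Idx ℚ) i j * (b : Matrix Idx Idx ℚ) j k
        = m * w i k := by
      intro j
      obtain ⟨m, hm⟩ := ha i j
      obtain ⟨n, hn⟩ := hb j k
      obtain ⟨r, hr⟩ := h_mul i j k
      refine ⟨m * n * r, ?_⟩
      rw [hm, hn]
      push_cast
      linear_combination (m : ℚ) * n * hr
    choose m hm using key
    refine ⟨∑ j, m j, ?_⟩
    push_cast
    rw [Finset.sum_mul]
    change ((a : Matrix Idx Idx ℚ) * (b : Matrix Idx Idx ℚ)) i k = _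
    rw [Matrix.mul_apply]
    exact Finset.sum_congr rfl fun j _ => hm j
  inv_mem' := by
    intro a ha i j
    obtain ⟨m, hm⟩ := ha j.swap i.swap
    rw [h_inv] at hm
    rw [SymplecticGroup.coe_inv, ← Matrix.fromBlocks_toBlocks (a : Matrix Idx Idx ℚ)]
    rcases i with i | i <;> rcases j with j | j <;>
      simp only [Sum.swap_inl, Sum.swap_inr] at hm <;>
      simp [Matrix.J, Matrix.fromBlocks_transpose, Matrix.fromBlocks_multiply,
        Matrix.fromBlocks_neg, Matrix.toBlocks₁₁, Matrix.toBlocks₁₂, Matrix.toBlocks₂₁,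
        Matrix.toBlocks₂₂, hm]
    · exact ⟨-m, by push_cast; ring⟩
    · exact ⟨-m, by push_cast; ring⟩

/-- `Γ₂ = Sp₂(ℤ)`, inside `Sp₂(ℚ)`. -/
def Sp2Z : Subgroup Sp2Q :=
  patternSubgroup (Matrix.of fun _ _ => 1) (fun _ => ⟨1, by simp⟩) (fun _ _ _ => ⟨1, by simp⟩)
    (fun _ _ => by simp)

/-- The entry pattern of the paramodular group. -/
def paramodularPattern (N : ℕ) : Matrix Idx Idx ℚ :=
  Matrix.fromBlocks
    !![1, 1;
       N, 1]
    !![1 / (N : ℚ), 1;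
       1, 1]
    !![(N : ℚ), N;
       N, 1]
    !![1, (N : ℚ);
       1, 1]

/-- The paramodular group `K(N)`. -/
def paramodular (N : ℕ) [NeZero N] : Subgroup Sp2Q :=
  patternSubgroup (paramodularPattern N)
    (by
      rintro (i | i) <;> fin_cases i <;> exact ⟨1, by simp [paramodularPattern]⟩)
    (by
      have hN : (N : ℚ) ≠ 0 := Nat.cast_ne_zero.mpr (NeZero.ne N)
      rintro (i | i) (j | j) (k | k) <;> fin_cases i <;> fin_cases j <;> fin_cases k <;>
      first
        | (refine ⟨1, ?_⟩; simp [paramodularPattern, hN]; done)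
        | (refine ⟨N, ?_⟩; simp [paramodularPattern, hN]))
    (by
      rintro (i | i) (j | j) <;> fin_cases i <;> fin_cases j <;> simp [paramodularPattern])

/-- `Γ₀'(N) = K(N) ∩ Sp₂(ℤ)`. -/
def gamma0' (N : ℕ) [NeZero N] : Subgroup Sp2Q := paramodular N ⊓ Sp2Z

/-- The entry pattern of the Iwahori subgroup. -/
def iwahoriPattern (N : ℕ) : Matrix Idx Idx ℚ :=
  Matrix.fromBlocks
    !![1, 1;
       N, 1]
    !![1, 1;
       1, 1]
    !![(N : ℚ), N;
       N, N]
    !![1, (N : ℚ);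
       1, 1]

/-- The Iwahori subgroup `B(N)` of `K(N)`. -/
def iwahori (N : ℕ) : Subgroup Sp2Q :=
  patternSubgroup (iwahoriPattern N)
    (by
      rintro (i | i) <;> fin_cases i <;> exact ⟨1, by simp [iwahoriPattern]⟩)
    (by
      rintro (i | i) (j | j) (k | k) <;> fin_cases i <;> fin_cases j <;> fin_cases k <;>
      first
        | (refine ⟨1, ?_⟩; simp [iwahoriPattern]; done)
        | (refine ⟨N, ?_⟩; simp [iwahoriPattern]))
    (by
      rintro (i | i) (j | j) <;> fin_cases i <;> fin_cases j <;> simp [iwahoriPattern])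

/-! ## Siegel modular forms of degree two -/

/-- The Siegel upper half space of degree two. Functions on it are functions on all complex
`2 × 2` matrices of which only the values on this set matter. -/
def siegelHalfSpace : Set (Matrix (Fin 2) (Fin 2) ℂ) :=
  {Ω | Ω.IsSymm ∧ (Ω.map Complex.im).PosDef}

/-- The weight `k` slash action of `Sp₂(ℚ)` (the similitude factor is `1` there):
`(f|γ)(Ω) = det(CΩ + D)^{-k} f((AΩ + B)(CΩ + D)⁻¹)`. -/
def slash (k : ℤ) (f : Matrix (Fin 2) (Fin 2) ℂ → ℂ) (γ : Sp2Q) :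
    Matrix (Fin 2) (Fin 2) ℂ → ℂ := fun Ω =>
  let M : Matrix Idx Idx ℂ := (γ : Matrix Idx Idx ℚ).map (Rat.cast : ℚ → ℂ)
  (M.toBlocks₂₁ * Ω + M.toBlocks₂₂).det ^ (-k) *
    f ((M.toBlocks₁₁ * Ω + M.toBlocks₁₂) * (M.toBlocks₂₁ * Ω + M.toBlocks₂₂)⁻¹)

/-- `f ∈ M₂ᵏ(Γ)`: `f` is holomorphic on the Siegel upper half space (as a function of the
coordinates `τ, z, ω` of `Ω = (τ, z; z, ω)`), is invariant under `Γ`, and for every `γ ∈ Sp₂(ℤ)`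
and every `Y₀ > 0` the function `f|γ` is bounded on `{Ω : Im Ω > Y₀}`. -/
structure IsSiegelModularForm (k : ℤ) (Γ : Subgroup Sp2Q)
    (f : Matrix (Fin 2) (Fin 2) ℂ → ℂ) : Prop where
  holo : DifferentiableOn ℂ (fun x : ℂ × ℂ × ℂ => f !![x.1, x.2.1; x.2.1, x.2.2])
    {x : ℂ × ℂ × ℂ | !![x.1, x.2.1; x.2.1, x.2.2] ∈ siegelHalfSpace}
  slash_eq : ∀ γ ∈ Γ, ∀ Ω ∈ siegelHalfSpace, slash k f γ Ω = f Ω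
  bdd : ∀ Y₀ : Matrix (Fin 2) (Fin 2) ℝ, Y₀.PosDef → ∀ γ ∈ Sp2Z,
    ∃ C : ℝ, ∀ Ω ∈ siegelHalfSpace, (Ω.map Complex.im - Y₀).PosDef → ‖slash k f γ Ω‖ ≤ C

/-! ## Hecke operators -/

/-- The set `Γ \ Γ g Γ'` of cosets `Γ x` contained in the double coset `Γ g Γ'`. -/
def cosetsOfDouble (Γ : Subgroup Sp2Q) (g : Sp2Q) (Γ' : Subgroup Sp2Q) :
    Set (Quotient (QuotientGroup.rightRel Γ)) :=
  (fun x => Quotient.mk (QuotientGroup.rightRel Γ) x) ''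
    DoubleCoset.doubleCoset g (Γ : Set Sp2Q) (Γ' : Set Sp2Q)

/-- The Hecke operator `f ↦ f|[Γ g Γ'] = ∑ᵢ f|gᵢ`, for `Γ g Γ' = ⋃ᵢ Γ gᵢ` disjoint. (For
`Γ`-invariant `f` the summands do not depend on the representatives of the cosets.) -/
def heckeOperator (k : ℤ) (Γ : Subgroup Sp2Q) (g : Sp2Q) (Γ' : Subgroup Sp2Q)
    (f : Matrix (Fin 2) (Fin 2) ℂ → ℂ) : Matrix (Fin 2) (Fin 2) ℂ → ℂ := fun Ω =>
  ∑ᶠ c ∈ cosetsOfDouble Γ g Γ', slash k f (Quotient.out c) Ω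

/-- `Tr f = f | [B(p) Γ₀'(p)] | [Γ₀'(p) K(p)]`, for `f ∈ M₂ᵏ(Γ₀(p)) ⊆ M₂ᵏ(B(p))`; here
`[Γ Γ']` is the double coset of the identity. -/
def paramodularTrace (k : ℤ) (p : ℕ) [NeZero p] (f : Matrix (Fin 2) (Fin 2) ℂ → ℂ) :
    Matrix (Fin 2) (Fin 2) ℂ → ℂ :=
  heckeOperator k (gamma0' p) 1 (paramodular p)
    (heckeOperator k (iwahori p) 1 (gamma0' p) f)

/-! ## Quadratic forms and theta series -/

/-- An even integral form: a symmetric integral matrix with even diagonal entries. -/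
def IsEvenForm {n : Type*} (A : Matrix n n ℤ) : Prop :=
  A.IsSymm ∧ ∀ i, Even (A i i)

/-- The rational matrix `A` has integral entries and is an even form. -/
def IsEvenRatForm {n : Type*} (A : Matrix n n ℚ) : Prop :=
  ∃ E : Matrix n n ℤ, IsEvenForm E ∧ A = E.map (Int.cast : ℤ → ℚ)

/-- The degree two theta series
`ϑ^Q(Ω) = ∑_N e(½ tr(N' Q N Ω))`, with `N` over the integral `n × 2` matrices and
`e(z) = exp(2πiz)`. -/
def theta {n : Type*} [Fintype n] (Q : Matrix n n ℤ) (Ω : Matrix (Fin 2) (Fin 2) ℂ) : ℂ :=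
  ∑' N : Matrix n (Fin 2) ℤ,
    Complex.exp (2 * Real.pi * Complex.I *
      (1 / 2 * ((Nᵀ * Q * N).map (Int.cast : ℤ → ℂ) * Ω).trace))

/-! ## Fourier expansions -/

/-- The semidefinite half-integral matrices: `T` rational symmetric, `T ≥ 0`, and
`v' T v ∈ ℤ` for all `v ∈ ℤ²`. -/
def halfIntegralSemi : Set (Matrix (Fin 2) (Fin 2) ℚ) :=
  {T | T.IsSymm ∧ (T.map (Rat.cast : ℚ → ℝ)).PosSemidef ∧
    ∀ v : Fin 2 → ℤ, ∃ m : ℤ, (fun i => (v i : ℚ)) ⬝ᵥ T *ᵥ (fun i => (v i : ℚ)) = m}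

/-- Those `T = (a, b; b, c)` among them with `N ∣ a`. -/
def paramodularIndices (N : ℕ) : Set (Matrix (Fin 2) (Fin 2) ℚ) :=
  {T | T ∈ halfIntegralSemi ∧ ∃ m : ℤ, T 0 0 = N * m}

/-- `f(Ω) = ∑_T a(T) e(tr(T Ω))` on the Siegel upper half space, with unconditional convergence:
`a` is the family of Fourier coefficients of the form `f` on `K(N)`. -/
def IsFourierExpansion (N : ℕ) (f : Matrix (Fin 2) (Fin 2) ℂ → ℂ)
    (a : paramodularIndices N → ℂ) : Prop :=
  ∀ Ω ∈ siegelHalfSpace,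
    HasSum (fun T : paramodularIndices N => a T *
      Complex.exp (2 * Real.pi * Complex.I *
        ((T : Matrix (Fin 2) (Fin 2) ℚ).map (Rat.cast : ℚ → ℂ) * Ω).trace)) (f Ω)

end

/-! ### Gaussian sums over `ℤⁿ` converge. -/

noncomputable section

open MeasureTheory Complex

variable {n : Type*} [Fintype n]

/-! Let `L = ℤ⁸`, `q(x) = ½ x'Qx` and `L^# = Q⁻¹L`. The level condition says that `pL^# ⊆ L` and
that `p q` is integral on `L^#`. For a bounded function `φ` of rational `8 × 2` matrices, supported
on one lattice and periodic under another, put `Θ(φ) = ∑ φ(N) e(½ tr(N'QNΩ))`. In weight `4 = 8/2`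
no multiplier occurs. A translation of `Ω` multiplies `φ` by a phase, a Levi element substitutes in
`φ`, and the inversion in the second variable replaces `φ` by its Fourier transform in the second
column (`thetaSum_slash_inversion`, which rests on `poisson_summation_pi`). Questions about the
trace become computations with `φ`.

The series `ϑ^Q` is `Θ(1_L ⊗ 1_L)`. Its invariance under `Γ₀(p)` is checked on generators
(`SpZ.mem_of_dvd`): translations, `GL₂(ℤ)` and an embedded `Γ₀(p) ⊆ SL₂(ℤ)`. In the last case
Dirichlet's theorem makes the lower right entry an odd prime `d ≠ p`, and the required Fourier
transform is a Gauss sum of a form in eight variables with square determinant, whose value is `d⁴`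
up to the expected phase (`quad_sum_dual`).

Both coset spaces in the trace are copies of `ℙ¹(𝔽_p)`. Summing over representatives gives `Tr(ϑ^Q)
= Θ(f ⊗ g)` with `f(x) = 1[x ∈ L, p ∣ q(x)] + p · 1[x ∈ pL^#]` and `g(y) = p · 1[y ∈ L] + 1[y ∈ L^#,
q(y) ∈ ℤ]` (`paramodularTrace_eq`). Holomorphy comes from termwise differentiation. The growth
condition holds because `Sp₂(ℤ)` preserves the space of the series `Θ(φ)` (`sp2Z_le_schwartzGroup`).

The coefficient `a(T)` is the finite sum of the integers `f(x) g(y)` over the `N = (x, y)` with `½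
N'QN = T`. Changing the sign of the rows belonging to `A`, or of those belonging to `B`, preserves
both `T` and the weight. If both blocks of `N` are nonzero its orbit has four elements. If one block
vanishes, only a quaternary form remains, and its discriminant form is anisotropic
(`mem_intLattice_of_quad_int`). Indeed an isotropic class would produce an even unimodular lattice
of rank four. Its theta function would satisfy `F(ω + 1) = F(ω)` and `F(-1/ω) = -ω² F(ω)`; these
relations force `F(i) = 0`, while `F(i)` is a sum of nonnegative terms, one of which is `1`. By
anisotropy the two conditions in `f` agree on such `N`, as do those in `g`, so a nonzero weight is
`(p + 1)²`, divisible by four since `p` is odd (`IsLevelPair.four_dvd_tsum_traceFiber`). Fourier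
coefficients are unique (`IsFourierExpansion.unique`), so this settles every expansion. -/

theorem summable_prod_int {g : ℤ → ℝ} (hg : ∀ m, 0 ≤ g m) (hs : Summable g) :
    Summable fun m : n → ℤ => ∏ i, g (m i) := by
  classical
  refine summable_of_sum_le (c := (∑' m, g m) ^ Fintype.card n)
    (fun m => Finset.prod_nonneg fun i _ => hg _) fun s => ?_
  -- A finite set of vectors lies in a cube `tⁿ`, over which the sum of products factors as a power.
  let t : Finset ℤ := s.biUnion fun m => Finset.univ.image m
  have hst : s ⊆ Fintype.piFinset fun _ => t := by
    intro m hm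
    simp only [Fintype.mem_piFinset]
    intro i
    exact Finset.mem_biUnion.2 ⟨m, hm, Finset.mem_image_of_mem _ (Finset.mem_univ i)⟩
  calc ∑ m ∈ s, ∏ i, g (m i) ≤ ∑ m ∈ Fintype.piFinset fun _ : n => t, ∏ i, g (m i) :=
        Finset.sum_le_sum_of_subset_of_nonneg hst fun m _ _ => Finset.prod_nonneg fun i _ => hg _
    _ = (∑ j ∈ t, g j) ^ Fintype.card n := by
        rw [← Finset.prod_univ_sum (fun _ => t) (fun _ j => g j)]
        simp
    _ ≤ _ := pow_le_pow_left₀ (Finset.sum_nonneg fun _ _ => hg _)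
        (hs.sum_le_tsum t fun _ _ => hg _) _

theorem summable_exp_neg_mul_sq_int {c : ℝ} (hc : 0 < c) :
    Summable fun m : ℤ => Real.exp (-c * (m : ℝ) ^ 2) := by
  -- The bound for Jacobi theta terms, with zero shift, `T = c / π` and no polynomial factor, is
  -- exactly `exp (-c m²)`.
  have h := summable_pow_mul_jacobiTheta₂_term_bound 0 (T := c / Real.pi)
    (by positivity) 0
  refine h.congr fun m => ?_
  have : Real.pi ≠ 0 := Real.pi_ne_zero
  simp only [pow_zero, one_mul, mul_zero, zero_mul, sub_zero]
  congr 1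
  field_simp

theorem summable_exp_neg_mul_sum_sq {c : ℝ} (hc : 0 < c) :
    Summable fun m : n → ℤ => Real.exp (-c * ∑ i, (m i : ℝ) ^ 2) := by
  refine (summable_prod_int (fun _ => (Real.exp_pos _).le)
    (summable_exp_neg_mul_sq_int hc)).congr fun m => ?_
  rw [← Real.exp_sum, Finset.mul_sum]

/-- A real positive definite form dominates a multiple of the sum of squares. -/
theorem Matrix.PosDef.exists_pos_mul_sum_sq_le {Q : Matrix n n ℝ} (hQ : Q.PosDef) :
    ∃ c : ℝ, 0 < c ∧ ∀ v : n → ℝ, c * ∑ i, v i ^ 2 ≤ v ⬝ᵥ Q *ᵥ v := by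
  classical
  by_cases hn : Nonempty n
  swap
  · refine ⟨1, one_pos, fun v => ?_⟩
    have : IsEmpty n := not_nonempty_iff.1 hn
    simp [dotProduct]
  have hcont : Continuous fun v : EuclideanSpace ℝ n => (v : n → ℝ) ⬝ᵥ Q *ᵥ (v : n → ℝ) := by
    simp only [dotProduct, mulVec]
    fun_prop
  have : Nontrivial (EuclideanSpace ℝ n) := inferInstance
  -- The constant is the minimum of the form on the unit sphere; homogeneity extends the bound to
  -- all vectors.
  obtain ⟨v₀, hv₀, hmin⟩ := (isCompact_sphere (0 : EuclideanSpace ℝ n) 1).exists_isMinOn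
    (NormedSpace.sphere_nonempty.2 zero_le_one) hcont.continuousOn
  have hv₀' : (v₀ : n → ℝ) ≠ 0 := by
    intro h
    have : v₀ = 0 := by ext i; exact congrFun h i
    simp [this] at hv₀
  refine ⟨(v₀ : n → ℝ) ⬝ᵥ Q *ᵥ (v₀ : n → ℝ), ?_, fun v => ?_⟩
  · simpa using hQ.dotProduct_mulVec_pos hv₀'
  by_cases hv : v = 0
  · simp [hv]
  set w : EuclideanSpace ℝ n := WithLp.toLp 2 v with hw
  have hw0 : w ≠ 0 := by
    intro h
    apply hv
    ext i
    have := congrArg (fun u : EuclideanSpace ℝ n => u i) h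
    simpa [hw] using this
  have hnw : 0 < ‖w‖ := norm_pos_iff.2 hw0
  have h1 := hmin (a := (‖w‖⁻¹ : ℝ) • w) (by simp [norm_smul, hnw.ne'])
  have h2 : ((‖w‖⁻¹ • w : EuclideanSpace ℝ n) : n → ℝ) = ‖w‖⁻¹ • v := by
    ext i; simp [hw]
  simp only [Set.mem_ofPred_eq, h2] at h1
  rw [mulVec_smul, dotProduct_smul, smul_dotProduct, smul_eq_mul, smul_eq_mul] at h1
  have h3 : ∑ i, v i ^ 2 = ‖w‖ ^ 2 := by
    rw [EuclideanSpace.norm_sq_eq]; simp [hw]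
  rw [h3]
  calc _ ≤ ‖w‖⁻¹ * (‖w‖⁻¹ * v ⬝ᵥ Q *ᵥ v) * ‖w‖ ^ 2 := by gcongr
    _ = v ⬝ᵥ Q *ᵥ v := by field_simp

end

/-! ### Periodization and Poisson summation. -/

noncomputable section

open MeasureTheory Complex

variable {n : Type*}

/-- The lift of a periodic continuous function to the torus. -/
theorem exists_lift_unitAddTorus {F : (n → ℝ) → ℂ} (hF : Continuous F)
    (hper : ∀ (v : n → ℝ) (m : n → ℤ), F (fun i => v i + m i) = F v) :
    ∃ G : C(UnitAddTorus n, ℂ), ∀ v : n → ℝ, G (fun i => (v i : UnitAddCircle)) = F v := by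
  -- Openness matters: a product of quotient maps need not be a quotient map, but a product of open
  -- ones is.
  have hq : IsOpenQuotientMap (Pi.map fun (_ : n) (x : ℝ) => (x : UnitAddCircle)) :=
    IsOpenQuotientMap.piMap fun _ => QuotientAddGroup.isOpenQuotientMap_mk
  let q : C(n → ℝ, UnitAddTorus n) := ⟨_, hq.continuous⟩
  have hq' : Topology.IsQuotientMap q := hq.isQuotientMap
  have hfac : Function.FactorsThrough (⟨F, hF⟩ : C(n → ℝ, ℂ)) q := by
    intro v w hvw
    have h : ∀ i, ∃ m : ℤ, w i = v i + m := by
      intro i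
      have h1 : ((v i : ℝ) : UnitAddCircle) = w i := congrFun hvw i
      obtain ⟨m, hm⟩ := (QuotientAddGroup.eq_iff_sub_mem.1 h1.symm)
      refine ⟨m, ?_⟩
      simp only [zsmul_eq_mul, mul_one] at hm
      linarith
    choose m hm using h
    have : w = fun i => v i + m i := funext hm
    rw [this]
    exact (hper v m).symm
  refine ⟨hq'.lift ⟨F, hF⟩ hfac, fun v => ?_⟩
  exact congrArg (fun g : C(n → ℝ, ℂ) => g v) (hq'.lift_comp ⟨F, hF⟩ hfac)

variable [Fintype n]

theorem sum_add_sq_ge (v w : n → ℝ) :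
    (∑ i, w i ^ 2) / 2 - ∑ i, v i ^ 2 ≤ ∑ i, (v i + w i) ^ 2 := by
  rw [Finset.sum_div, ← Finset.sum_sub_distrib]
  refine Finset.sum_le_sum fun i _ => ?_
  nlinarith [sq_nonneg (2 * v i + w i)]

variable {f : (n → ℝ) → ℂ} {K c : ℝ}

/-- Half of the decay rate pays for the shift. The bound is uniform for `v` in a ball, so it serves
both for the continuity of the periodization and for integrating it term by term. -/
theorem norm_shift_le (hc : 0 < c) (hf : ∀ v, ‖f v‖ ≤ K * Real.exp (-c * ∑ i, v i ^ 2))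
    (v : n → ℝ) {ρ : ℝ} (hv : ∑ i, v i ^ 2 ≤ ρ) (m : n → ℤ) :
    ‖f (fun i => v i + m i)‖ ≤
      K * Real.exp (c * ρ) * Real.exp (-(c / 2) * ∑ i, (m i : ℝ) ^ 2) := by
  have hK : 0 ≤ K := by
    have h := (norm_nonneg _).trans (hf 0)
    exact nonneg_of_mul_nonneg_left h (Real.exp_pos _)
  refine (hf _).trans ?_
  rw [mul_assoc, ← Real.exp_add]
  gcongr
  have := sum_add_sq_ge v fun i => (m i : ℝ)
  nlinarith

theorem integrable_of_gaussian_bound (hc : 0 < c) (hcont : Continuous f)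
    (hf : ∀ v, ‖f v‖ ≤ K * Real.exp (-c * ∑ i, v i ^ 2)) : Integrable f := by
  have h1 := (GaussianFourier.integrable_cexp_neg_mul_sum_add (ι := n) (b := (c : ℂ))
    (by simpa using hc) 0).norm.const_mul K
  refine h1.mono' hcont.aestronglyMeasurable (Filter.Eventually.of_forall fun v => ?_)
  refine (hf v).trans (le_of_eq ?_)
  rw [Complex.norm_exp]
  congr 2
  simp [← Complex.ofReal_pow, ← Complex.ofReal_sum, ← Complex.ofReal_mul]

theorem continuous_tsum_shift (hc : 0 < c) (hcont : Continuous f)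
    (hf : ∀ v, ‖f v‖ ≤ K * Real.exp (-c * ∑ i, v i ^ 2)) :
    Continuous fun v : n → ℝ => ∑' m : n → ℤ, f (fun i => v i + m i) := by
  rw [continuous_iff_continuousAt]
  intro v₀
  let U : Set (n → ℝ) := {v | ∑ i, v i ^ 2 < ∑ i, v₀ i ^ 2 + 1}
  have hU : IsOpen U := isOpen_lt (by fun_prop) continuous_const
  have hmem : v₀ ∈ U := by simp [U]
  refine ContinuousOn.continuousAt ?_ (hU.mem_nhds hmem)
  refine continuousOn_tsum (fun m => (hcont.comp (by fun_prop)).continuousOn)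
    ((summable_exp_neg_mul_sum_sq (n := n) (half_pos hc)).mul_left
      (K * Real.exp (c * (∑ i, v₀ i ^ 2 + 1)))) fun m v hv => ?_
  exact norm_shift_le hc hf v hv.le m

/-- Half-open unit cubes with integral corners tile space, and translation carries each to the
standard one. This is the unfolding step of Poisson summation. -/
theorem integral_eq_tsum_box {h : (n → ℝ) → ℂ} (hh : Integrable h) :
    ∫ v, h v = ∑' m : n → ℤ,
      ∫ v in {v : n → ℝ | ∀ i, v i ∈ Set.Ioc (0 : ℝ) (0 + 1)}, h (fun i => v i + m i) := by
  let B : (n → ℤ) → Set (n → ℝ) := fun m => {v | ∀ i, v i ∈ Set.Ioc (m i : ℝ) (m i + 1)}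
  have hBmeas : ∀ m, MeasurableSet (B m) := by
    intro m
    have : B m = Set.univ.pi fun i => Set.Ioc (m i : ℝ) (m i + 1) := by
      ext v; simp [B]
    rw [this]
    exact MeasurableSet.univ_pi fun i => measurableSet_Ioc
  -- The cubes are open on the left and closed on the right, so the corner belonging to `v` is `⌈v
  -- i⌉ - 1` and not the floor.
  have hmemB : ∀ v m, v ∈ B m ↔ ∀ i, m i = ⌈v i⌉ - 1 := by
    intro v m
    refine forall_congr' fun i => ?_
    rw [eq_comm, sub_eq_iff_eq_add, Int.ceil_eq_iff]
    simp [Set.mem_Ioc]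
  have hdisj : Pairwise (Function.onFun Disjoint B) := by
    intro m m' hmm
    rw [Function.onFun, Set.disjoint_left]
    intro v hv hv'
    refine hmm (funext fun i => ?_)
    rw [(hmemB v m).1 hv i, (hmemB v m').1 hv' i]
  have hU : ⋃ m, B m = Set.univ := by
    refine Set.eq_univ_of_forall fun v => Set.mem_iUnion.2 ⟨fun i => ⌈v i⌉ - 1, ?_⟩
    rw [hmemB]; simp
  rw [← setIntegral_univ, ← hU, integral_iUnion hBmeas hdisj (by rw [hU]; exact hh.integrableOn)]
  refine tsum_congr fun m => ?_
  have hmp : MeasurePreserving (fun v : n → ℝ => v + fun i => (m i : ℝ)) volume volume :=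
    measurePreserving_add_right _ _
  rw [← hmp.setIntegral_preimage_emb (measurableEmbedding_addRight _)]
  congr 2
  ext v
  simp only [B, Set.mem_preimage, Set.mem_ofPred_eq, Pi.add_apply, Set.mem_Ioc]
  refine forall_congr' fun i => ?_
  constructor <;> rintro ⟨h1, h2⟩ <;> constructor <;> linarith

theorem mFourier_coe (k : n → ℤ) (v : n → ℝ) :
    UnitAddTorus.mFourier k (fun i => (v i : UnitAddCircle)) =
      cexp (2 * Real.pi * I * ∑ i, (k i : ℂ) * v i) := by
  simp only [UnitAddTorus.mFourier, ContinuousMap.coe_mk, fourier_coe_apply, Finset.mul_sum,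
    Complex.exp_sum]
  refine Finset.prod_congr rfl fun i _ => ?_
  congr 1
  push_cast
  ring

/-- Poisson summation on `ℤⁿ` for continuous functions of Gaussian decay. -/
theorem poisson_summation_pi (hc : 0 < c) (hcont : Continuous f)
    (hf : ∀ v, ‖f v‖ ≤ K * Real.exp (-c * ∑ i, v i ^ 2))
    (hs : Summable fun k : n → ℤ =>
      ∫ v : n → ℝ, cexp (-(2 * Real.pi * I * ∑ i, (k i : ℂ) * v i)) * f v) :
    ∑' m : n → ℤ, f (fun i => (m i : ℝ)) = ∑' k : n → ℤ,
      ∫ v : n → ℝ, cexp (-(2 * Real.pi * I * ∑ i, (k i : ℂ) * v i)) * f v := by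
  -- `G` is the periodization of `f` on the torus. Its Fourier coefficients unfold to the Fourier
  -- integrals of `f`, and the formula is its Fourier series at `0`.
  obtain ⟨G, hG⟩ := exists_lift_unitAddTorus (continuous_tsum_shift hc hcont hf) (by
    intro v m
    rw [← (Equiv.addLeft m).tsum_eq fun m' : n → ℤ => f (fun i => v i + m' i)]
    refine tsum_congr fun m' => congrArg f (funext fun i => ?_)
    simp [add_assoc])
  have hcoeff : ∀ k : n → ℤ, UnitAddTorus.mFourierCoeff G k =
      ∫ v : n → ℝ, cexp (-(2 * Real.pi * I * ∑ i, (k i : ℂ) * v i)) * f v := by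
    intro k
    set h : (n → ℝ) → ℂ := fun v => cexp (-(2 * Real.pi * I * ∑ i, (k i : ℂ) * v i)) * f v with hh
    have hnorm : ∀ v, ‖h v‖ = ‖f v‖ := by
      intro v
      rw [hh, norm_mul, Complex.norm_exp]
      simp
    have hhcont : Continuous h := by
      rw [hh]; fun_prop
    have hhb : ∀ v, ‖h v‖ ≤ K * Real.exp (-c * ∑ i, v i ^ 2) := fun v => (hnorm v).trans_le (hf v)
    rw [integral_eq_tsum_box (integrable_of_gaussian_bound hc hhcont hhb),
      UnitAddTorus.mFourierCoeff_eq_integral _ _ 0]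
    set S : Set (n → ℝ) := {v : n → ℝ | ∀ i, v i ∈ Set.Ioc (0 : ℝ) (0 + 1)} with hS
    have hSpi : S = Set.univ.pi fun i => Set.Ioc (0 : ℝ) (0 + 1) := by ext v; simp [S]
    have hSmeas : MeasurableSet S := by
      rw [hSpi]; exact MeasurableSet.univ_pi fun i => measurableSet_Ioc
    have hSvol : volume S = 1 := by
      rw [hSpi, volume_pi_pi]; simp
    have hbound : ∀ m : n → ℤ, ∀ v ∈ S, ‖h (fun i => v i + m i)‖ ≤
        K * Real.exp (c * Fintype.card n) * Real.exp (-(c / 2) * ∑ i, (m i : ℝ) ^ 2) := by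
      intro m v hv
      refine norm_shift_le hc hhb v ?_ m
      calc ∑ i, v i ^ 2 ≤ ∑ i : n, (1 : ℝ) := by
            refine Finset.sum_le_sum fun i _ => ?_
            have := hv i
            simp only [zero_add, Set.mem_Ioc] at this
            nlinarith
        _ = _ := by simp
    have hint : ∀ m : n → ℤ, Integrable (fun v => h (fun i => v i + m i)) (volume.restrict S) := by
      intro m
      refine (integrable_of_gaussian_bound hc hhcont hhb).comp_add_right (fun i => (m i : ℝ))
        |>.integrableOn
    have hsum : Summable fun m : n → ℤ => ∫ v in S, ‖h (fun i => v i + m i)‖ := by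
      refine Summable.of_nonneg_of_le (fun m => integral_nonneg fun v => norm_nonneg _)
        (fun m => ?_) ((summable_exp_neg_mul_sum_sq (n := n) (half_pos hc)).mul_left
          (K * Real.exp (c * Fintype.card n)))
      calc _ ≤ ∫ v in S, K * Real.exp (c * Fintype.card n) *
              Real.exp (-(c / 2) * ∑ i, (m i : ℝ) ^ 2) := by
            refine setIntegral_mono_on (hint m).norm ?_ hSmeas (hbound m)
            exact integrableOn_const (by simp [hSvol])
        _ = _ := by simp [Measure.real, hSvol]
    rw [(hasSum_integral_of_summable_integral_norm hint hsum).tsum_eq]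
    refine setIntegral_congr_fun hSmeas fun v _ => ?_
    rw [hG, mFourier_coe, smul_eq_mul, ← tsum_mul_left]
    refine tsum_congr fun m => ?_
    simp only [hh]
    congr 1
    -- The pairing of `k` with `m` is an integer, so the character does not see the shift by `m`.
    rw [Complex.exp_eq_exp_iff_exists_int]
    refine ⟨∑ i, k i * m i, ?_⟩
    push_cast
    simp only [mul_add, Finset.sum_add_distrib, Pi.neg_apply, Int.cast_neg, neg_mul,
      Finset.sum_neg_distrib]
    ring
  have hs' : Summable (UnitAddTorus.mFourierCoeff G) := hs.congr fun k => (hcoeff k).symm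
  have := UnitAddTorus.hasSum_mFourier_series_apply_of_summable hs' (fun i => ((0 : ℝ) : UnitAddCircle))
  have h0 := hG 0
  simp only [Pi.zero_apply, zero_add] at h0
  rw [h0] at this
  rw [← this.tsum_eq]
  refine tsum_congr fun k => ?_
  have h1 := mFourier_coe k (0 : n → ℝ)
  simp only [Pi.zero_apply] at h1
  rw [h1, hcoeff]
  simp

end

/-! ### Fourier transforms of Gaussians and inversion of Gaussian sums. -/

noncomputable section

open MeasureTheory Complex

variable {n : Type*} [Fintype n]

theorem ofReal_dotProduct_mulVec (P : Matrix n n ℝ) (v w : n → ℝ) :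
    (fun i => (v i : ℂ)) ⬝ᵥ P.map ofReal *ᵥ (fun i => (w i : ℂ)) = ((v ⬝ᵥ P *ᵥ w : ℝ) : ℂ) := by
  simp [dotProduct, mulVec]

/-- Completing the square, `l v ≤ l² / (4ε) + ε v²`, makes the linear term cost only half of the
quadratic decay. -/
theorem exists_gaussian_bound {P : Matrix n n ℝ} (hP : P.PosDef) {β : ℂ} (hβ : 0 < β.re)
    (l : n → ℂ) (κ : ℂ) : ∃ K c : ℝ, 0 < c ∧ ∀ v : n → ℝ,
      ‖cexp (-(β * ((fun i => (v i : ℂ)) ⬝ᵥ P.map ofReal *ᵥ (fun i => (v i : ℂ)))) +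
        ∑ i, l i * v i + κ)‖ ≤ K * Real.exp (-c * ∑ i, v i ^ 2) := by
  obtain ⟨c₀, hc₀, hle⟩ := hP.exists_pos_mul_sum_sq_le
  set ε := β.re * c₀ / 2 with hε
  have hεpos : 0 < ε := by positivity
  refine ⟨Real.exp (∑ i, (l i).re ^ 2 / (4 * ε) + κ.re), ε, hεpos, fun v => ?_⟩
  rw [Complex.norm_exp, ← Real.exp_add, Real.exp_le_exp, ofReal_dotProduct_mulVec]
  simp only [add_re, neg_re, re_mul_ofReal, re_sum]
  have h1 : ∑ i, (l i).re * v i ≤ ∑ i, (l i).re ^ 2 / (4 * ε) + ε * ∑ i, v i ^ 2 := by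
    rw [Finset.mul_sum, ← Finset.sum_add_distrib]
    refine Finset.sum_le_sum fun i _ => ?_
    rw [← sub_nonneg]
    have : (l i).re ^ 2 / (4 * ε) + ε * v i ^ 2 - (l i).re * v i =
        ((l i).re - 2 * ε * v i) ^ 2 / (4 * ε) := by
      field_simp
      ring
    rw [this]
    positivity
  have h2 : β.re * (c₀ * ∑ i, v i ^ 2) ≤ β.re * (v ⬝ᵥ P *ᵥ v) := by
    gcongr
    exact hle v
  have h3 : β.re * (c₀ * ∑ i, v i ^ 2) = 2 * ε * ∑ i, v i ^ 2 := by rw [hε]; ring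
  linarith

variable [DecidableEq n]

theorem integral_comp_mulVec {S : Matrix n n ℝ} (hS : S.det ≠ 0) {g : (n → ℝ) → ℂ}
    (hg : Continuous g) : ∫ v : n → ℝ, g (S *ᵥ v) = |S.det|⁻¹ * ∫ v, g v := by
  have h := integral_map (μ := (volume : Measure (n → ℝ))) (φ := Matrix.toLin' S)
    (by exact (Continuous.measurable (LinearMap.continuous_of_finiteDimensional _)).aemeasurable)
    (f := g) hg.aestronglyMeasurable
  rw [Real.map_matrix_volume_pi_eq_smul_volume_pi hS] at h
  simp only [toLin'_apply] at h
  rw [← h, integral_smul_measure, ENNReal.toReal_ofReal (abs_nonneg _), abs_inv]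
  simp

/-- The Fourier transform of a Gaussian with complex shift. -/
theorem integral_gaussian_posDef {Q : Matrix n n ℝ} (hQ : Q.PosDef) {j : ℕ}
    (hj : Fintype.card n = 2 * j) {ω : ℂ} (hω : 0 < ω.im) (u : n → ℂ) :
    ∫ v : n → ℝ, cexp (Real.pi * I * (ω *
        ((fun i => (v i : ℂ)) ⬝ᵥ Q.map ofReal *ᵥ (fun i => (v i : ℂ))) + 2 * ∑ i, u i * v i)) =
      (√Q.det)⁻¹ * ((-I * ω)⁻¹) ^ j *
        cexp (-(Real.pi * I / ω * (u ⬝ᵥ (Q⁻¹).map ofReal *ᵥ u))) := by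
  -- In the coordinates `S v` the Gaussian is a product of one-dimensional ones, and the Jacobian is
  -- `|det S| = √(det Q)`.
  obtain ⟨S, hS⟩ : ∃ S : Matrix n n ℝ, Q = Sᵀ * S := by
    open scoped MatrixOrder in
    obtain ⟨S, hS⟩ := CStarAlgebra.nonneg_iff_eq_star_mul_self.1 hQ.posSemidef.nonneg
    exact ⟨S, by simpa [Matrix.star_eq_conjTranspose, conjTranspose_eq_transpose_of_trivial] using hS⟩
  have hdetQ : Q.det = S.det ^ 2 := by rw [hS, det_mul, det_transpose, sq]
  have hSdet : S.det ≠ 0 := by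
    intro h
    have := hQ.det_pos
    rw [hdetQ, h] at this
    simp at this
  have hω0 : ω ≠ 0 := fun h => by simp [h] at hω
  set Sc : Matrix n n ℂ := S.map ofReal with hSc
  have hScdet : IsUnit Sc.det := by
    have : Sc.det = (S.det : ℂ) := by
      rw [hSc]; exact (RingHom.map_det (ofRealHom) S).symm
    rw [this]
    exact isUnit_iff_ne_zero.2 (by exact_mod_cast hSdet)
  have hQc : Q.map ofReal = Scᵀ * Sc := by
    rw [hS, hSc]
    have := Matrix.map_mul (L := Sᵀ) (M := S) (f := ofRealHom)
    exact this
  have hQinv : (Q⁻¹).map ofReal = (Scᵀ * Sc)⁻¹ := by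
    rw [← hQc]
    have h1 : (Q⁻¹).map ofReal * Q.map ofReal = 1 := by
      have h2 : Q⁻¹ * Q = 1 := nonsing_inv_mul _ (isUnit_iff_ne_zero.2 hQ.det_pos.ne')
      have := congrArg (fun M : Matrix n n ℝ => M.map ofRealHom) h2
      simp only [Matrix.map_mul] at this
      rw [Matrix.map_one _ (map_zero _) (map_one _)] at this
      exact this
    exact (inv_eq_left_inv h1).symm
  set t : n → ℂ := (Sc⁻¹)ᵀ *ᵥ u with ht
  have htS : ∀ v : n → ℂ, ∑ i, u i * v i = ∑ i, t i * (Sc *ᵥ v) i := by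
    intro v
    change u ⬝ᵥ v = t ⬝ᵥ Sc *ᵥ v
    rw [dotProduct_mulVec, ht, mulVec_transpose, vecMul_vecMul, nonsing_inv_mul _ hScdet,
      vecMul_one]
  have hmv : ∀ v : n → ℝ, Sc *ᵥ (fun i => (v i : ℂ)) = fun i => ((S *ᵥ v) i : ℂ) := by
    intro v; ext i; simp [hSc, mulVec, dotProduct]
  let g : (n → ℝ) → ℂ := fun w =>
    cexp (-∑ i, (-(Real.pi * I * ω)) * (w i : ℂ) ^ 2 + ∑ i, (2 * Real.pi * I * t i) * w i)
  have hfg : ∀ v : n → ℝ, cexp (Real.pi * I * (ω *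
      ((fun i => (v i : ℂ)) ⬝ᵥ Q.map ofReal *ᵥ (fun i => (v i : ℂ))) + 2 * ∑ i, u i * v i)) =
      g (S *ᵥ v) := by
    intro v
    simp only [g]
    congr 1
    rw [hQc, ← mulVec_mulVec, dotProduct_mulVec, vecMul_transpose, htS, hmv]
    simp only [dotProduct, mul_add, Finset.mul_sum, ← Finset.sum_neg_distrib]
    congr 1 <;> refine Finset.sum_congr rfl fun i _ => ?_ <;> ring
  simp_rw [hfg]
  rw [integral_comp_mulVec hSdet (by simp only [g]; fun_prop)]
  simp only [g]
  rw [GaussianFourier.integral_cexp_neg_sum_mul_add (b := fun _ => -(Real.pi * I * ω))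
    (fun _ => by simp; positivity)]
  -- In even dimension `2j` the square roots combine to a `j`-th power, so no branch has to be
  -- followed.
  rw [Finset.prod_mul_distrib, Finset.prod_const, Finset.card_univ, hj, pow_mul,
    ← Complex.cpow_nat_mul, ← Complex.exp_sum, ← mul_assoc]
  congr 2
  · congr 1
    rw [hdetQ, Real.sqrt_sq_eq_abs]
  · have hpi : (Real.pi : ℂ) ≠ 0 := by exact_mod_cast Real.pi_ne_zero
    congr 1
    norm_num
    field_simp
    rw [I_sq]
  · rw [hQinv, Matrix.mul_inv_rev, ← mulVec_mulVec, ← transpose_nonsing_inv, ← ht,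
      dotProduct_mulVec, ← mulVec_transpose, ← ht, dotProduct, Finset.mul_sum,
      ← Finset.sum_neg_distrib]
    refine Finset.sum_congr rfl fun i _ => ?_
    have hpi : (Real.pi : ℂ) ≠ 0 := by exact_mod_cast Real.pi_ne_zero
    field_simp
    norm_num
    ring

/-- Expanding about `u` gives a Gaussian for `Q⁻¹` with a linear term, and `Re(πi/ω) = π Im ω /
|ω|²` is positive. -/
theorem summable_gaussian_dual {Q : Matrix n n ℝ} (hQ : Q.PosDef) {ω : ℂ} (hω : 0 < ω.im)
    (u : n → ℂ) :
    Summable fun k : n → ℤ => cexp (-(Real.pi * I / ω *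
      ((fun i => u i - k i) ⬝ᵥ (Q⁻¹).map ofReal *ᵥ fun i => u i - k i))) := by
  have hω0 : ω ≠ 0 := fun h => by simp [h] at hω
  have hre : 0 < (Real.pi * I / ω).re := by
    rw [Complex.div_re]
    simp only [mul_re, ofReal_re, I_re, mul_zero, ofReal_im, I_im, mul_one, sub_self, zero_mul,
      zero_div, zero_add, mul_im, add_zero]
    have : 0 < normSq ω := normSq_pos.2 hω0
    positivity
  set Pc := (Q⁻¹).map ofReal with hPc
  have hsymm : Pcᵀ = Pc := by
    have h : (Q⁻¹)ᵀ = Q⁻¹ := by simpa using hQ.inv.isHermitian.eq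
    rw [hPc, ← transpose_map, h]
  obtain ⟨K', c', hc', hb'⟩ := exists_gaussian_bound hQ.inv hre
    (fun i => 2 * (Real.pi * I / ω) * (Pc *ᵥ u) i) (-(Real.pi * I / ω * (u ⬝ᵥ Pc *ᵥ u)))
  refine Summable.of_norm_bounded
    ((summable_exp_neg_mul_sum_sq (n := n) hc').mul_left K') fun k => ?_
  refine le_of_eq_of_le ?_ (hb' fun i => (k i : ℝ))
  congr 2
  have h1 : (fun i => u i - (k i : ℂ)) = u - fun i => ((k i : ℝ) : ℂ) := by ext i; simp
  rw [h1, mulVec_sub, sub_dotProduct, dotProduct_sub, dotProduct_sub]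
  set w : n → ℂ := fun i => ((k i : ℝ) : ℂ) with hw
  have h2 : u ⬝ᵥ Pc *ᵥ w = w ⬝ᵥ Pc *ᵥ u := by
    rw [dotProduct_mulVec, ← mulVec_transpose, hsymm, dotProduct_comm]
  have h3 : ∑ i, 2 * (Real.pi * I / ω) * (Pc *ᵥ u) i * w i =
      2 * (Real.pi * I / ω) * (w ⬝ᵥ Pc *ᵥ u) := by
    rw [dotProduct, Finset.mul_sum]
    exact Finset.sum_congr rfl fun i _ => by ring
  rw [h2, h3]
  ring

omit [DecidableEq n] in
theorem summable_gaussian {Q : Matrix n n ℝ} (hQ : Q.PosDef) {ω : ℂ} (hω : 0 < ω.im)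
    (u : n → ℂ) :
    Summable fun m : n → ℤ => cexp (Real.pi * I * (ω *
        ((fun i => (m i : ℂ)) ⬝ᵥ Q.map ofReal *ᵥ (fun i => (m i : ℂ))) + 2 * ∑ i, u i * m i)) := by
  obtain ⟨K, c, hc, hb⟩ := exists_gaussian_bound hQ (β := -(Real.pi * I * ω))
    (by simp; positivity) (fun i => 2 * Real.pi * I * u i) 0
  refine Summable.of_norm_bounded
    ((summable_exp_neg_mul_sum_sq (n := n) hc).mul_left K) fun m => ?_
  refine le_of_eq_of_le ?_ (hb fun i => (m i : ℝ))
  congr 2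
  simp only [mul_add, Finset.mul_sum, add_zero, ofReal_intCast]
  congr 1
  · ring
  · exact Finset.sum_congr rfl fun i _ => by ring

/-- The inversion formula for Gaussian sums over `ℤⁿ`. -/
theorem tsum_gaussian_posDef {Q : Matrix n n ℝ} (hQ : Q.PosDef) {j : ℕ}
    (hj : Fintype.card n = 2 * j) {ω : ℂ} (hω : 0 < ω.im) (u : n → ℂ) :
    ∑' m : n → ℤ, cexp (Real.pi * I * (ω *
        ((fun i => (m i : ℂ)) ⬝ᵥ Q.map ofReal *ᵥ (fun i => (m i : ℂ))) + 2 * ∑ i, u i * m i)) =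
      (√Q.det)⁻¹ * ((-I * ω)⁻¹) ^ j * ∑' k : n → ℤ,
        cexp (-(Real.pi * I / ω * ((fun i => u i - k i) ⬝ᵥ (Q⁻¹).map ofReal *ᵥ
          fun i => u i - k i))) := by
  have hint : ∀ k : n → ℤ, ∫ v : n → ℝ, cexp (-(2 * Real.pi * I * ∑ i, (k i : ℂ) * v i)) *
      cexp (Real.pi * I * (ω *
        ((fun i => (v i : ℂ)) ⬝ᵥ Q.map ofReal *ᵥ (fun i => (v i : ℂ))) + 2 * ∑ i, u i * v i)) =
      (√Q.det)⁻¹ * ((-I * ω)⁻¹) ^ j * cexp (-(Real.pi * I / ω *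
        ((fun i => u i - k i) ⬝ᵥ (Q⁻¹).map ofReal *ᵥ fun i => u i - k i))) := by
    intro k
    rw [← integral_gaussian_posDef hQ hj hω]
    congr 1
    ext v
    rw [← Complex.exp_add]
    congr 1
    simp only [sub_mul, Finset.sum_sub_distrib]
    ring
  obtain ⟨K, c, hc, hb⟩ := exists_gaussian_bound hQ (β := -(Real.pi * I * ω))
    (by simp; positivity) (fun i => 2 * Real.pi * I * u i) 0
  have h := poisson_summation_pi (n := n) (f := fun v => cexp (Real.pi * I * (ω *
    ((fun i => (v i : ℂ)) ⬝ᵥ Q.map ofReal *ᵥ (fun i => (v i : ℂ))) + 2 * ∑ i, u i * v i)))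
    (K := K) hc (by simp only [dotProduct, mulVec]; fun_prop) (fun v => by
      refine le_of_eq_of_le ?_ (hb v)
      congr 2
      simp only [mul_add, Finset.mul_sum, add_zero]
      congr 1
      · ring
      · exact Finset.sum_congr rfl fun i _ => by ring)
    (by simp_rw [hint]; exact (summable_gaussian_dual hQ hω u).mul_left _)
  simp_rw [hint, tsum_mul_left] at h
  simpa using h

end

noncomputable section

open Complex

/-! ## The action on the Siegel half space -/

/-- The complex matrix of a rational symplectic matrix. -/
def Sp2Q.toComplex (γ : Sp2Q) : Matrix Idx Idx ℂ :=
  (γ : Matrix Idx Idx ℚ).map (Rat.cast : ℚ → ℂ)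

/-- The numerator `A Ω + B`. -/
def Sp2Q.num (γ : Sp2Q) (Ω : Matrix (Fin 2) (Fin 2) ℂ) : Matrix (Fin 2) (Fin 2) ℂ :=
  γ.toComplex.toBlocks₁₁ * Ω + γ.toComplex.toBlocks₁₂

/-- The denominator `C Ω + D`. -/
def Sp2Q.den (γ : Sp2Q) (Ω : Matrix (Fin 2) (Fin 2) ℂ) : Matrix (Fin 2) (Fin 2) ℂ :=
  γ.toComplex.toBlocks₂₁ * Ω + γ.toComplex.toBlocks₂₂

/-- The action `(A Ω + B)(C Ω + D)⁻¹`. -/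
def Sp2Q.act (γ : Sp2Q) (Ω : Matrix (Fin 2) (Fin 2) ℂ) : Matrix (Fin 2) (Fin 2) ℂ :=
  γ.num Ω * (γ.den Ω)⁻¹

theorem slash_eq_act (k : ℤ) (f : Matrix (Fin 2) (Fin 2) ℂ → ℂ) (γ : Sp2Q)
    (Ω : Matrix (Fin 2) (Fin 2) ℂ) :
    slash k f γ Ω = (γ.den Ω).det ^ (-k) * f (γ.act Ω) := rfl

open scoped ComplexOrder

namespace Sp2Q

variable (γ δ : Sp2Q) {Ω : Matrix (Fin 2) (Fin 2) ℂ}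

theorem toComplex_mem : γ.toComplex ∈ Matrix.symplecticGroup (Fin 2) ℂ :=
  SymplecticGroup.map_mem γ.2 (algebraMap ℚ ℂ)

theorem toComplex_mul : (γ * δ).toComplex = γ.toComplex * δ.toComplex :=
  Matrix.map_mul (f := algebraMap ℚ ℂ)

theorem block_relations :
    (γ.toComplex.toBlocks₁₁)ᵀ * γ.toComplex.toBlocks₂₁ =
        (γ.toComplex.toBlocks₂₁)ᵀ * γ.toComplex.toBlocks₁₁ ∧
    (γ.toComplex.toBlocks₁₂)ᵀ * γ.toComplex.toBlocks₂₂ =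
        (γ.toComplex.toBlocks₂₂)ᵀ * γ.toComplex.toBlocks₁₂ ∧
    (γ.toComplex.toBlocks₁₁)ᵀ * γ.toComplex.toBlocks₂₂ -
        (γ.toComplex.toBlocks₂₁)ᵀ * γ.toComplex.toBlocks₁₂ = 1 := by
  have h := SymplecticGroup.fromBlocks_mem_iff.1
    ((fromBlocks_toBlocks γ.toComplex).symm ▸ γ.toComplex_mem)
  exact h

theorem conj_toBlocks :
    (γ.toComplex.toBlocks₁₁)ᴴ = (γ.toComplex.toBlocks₁₁)ᵀ ∧
    (γ.toComplex.toBlocks₁₂)ᴴ = (γ.toComplex.toBlocks₁₂)ᵀ ∧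
    (γ.toComplex.toBlocks₂₁)ᴴ = (γ.toComplex.toBlocks₂₁)ᵀ ∧
    (γ.toComplex.toBlocks₂₂)ᴴ = (γ.toComplex.toBlocks₂₂)ᵀ := by
  refine ⟨?_, ?_, ?_, ?_⟩ <;> ext i j <;>
    simp [toComplex, toBlocks₁₁, toBlocks₁₂, toBlocks₂₁, toBlocks₂₂]

theorem sub_conjTranspose_eq (hΩ : Ω.IsSymm) :
    Ω - Ωᴴ = (2 * I) • (Ω.map Complex.im).map ofReal := by
  ext i j
  have h : Ω j i = Ω i j := hΩ.apply i j
  simp only [Matrix.sub_apply, conjTranspose_apply, h, Matrix.smul_apply, map_apply, smul_eq_mul]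
  apply Complex.ext <;> simp
  ring

/-- This is the invariance of the symplectic form, read off on the columns `(Ω, 1)`. It is used
twice: it makes `CΩ + D` invertible, and it shows that the imaginary part transforms by a
congruence. -/
theorem den_conjTranspose_mul_num :
    (γ.den Ω)ᴴ * γ.num Ω - (γ.num Ω)ᴴ * γ.den Ω = Ω - Ωᴴ := by
  obtain ⟨hA, hB, hC, hD⟩ := γ.conj_toBlocks
  obtain ⟨h1, h2, h3⟩ := γ.block_relations
  have h4 := congrArg Matrix.transpose h3
  simp only [transpose_sub, transpose_mul, transpose_transpose, transpose_one] at h4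
  simp only [num, den, conjTranspose_add, conjTranspose_mul, hA, hB, hC, hD]
  generalize γ.toComplex.toBlocks₁₁ = A at *
  generalize γ.toComplex.toBlocks₁₂ = B at *
  generalize γ.toComplex.toBlocks₂₁ = C at *
  generalize γ.toComplex.toBlocks₂₂ = D at *
  -- The terms are grouped so that each bracket is one of the block relations or its transpose.
  have e : (Ωᴴ * Cᵀ + Dᵀ) * (A * Ω + B) - (Ωᴴ * Aᵀ + Bᵀ) * (C * Ω + D) =
      Ωᴴ * (Cᵀ * A - Aᵀ * C) * Ω - Ωᴴ * (Aᵀ * D - Cᵀ * B) + (Dᵀ * A - Bᵀ * C) * Ω +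
        (Dᵀ * B - Bᵀ * D) := by
    noncomm_ring
  rw [e, h1, h2, h3, h4]
  simp
  abel

/-- The Hermitian value at `v` is the sum of the real values at its real and imaginary parts. -/
theorem posDef_ofReal {Y : Matrix (Fin 2) (Fin 2) ℝ} (hY : Y.PosDef) : (Y.map ofReal).PosDef := by
  have hs : Yᵀ = Y := by simpa using hY.isHermitian.eq
  refine Matrix.PosDef.of_dotProduct_mulVec_pos ?_ fun v hv => ?_
  · ext i j
    have := congrFun (congrFun hs i) j
    simp only [transpose_apply] at this
    simp [this]
  · have h : star v ⬝ᵥ Y.map ofReal *ᵥ v =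
        (((fun i => (v i).re) ⬝ᵥ Y *ᵥ (fun i => (v i).re) +
          (fun i => (v i).im) ⬝ᵥ Y *ᵥ (fun i => (v i).im) : ℝ) : ℂ) := by
      have h01 : Y 1 0 = Y 0 1 := congrFun (congrFun hs 0) 1
      simp only [dotProduct, mulVec, Fin.sum_univ_two, Pi.star_apply, map_apply, h01]
      apply Complex.ext <;> simp <;> ring
    rw [h]
    have h0 : (fun i => (v i).re) ≠ 0 ∨ (fun i => (v i).im) ≠ 0 := by
      by_contra hcon
      push Not at hcon
      apply hv
      ext i
      exact Complex.ext (congrFun hcon.1 i) (congrFun hcon.2 i)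
    have hre := hY.posSemidef.dotProduct_mulVec_nonneg (fun i => (v i).re)
    have him := hY.posSemidef.dotProduct_mulVec_nonneg (fun i => (v i).im)
    simp only [star_trivial] at hre him
    rw [← ofReal_zero, Complex.real_lt_real]
    rcases h0 with h0 | h0
    · have := hY.dotProduct_mulVec_pos h0
      simp only [star_trivial] at this
      linarith
    · have := hY.dotProduct_mulVec_pos h0
      simp only [star_trivial] at this
      linarith

/-- A vector `v` killed by `CΩ + D` satisfies `v* (Ω - Ω*) v = 0` by `den_conjTranspose_mul_num`, so
it vanishes because `Im Ω > 0`. -/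
theorem isUnit_den (hΩ : Ω ∈ siegelHalfSpace) : IsUnit (γ.den Ω) := by
  rw [← Matrix.mulVec_injective_iff_isUnit]
  change Function.Injective (γ.den Ω).mulVecLin
  rw [injective_iff_map_eq_zero']
  intro v
  refine ⟨fun hv => ?_, fun h => by simp [h]⟩
  have hv' : γ.den Ω *ᵥ v = 0 := hv
  have h := congrArg (fun M => star v ⬝ᵥ M *ᵥ v) (γ.den_conjTranspose_mul_num (Ω := Ω))
  simp only [sub_mulVec, ← mulVec_mulVec, hv', mulVec_zero, dotProduct_sub, dotProduct_zero] at h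
  rw [dotProduct_mulVec, ← star_mulVec, hv', ← dotProduct_sub, ← sub_mulVec,
    sub_conjTranspose_eq hΩ.1, smul_mulVec, dotProduct_smul] at h
  simp only [star_zero, zero_dotProduct, sub_zero] at h
  by_contra hne
  have := (posDef_ofReal hΩ.2).dotProduct_mulVec_pos hne
  have h2 : (2 * I : ℂ) ≠ 0 := by simp
  rcases smul_eq_zero.1 h.symm with h3 | h3
  · exact h2 h3
  · exact this.ne' h3

theorem isUnit_det_den (hΩ : Ω ∈ siegelHalfSpace) : IsUnit (γ.den Ω).det :=
  (Matrix.isUnit_iff_isUnit_det _).1 (γ.isUnit_den hΩ)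

theorem act_mem (hΩ : Ω ∈ siegelHalfSpace) : γ.act Ω ∈ siegelHalfSpace := by
  have hu := γ.isUnit_det_den hΩ
  obtain ⟨h1, h2, h3⟩ := γ.block_relations
  have hs : Ωᵀ = Ω := hΩ.1
  have hsymm : (γ.act Ω).IsSymm := by
    have h4 := congrArg Matrix.transpose h3
    simp only [transpose_sub, transpose_mul, transpose_transpose, transpose_one] at h4
    have key : (γ.den Ω)ᵀ * γ.num Ω = (γ.num Ω)ᵀ * γ.den Ω := by
      simp only [num, den, transpose_add, transpose_mul, hs]
      generalize γ.toComplex.toBlocks₁₁ = A at *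
      generalize γ.toComplex.toBlocks₁₂ = B at *
      generalize γ.toComplex.toBlocks₂₁ = C at *
      generalize γ.toComplex.toBlocks₂₂ = D at *
      rw [← sub_eq_zero]
      have e : (Ω * Cᵀ + Dᵀ) * (A * Ω + B) - (Ω * Aᵀ + Bᵀ) * (C * Ω + D) =
          Ω * (Cᵀ * A - Aᵀ * C) * Ω - Ω * (Aᵀ * D - Cᵀ * B) + (Dᵀ * A - Bᵀ * C) * Ω +
            (Dᵀ * B - Bᵀ * D) := by
        noncomm_ring
      rw [e, h1, h2, h3, h4]
      simp
    have hut : IsUnit ((γ.den Ω)ᵀ).det := by rwa [det_transpose]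
    unfold Matrix.IsSymm act
    rw [transpose_mul, transpose_nonsing_inv]
    calc _ = ((γ.den Ω)ᵀ)⁻¹ * ((γ.num Ω)ᵀ * γ.den Ω) * (γ.den Ω)⁻¹ := by
          rw [Matrix.mul_assoc, Matrix.mul_assoc, mul_nonsing_inv _ hu, Matrix.mul_one]
      _ = _ := by
          rw [← key, ← Matrix.mul_assoc, nonsing_inv_mul _ hut, Matrix.one_mul]
  refine ⟨hsymm, ?_⟩
  -- The imaginary part of the image is the congruence transform of `Im Ω` by `(CΩ + D)⁻¹`, hence
  -- positive definite.
  have key : ((γ.act Ω).map Complex.im).map ofReal =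
      ((γ.den Ω)⁻¹)ᴴ * (Ω.map Complex.im).map ofReal * (γ.den Ω)⁻¹ := by
    have h2I : (2 * I : ℂ) ≠ 0 := by simp
    refine smul_right_injective _ h2I ?_
    simp only
    rw [← sub_conjTranspose_eq hsymm, ← Matrix.smul_mul, ← Matrix.mul_smul,
      ← sub_conjTranspose_eq hΩ.1, ← den_conjTranspose_mul_num γ (Ω := Ω)]
    have hu' : ((γ.den Ω)⁻¹)ᴴ * (γ.den Ω)ᴴ = 1 := by
      rw [← conjTranspose_mul, mul_nonsing_inv _ hu, conjTranspose_one]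
    rw [Matrix.mul_sub, Matrix.sub_mul, ← Matrix.mul_assoc, hu', Matrix.one_mul]
    congr 1
    rw [Matrix.mul_assoc, Matrix.mul_assoc, mul_nonsing_inv _ hu, Matrix.mul_one, act,
      conjTranspose_mul]
  have hpd : (((γ.act Ω).map Complex.im).map ofReal).PosDef := by
    rw [key]
    refine (posDef_ofReal hΩ.2).conjTranspose_mul_mul_same ?_
    rw [Matrix.mulVec_injective_iff_isUnit]
    exact Matrix.isUnit_nonsing_inv_iff.2 (γ.isUnit_den hΩ)
  refine Matrix.PosDef.of_dotProduct_mulVec_pos ?_ fun v hv => ?_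
  · ext i j
    simpa using congrArg Complex.im (hsymm.apply i j)
  · have h := hpd.dotProduct_mulVec_pos (x := fun i => (v i : ℂ)) (fun h => hv (by
      ext i; simpa using congrFun h i))
    have h' := ofReal_dotProduct_mulVec ((γ.act Ω).map Complex.im) v v
    have hst : star (fun i => (v i : ℂ)) = fun i => (v i : ℂ) := by ext i; simp
    rw [hst, h', ← ofReal_zero, Complex.real_lt_real] at h
    rwa [star_trivial]

/-- With `den_mul` this is the cocycle relation that makes the slash operator a right action. -/
theorem num_mul (hΩ : Ω ∈ siegelHalfSpace) :
    (γ * δ).num Ω = γ.num (δ.act Ω) * δ.den Ω := by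
  have hu := δ.isUnit_det_den hΩ
  have h : γ.num (δ.act Ω) * δ.den Ω =
      γ.toComplex.toBlocks₁₁ * δ.num Ω + γ.toComplex.toBlocks₁₂ * δ.den Ω := by
    rw [num, act, Matrix.add_mul, Matrix.mul_assoc, Matrix.mul_assoc, nonsing_inv_mul _ hu,
      Matrix.mul_one]
  rw [h]
  simp only [num, den, toComplex_mul]
  conv_lhs => rw [← fromBlocks_toBlocks γ.toComplex, ← fromBlocks_toBlocks δ.toComplex,
    fromBlocks_multiply]
  simp only [toBlocks_fromBlocks₁₁, toBlocks_fromBlocks₁₂]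
  noncomm_ring

theorem den_mul (hΩ : Ω ∈ siegelHalfSpace) :
    (γ * δ).den Ω = γ.den (δ.act Ω) * δ.den Ω := by
  have hu := δ.isUnit_det_den hΩ
  have h : γ.den (δ.act Ω) * δ.den Ω =
      γ.toComplex.toBlocks₂₁ * δ.num Ω + γ.toComplex.toBlocks₂₂ * δ.den Ω := by
    rw [den, act, Matrix.add_mul, Matrix.mul_assoc, Matrix.mul_assoc, nonsing_inv_mul _ hu,
      Matrix.mul_one]
  rw [h]
  simp only [num, den, toComplex_mul]
  conv_lhs => rw [← fromBlocks_toBlocks γ.toComplex, ← fromBlocks_toBlocks δ.toComplex,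
    fromBlocks_multiply]
  simp only [toBlocks_fromBlocks₂₁, toBlocks_fromBlocks₂₂]
  noncomm_ring

theorem act_mul (hΩ : Ω ∈ siegelHalfSpace) : (γ * δ).act Ω = γ.act (δ.act Ω) := by
  have hu := δ.isUnit_det_den hΩ
  simp only [act]
  rw [num_mul _ _ hΩ, den_mul _ _ hΩ, Matrix.mul_inv_rev, Matrix.mul_assoc,
    ← Matrix.mul_assoc (δ.den Ω), mul_nonsing_inv _ hu, Matrix.one_mul]
  rfl

end Sp2Q

theorem slash_mul (k : ℤ) (f : Matrix (Fin 2) (Fin 2) ℂ → ℂ) (γ δ : Sp2Q)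
    {Ω : Matrix (Fin 2) (Fin 2) ℂ} (hΩ : Ω ∈ siegelHalfSpace) :
    slash k f (γ * δ) Ω = slash k (slash k f γ) δ Ω := by
  simp only [slash_eq_act]
  rw [γ.den_mul δ hΩ, γ.act_mul δ hΩ, det_mul, mul_zpow]
  ring

theorem slash_one (k : ℤ) (f : Matrix (Fin 2) (Fin 2) ℂ → ℂ) (Ω : Matrix (Fin 2) (Fin 2) ℂ) :
    slash k f 1 Ω = f Ω := by
  have h : (1 : Sp2Q).toComplex = fromBlocks 1 0 0 1 := by
    rw [fromBlocks_one]
    exact Matrix.map_one _ Rat.cast_zero Rat.cast_one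
  rw [slash_eq_act, Sp2Q.act, Sp2Q.num, Sp2Q.den, h]
  simp only [toBlocks_fromBlocks₁₁, toBlocks_fromBlocks₁₂, toBlocks_fromBlocks₂₁,
    toBlocks_fromBlocks₂₂]
  simp

theorem slash_congr (k : ℤ) {f g : Matrix (Fin 2) (Fin 2) ℂ → ℂ}
    (h : ∀ Ω ∈ siegelHalfSpace, f Ω = g Ω) (γ : Sp2Q)
    {Ω : Matrix (Fin 2) (Fin 2) ℂ} (hΩ : Ω ∈ siegelHalfSpace) :
    slash k f γ Ω = slash k g γ Ω := by
  rw [slash_eq_act, slash_eq_act, h _ (γ.act_mem hΩ)]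

end

noncomputable section

open Complex

/-! ## Elementary symplectic matrices -/

namespace Sp2Q

/-- The translation `Ω ↦ Ω + b`. -/
def upper (b : Matrix (Fin 2) (Fin 2) ℚ) (hb : b.IsSymm) : Sp2Q :=
  ⟨fromBlocks 1 b 0 1, SymplecticGroup.fromBlocks_mem_iff.2 (by simp [hb.eq])⟩

/-- The Levi element `Ω ↦ a Ω aᵀ`. -/
def levi (a : GL (Fin 2) ℚ) : Sp2Q :=
  ⟨fromBlocks a 0 0 (a⁻¹ : GL (Fin 2) ℚ).1ᵀ, SymplecticGroup.fromBlocks_mem_iff.2 (by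
    simp [← transpose_mul])⟩

/-- The embedding of `SL₂` in the second and fourth coordinates. -/
def embSL : SpecialLinearGroup (Fin 2) ℚ →* Sp2Q where
  toFun σ := ⟨fromBlocks !![1, 0; 0, σ 0 0] !![0, 0; 0, σ 0 1] !![0, 0; 0, σ 1 0]
    !![1, 0; 0, σ 1 1], SymplecticGroup.fromBlocks_mem_iff.2 (by
      have h := σ.det_coe
      rw [det_fin_two] at h
      refine ⟨?_, ?_, ?_⟩ <;> ext i j <;> fin_cases i <;> fin_cases j <;>
        simp [Matrix.mul_apply, Fin.sum_univ_two, Matrix.sub_apply] <;>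
        first | ring1 | linear_combination h)⟩
  map_one' := by
    apply Subtype.ext
    rw [OneMemClass.coe_one, ← fromBlocks_one]
    ext (i | i) (j | j) <;> fin_cases i <;> fin_cases j <;> simp
  map_mul' σ τ := by
    apply Subtype.ext
    simp only [MulMemClass.mk_mul_mk, fromBlocks_multiply]
    congr 1 <;> ext i j <;> fin_cases i <;> fin_cases j <;>
      simp [Matrix.mul_apply, Fin.sum_univ_two]

/-- The element `(0, 1; -1, 0)` of `SL₂`, embedded in the second and fourth coordinates. -/
def inversion : Sp2Q := embSL ⟨!![0, 1; -1, 0], by simp [det_fin_two]⟩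

end Sp2Q

variable (k : ℤ) (f : Matrix (Fin 2) (Fin 2) ℂ → ℂ) (Ω : Matrix (Fin 2) (Fin 2) ℂ)

theorem toComplex_mk {A B C D : Matrix (Fin 2) (Fin 2) ℚ}
    (h : fromBlocks A B C D ∈ symplecticGroup (Fin 2) ℚ) :
    Sp2Q.toComplex ⟨fromBlocks A B C D, h⟩ = fromBlocks (A.map (Rat.cast : ℚ → ℂ))
      (B.map (Rat.cast : ℚ → ℂ)) (C.map (Rat.cast : ℚ → ℂ)) (D.map (Rat.cast : ℚ → ℂ)) :=
  fromBlocks_map _ _ _ _ _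

theorem slash_mk {A B C D : Matrix (Fin 2) (Fin 2) ℚ}
    (h : fromBlocks A B C D ∈ symplecticGroup (Fin 2) ℚ) :
    slash k f ⟨fromBlocks A B C D, h⟩ Ω =
      (C.map (Rat.cast : ℚ → ℂ) * Ω + D.map (Rat.cast : ℚ → ℂ)).det ^ (-k) *
      f ((A.map (Rat.cast : ℚ → ℂ) * Ω + B.map (Rat.cast : ℚ → ℂ)) *
        (C.map (Rat.cast : ℚ → ℂ) * Ω + D.map (Rat.cast : ℚ → ℂ))⁻¹) := by
  simp only [slash_eq_act, Sp2Q.act, Sp2Q.num, Sp2Q.den, toComplex_mk, toBlocks_fromBlocks₁₁,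
    toBlocks_fromBlocks₁₂, toBlocks_fromBlocks₂₁, toBlocks_fromBlocks₂₂]

theorem ratCast_map_one : (1 : Matrix (Fin 2) (Fin 2) ℚ).map (Rat.cast : ℚ → ℂ) = 1 :=
  Matrix.map_one _ Rat.cast_zero Rat.cast_one

theorem slash_upper (b : Matrix (Fin 2) (Fin 2) ℚ) (hb : b.IsSymm) :
    slash k f (Sp2Q.upper b hb) Ω = f (Ω + b.map (Rat.cast : ℚ → ℂ)) := by
  rw [Sp2Q.upper, slash_mk, ratCast_map_one, Matrix.map_zero _ Rat.cast_zero]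
  simp

theorem slash_levi (a : GL (Fin 2) ℚ) :
    slash k f (Sp2Q.levi a) Ω = ((a.1.det : ℚ) : ℂ) ^ k *
      f (a.1.map (Rat.cast : ℚ → ℂ) * Ω * (a.1.map (Rat.cast : ℚ → ℂ))ᵀ) := by
  rw [Sp2Q.levi, slash_mk, Matrix.map_zero _ Rat.cast_zero]
  have h1 : a.1.map (Rat.cast : ℚ → ℂ) * (a⁻¹ : GL (Fin 2) ℚ).1.map (Rat.cast : ℚ → ℂ) = 1 := by
    have h : a.1 * (a⁻¹ : GL (Fin 2) ℚ).1 = 1 := by rw [← Units.val_mul]; simp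
    have := congrArg (fun M : Matrix (Fin 2) (Fin 2) ℚ => M.map (algebraMap ℚ ℂ)) h
    simp only [Matrix.map_mul] at this
    exact this.trans ratCast_map_one
  have h2 : ((a⁻¹ : GL (Fin 2) ℚ).1ᵀ.map (Rat.cast : ℚ → ℂ))⁻¹ = (a.1.map (Rat.cast : ℚ → ℂ))ᵀ := by
    apply inv_eq_left_inv
    rw [transpose_map, ← transpose_mul, ← transpose_one, ← h1]
    congr 1
    have h3 := mul_eq_one_comm.1 h1
    rw [h3, h1]
  have h4 : (a.1.map (Rat.cast : ℚ → ℂ)).det = ((a.1.det : ℚ) : ℂ) :=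
    (RingHom.map_det (algebraMap ℚ ℂ) a.1).symm
  rw [Matrix.zero_mul, zero_add, add_zero, h2, transpose_map, det_transpose, ← h4, _root_.zpow_neg,
    ← _root_.inv_zpow]
  congr 2
  exact inv_eq_of_mul_eq_one_right (by rw [← det_mul, mul_eq_one_comm.1 h1, det_one])

/-- The image of `Ω` under the embedded inversion. -/
def invertSecond (Ω : Matrix (Fin 2) (Fin 2) ℂ) : Matrix (Fin 2) (Fin 2) ℂ :=
  !![Ω 0 0 - Ω 0 1 ^ 2 / Ω 1 1, -(Ω 0 1 / Ω 1 1); -(Ω 0 1 / Ω 1 1), -(1 / Ω 1 1)]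

theorem slash_inversion {Ω : Matrix (Fin 2) (Fin 2) ℂ} (hΩ : Ω.IsSymm) (h0 : Ω 1 1 ≠ 0) :
    slash k f Sp2Q.inversion Ω = (-Ω 1 1) ^ (-k) * f (invertSecond Ω) := by
  have h10 : Ω 1 0 = Ω 0 1 := hΩ.apply 0 1
  change slash k f ⟨fromBlocks _ _ _ _, _⟩ Ω = _
  rw [slash_mk]
  have hden : (!![(0 : ℚ), 0; 0, -1].map (Rat.cast : ℚ → ℂ) * Ω +
      !![(1 : ℚ), 0; 0, 0].map (Rat.cast : ℚ → ℂ)) = !![1, 0; -Ω 0 1, -Ω 1 1] := by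
    ext i j; fin_cases i <;> fin_cases j <;> simp [Matrix.mul_apply, Fin.sum_univ_two, h10]
  have hnum : (!![(1 : ℚ), 0; 0, 0].map (Rat.cast : ℚ → ℂ) * Ω +
      !![(0 : ℚ), 0; 0, 1].map (Rat.cast : ℚ → ℂ)) = !![Ω 0 0, Ω 0 1; 0, 1] := by
    ext i j; fin_cases i <;> fin_cases j <;> simp [Matrix.mul_apply, Fin.sum_univ_two]
  have hinv : (!![1, 0; -Ω 0 1, -Ω 1 1] : Matrix (Fin 2) (Fin 2) ℂ)⁻¹ =
      !![1, 0; -(Ω 0 1 / Ω 1 1), -(1 / Ω 1 1)] := by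
    apply inv_eq_left_inv
    ext i j; fin_cases i <;> fin_cases j <;> simp [Matrix.mul_apply, Fin.sum_univ_two, h0]
    field_simp
    ring
  change (!![(0 : ℚ), 0; 0, -1].map (Rat.cast : ℚ → ℂ) * Ω +
      !![(1 : ℚ), 0; 0, 0].map (Rat.cast : ℚ → ℂ)).det ^ (-k) *
    f ((!![(1 : ℚ), 0; 0, 0].map (Rat.cast : ℚ → ℂ) * Ω +
      !![(0 : ℚ), 0; 0, 1].map (Rat.cast : ℚ → ℂ)) *
      (!![(0 : ℚ), 0; 0, -1].map (Rat.cast : ℚ → ℂ) * Ω + !![(1 : ℚ), 0; 0, 0].map (Rat.cast : ℚ → ℂ))⁻¹) = _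
  rw [hden, hnum, hinv]
  congr 2
  · simp [det_fin_two]
  · rw [invertSecond]
    ext i j; fin_cases i <;> fin_cases j <;> simp [Matrix.mul_apply, Fin.sum_univ_two]
    all_goals ring

theorem im_pos_of_mem {Ω : Matrix (Fin 2) (Fin 2) ℂ} (hΩ : Ω ∈ siegelHalfSpace) (i : Fin 2) :
    0 < (Ω i i).im := by
  have := hΩ.2.diag_pos (i := i)
  simpa using this

/-- Slashing the indicator function of the half space in weight `0` reads the claim off from the
general fact that symplectic matrices preserve the half space. -/
theorem invertSecond_mem {Ω : Matrix (Fin 2) (Fin 2) ℂ} (hΩ : Ω ∈ siegelHalfSpace) :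
    invertSecond Ω ∈ siegelHalfSpace := by
  have h0 : Ω 1 1 ≠ 0 := fun h => by have := im_pos_of_mem hΩ 1; simp [h] at this
  classical
  by_contra hcon
  have h1 := slash_inversion 0 (fun X => if X ∈ siegelHalfSpace then 1 else 0) hΩ.1 h0
  rw [slash_eq_act, if_pos (Sp2Q.act_mem _ hΩ), if_neg hcon] at h1
  simp at h1

end

noncomputable section

open Complex

/-! ## Bilinear forms over general rings -/

section Bil

variable {n : Type*} [Fintype n] (Q : Matrix n n ℤ) {R S : Type*} [CommRing R] [CommRing S]

/-- The bilinear form of an integral matrix, over any commutative ring. -/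
def bil (x y : n → R) : R := x ⬝ᵥ Q.map (Int.cast : ℤ → R) *ᵥ y

theorem bil_add_left (x y z : n → R) : bil Q (x + y) z = bil Q x z + bil Q y z :=
  add_dotProduct _ _ _

theorem bil_add_right (x y z : n → R) : bil Q x (y + z) = bil Q x y + bil Q x z := by
  simp [bil, mulVec_add]

theorem bil_sub_left (x y z : n → R) : bil Q (x - y) z = bil Q x z - bil Q y z :=
  sub_dotProduct _ _ _

theorem bil_sub_right (x y z : n → R) : bil Q x (y - z) = bil Q x y - bil Q x z := by
  simp [bil, mulVec_sub]

theorem bil_smul_left (c : R) (x y : n → R) : bil Q (c • x) y = c * bil Q x y :=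
  smul_dotProduct _ _ _

theorem bil_smul_right (c : R) (x y : n → R) : bil Q x (c • y) = c * bil Q x y := by
  simp [bil, mulVec_smul]

theorem bil_zero_left (y : n → R) : bil Q 0 y = 0 := zero_dotProduct _

theorem bil_zero_right (x : n → R) : bil Q x 0 = 0 := by simp [bil]

theorem bil_comm {Q : Matrix n n ℤ} (hQ : Q.IsSymm) (x y : n → R) : bil Q x y = bil Q y x := by
  have h : (Q.map (Int.cast : ℤ → R))ᵀ = Q.map (Int.cast : ℤ → R) := by
    rw [← transpose_map, hQ.eq]
  rw [bil, dotProduct_mulVec, ← mulVec_transpose, h, dotProduct_comm, bil]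

theorem map_bil (f : R →+* S) (x y : n → R) : f (bil Q x y) = bil Q (fun i => f (x i)) fun i => f (y i) := by
  simp [bil, dotProduct, mulVec]

theorem ratCast_bil (x y : n → ℚ) :
    ((bil Q x y : ℚ) : ℂ) = bil Q (fun i => (x i : ℂ)) fun i => (y i : ℂ) :=
  map_bil Q (algebraMap ℚ ℂ) x y

theorem intCast_bil (x y : n → ℤ) :
    ((bil Q x y : ℤ) : R) = bil Q (fun i => (x i : R)) fun i => (y i : R) :=
  map_bil Q (Int.castRingHom R) x y

/-- An even form takes even values. -/
theorem IsEvenForm.even_bil [DecidableEq n] {Q : Matrix n n ℤ} (hQ : IsEvenForm Q) (x : n → ℤ) :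
    Even (bil Q x x) := by
  have key : ∀ s : Finset n, Even (bil Q (∑ i ∈ s, Pi.single i (x i)) (∑ i ∈ s, Pi.single i (x i))) := by
    intro s
    induction s using Finset.induction_on with
    | empty => simp [bil_zero_left]
    | insert a s ha ih =>
      rw [Finset.sum_insert ha, bil_add_left, bil_add_right, bil_add_right,
        bil_comm hQ.1 (∑ i ∈ s, Pi.single i (x i)) (Pi.single a (x a))]
      have h : Even (bil Q (Pi.single a (x a)) (Pi.single a (x a))) := by
        simp only [bil, single_dotProduct, mulVec_single]
        have := hQ.2 a
        simp only [Pi.smul_apply, MulOpposite.smul_eq_mul_unop]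
        exact ((this.mul_right _).mul_left _)
      obtain ⟨u, hu⟩ := h
      obtain ⟨w, hw⟩ := ih
      rw [hu, hw]
      exact ⟨u + w + bil Q (Pi.single a (x a)) (∑ i ∈ s, Pi.single i (x i)), by ring⟩
  have := key Finset.univ
  rwa [Finset.univ_sum_single] at this

end Bil

/-! ## One-variable inversion -/

variable {n : Type*} [Fintype n] [DecidableEq n] (Q : Matrix n n ℤ)

/-- `e(x) = exp(2πix)` for rational `x`. -/
def ratExp (x : ℚ) : ℂ := cexp (2 * Real.pi * I * (x : ℂ))

theorem ratExp_add (x y : ℚ) : ratExp (x + y) = ratExp x * ratExp y := by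
  rw [ratExp, ratExp, ratExp, ← Complex.exp_add]; push_cast; ring_nf

theorem ratExp_int (m : ℤ) : ratExp m = 1 := by
  rw [ratExp, Complex.exp_eq_one_iff]; exact ⟨m, by push_cast; ring⟩

theorem ratExp_add_int (x : ℚ) (m : ℤ) : ratExp (x + m) = ratExp x := by
  rw [ratExp_add, ratExp_int, mul_one]

theorem norm_ratExp (x : ℚ) : ‖ratExp x‖ = 1 := by
  rw [ratExp, Complex.norm_exp]; simp

/-- `y ∈ R⁻¹ L^#`, where `L^# = Q⁻¹ ℤⁿ`. -/
def InDual (R : ℕ) (y : n → ℚ) : Prop :=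
  ∃ v : n → ℤ, ∀ i, (R : ℚ) * (Q.map (Int.cast : ℤ → ℚ) *ᵥ y) i = v i

open scoped Classical in
/-- The Fourier transform of a function supported on `M⁻¹ ℤⁿ` and periodic under `R ℤⁿ`. -/
def latticeFourier (M R : ℕ) (ψ : (n → ℚ) → ℂ) (y : n → ℚ) : ℂ :=
  if InDual Q R y then ((R : ℂ) ^ Fintype.card n * (√(Q.det : ℝ) : ℝ))⁻¹ *
    ∑ k : n → Fin (R * M), ψ (fun i => ((k i : ℕ) : ℚ) / M) *
      ratExp (bil Q (fun i => ((k i : ℕ) : ℚ) / M) y)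
  else 0

variable {Q}

/-- Splitting `M⁻¹ ℤⁿ` into cosets of `R ℤⁿ`. -/
theorem hasSum_split {M R : ℕ} (hM : 0 < M) (hR : 0 < R) {g : (n → ℚ) → ℂ} {s : (n → Fin (R * M)) → ℂ}
    (hsupp : ∀ x, g x ≠ 0 → ∀ i, ∃ m : ℤ, x i = m / M)
    (hs : ∀ k : n → Fin (R * M),
      HasSum (fun m : n → ℤ => g fun i => ((k i : ℕ) : ℚ) / M + R * m i) (s k)) :
    HasSum g (∑ k, s k) := by
  have hRM : NeZero (R * M) := ⟨by positivity⟩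
  have hMq : (M : ℚ) ≠ 0 := by positivity
  -- Division with remainder by `R * M`: a numerator `k + R M m` gives the coordinate `k / M + R m`.
  let e : (n → ℤ) × (n → Fin (R * M)) ≃ (n → ℤ) :=
    (Equiv.arrowProdEquivProdArrow n (fun _ => ℤ) (fun _ => Fin (R * M))).symm.trans
      (Equiv.piCongrRight fun _ => (Int.divModEquiv (R * M)).symm)
  let ι : (n → ℤ) → (n → ℚ) := fun m i => (m i : ℚ) / M
  have hι : Function.Injective ι := by
    intro a b hab
    ext i
    have := congrFun hab i
    simp only [ι] at this
    field_simp at this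
    exact_mod_cast this
  have h1 : HasSum (fun p : (n → ℤ) × (n → Fin (R * M)) => g (ι (e p))) (∑ k, s k) := by
    rw [← (Equiv.prodComm _ _).hasSum_iff]
    have hval : ∀ p : (n → Fin (R * M)) × (n → ℤ), g (ι (e (Equiv.prodComm _ _ p))) =
        g fun i => ((p.1 i : ℕ) : ℚ) / M + R * p.2 i := by
      rintro ⟨k, m⟩
      congr 1
      ext i
      simp only [ι, e, Equiv.prodComm_apply, Prod.swap, Equiv.trans_apply]
      simp [Equiv.arrowProdEquivProdArrow, Int.divModEquiv]
      field_simp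
      ring
    simp only [Function.comp_def]
    simp_rw [hval]
    have hk : ∀ k : n → Fin (R * M), HasSum (fun p : (n → Fin (R * M)) × (n → ℤ) =>
        if p.1 = k then g fun i => ((p.1 i : ℕ) : ℚ) / M + R * p.2 i else 0) (s k) := by
      intro k
      have hinj : Function.Injective fun m : n → ℤ => (k, m) := fun a b h => (Prod.ext_iff.1 h).2
      rw [← hinj.hasSum_iff]
      · simpa [Function.comp_def] using hs k
      · rintro ⟨k', m⟩ hp
        have : k' ≠ k := fun h => hp ⟨m, by rw [h]⟩
        simp [this]
    have := hasSum_sum (s := Finset.univ) fun k _ => hk k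
    simpa using this
  have h2 := (e.hasSum_iff (f := fun m => g (ι m))).1 h1
  refine (hι.hasSum_iff fun x hx => ?_).1 h2
  by_contra hne
  choose m hm using hsupp x hne
  exact hx ⟨m, by ext i; simp [ι, hm]⟩

end

/-! ### The functional equation of a theta sum in one column. -/

noncomputable section

open Complex

variable {n : Type*} [Fintype n] [DecidableEq n] {Q : Matrix n n ℤ}

/-- The dual form at a vector `P w` is a value of the original form; this evaluates the exponents of
the dual sum after the square has been completed. -/
theorem inv_dotProduct_self {P : Matrix n n ℝ} (hP : IsUnit P.det) (w : n → ℂ) :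
    (P.map ofReal *ᵥ w) ⬝ᵥ (P⁻¹).map ofReal *ᵥ (P.map ofReal *ᵥ w) =
      w ⬝ᵥ (P.map ofReal)ᵀ *ᵥ w := by
  have h1 : (P⁻¹).map ofReal * P.map ofReal = 1 := by
    have := congrArg (fun M : Matrix n n ℝ => M.map ofRealHom) (nonsing_inv_mul P hP)
    simp only [Matrix.map_mul] at this
    rw [Matrix.map_one _ (map_zero _) (map_one _)] at this
    exact this
  rw [mulVec_mulVec, h1, one_mulVec, mulVec_transpose, dotProduct_comm,
    dotProduct_mulVec, dotProduct_comm]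

theorem isUnit_det_rat (hpos : (Q.map (Int.cast : ℤ → ℝ)).PosDef) :
    IsUnit (Q.map (Int.cast : ℤ → ℚ)).det := by
  have h1 : (Q.map (Int.cast : ℤ → ℝ)).det = ((Q.det : ℤ) : ℝ) :=
    (RingHom.map_det (Int.castRingHom ℝ) Q).symm
  have h2 : (Q.map (Int.cast : ℤ → ℚ)).det = ((Q.det : ℤ) : ℚ) :=
    (RingHom.map_det (Int.castRingHom ℚ) Q).symm
  have h3 := hpos.det_pos
  rw [h1] at h3
  rw [h2, isUnit_iff_ne_zero]
  have : Q.det ≠ 0 := by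
    intro h; simp [h] at h3
  exact_mod_cast this

theorem det_real_eq : (Q.map (Int.cast : ℤ → ℝ)).det = (Q.det : ℝ) :=
  (RingHom.map_det (Int.castRingHom ℝ) Q).symm

/-- On each coset of `Rℤⁿ` in `M⁻¹ℤⁿ` the function `ψ` is constant, and the sum is a Gaussian sum
for `R²Q`, to which `tsum_gaussian_posDef` applies. The dual index `κ` stands for `y = R⁻¹Q⁻¹κ`, and
adding up the cosets assembles `latticeFourier`. Both sums are expressed through the same `t`, so
that two-column sums can later be compared fibrewise over the fixed column `a`. -/
theorem summable_column_dual_and_hasSum (hQ : Q.IsSymm)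
    (hpos : (Q.map (Int.cast : ℤ → ℝ)).PosDef) {j : ℕ} (hj : Fintype.card n = 2 * j)
    {M R : ℕ} (hM : 0 < M) (hR : 0 < R) {ψ : (n → ℚ) → ℂ}
    (hsupp : ∀ x, ψ x ≠ 0 → ∀ i, ∃ m : ℤ, x i = m / M)
    (hper : ∀ x (v : n → ℤ), ψ (fun i => x i + R * v i) = ψ x) {ω : ℂ} (hω : 0 < ω.im) (z : ℂ)
    (a : n → ℚ) :
    ∃ t : ℂ, HasSum (fun y : n → ℚ => latticeFourier Q M R ψ y * cexp (Real.pi * I *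
        (-(bil Q y y : ℚ) / ω + 2 * (bil Q a y : ℚ) * (z / ω) - (bil Q a a : ℚ) * (z ^ 2 / ω)))) t ∧
      HasSum (fun x : n → ℚ => ψ x * cexp (Real.pi * I *
        (2 * (bil Q a x : ℚ) * z + (bil Q x x : ℚ) * ω))) (((-I * ω)⁻¹) ^ j * t) := by
  have hω0 : ω ≠ 0 := fun h => by simp [h] at hω
  have hRq : (R : ℚ) ≠ 0 := by positivity
  have hRc : (R : ℂ) ≠ 0 := by exact_mod_cast hR.ne'
  have hu := isUnit_det_rat hpos
  set Qr := Q.map (Int.cast : ℤ → ℝ) with hQr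
  set P : Matrix n n ℝ := (R : ℝ) ^ 2 • Qr with hPdef
  have hP : P.PosDef := hpos.smul (by positivity)
  have hPu : IsUnit P.det := isUnit_iff_ne_zero.2 hP.det_pos.ne'
  have hPc : P.map ofReal = (R : ℂ) ^ 2 • Q.map (Int.cast : ℤ → ℂ) := by
    ext i j; simp [hPdef, hQr]
  have hPdet : √P.det = (R : ℝ) ^ Fintype.card n * √(Q.det : ℝ) := by
    rw [hPdef, det_smul, hQr, det_real_eq, ← pow_mul, mul_comm 2, pow_mul,
      Real.sqrt_mul (by positivity), Real.sqrt_sq (by positivity)]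
  let x : (n → Fin (R * M)) → n → ℚ := fun k i => ((k i : ℕ) : ℚ) / M
  let xc : (n → Fin (R * M)) → n → ℂ := fun k i => (x k i : ℂ)
  let ac : n → ℂ := fun i => (a i : ℂ)
  -- The linear coefficient in `m` of the exponent at `x_k + R m`: the cross terms with `x_k`,
  -- weighted by `ω`, and with `a`, weighted by `z`.
  let u : (n → Fin (R * M)) → n → ℂ := fun k =>
    (R : ℂ) • (Q.map (Int.cast : ℤ → ℂ) *ᵥ (ω • xc k + z • ac))
  let E : (n → Fin (R * M)) → ℂ := fun k => cexp (Real.pi * I *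
    (2 * (bil Q a (x k) : ℚ) * z + (bil Q (x k) (x k) : ℚ) * ω))
  let dual : (n → Fin (R * M)) → (n → ℤ) → ℂ := fun k κ => cexp (-(Real.pi * I / ω *
    ((fun i => u k i - κ i) ⬝ᵥ (P⁻¹).map ofReal *ᵥ fun i => u k i - κ i)))
  have hdual : ∀ k, Summable (dual k) := fun k => summable_gaussian_dual hP hω (u k)
  let D : ℂ := ((R : ℂ) ^ Fintype.card n * (√(Q.det : ℝ) : ℝ))⁻¹
  have hleft : ∀ k, HasSum (fun m : n → ℤ => ψ (fun i => ((k i : ℕ) : ℚ) / M + R * m i) *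
      cexp (Real.pi * I * (2 * (bil Q a (fun i => ((k i : ℕ) : ℚ) / M + R * m i) : ℚ) * z +
        (bil Q (fun i => ((k i : ℕ) : ℚ) / M + R * m i)
          (fun i => ((k i : ℕ) : ℚ) / M + R * m i) : ℚ) * ω)))
      (((-I * ω)⁻¹) ^ j * (D * (ψ (x k) * (E k * ∑' κ, dual k κ)))) := by
    intro k
    have h := (summable_gaussian hP hω (u k)).hasSum
    rw [tsum_gaussian_posDef hP hj hω (u k)] at h
    have h' := h.mul_left (ψ (x k) * E k)
    have hD : (((√P.det)⁻¹ : ℝ) : ℂ) = D := by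
      simp only [D]; rw [hPdet]; push_cast; rfl
    refine Eq.mpr (congrArg₂ (fun f s => HasSum f s) (funext fun m => ?_) ?_) h'
    · rw [hper (fun i => ((k i : ℕ) : ℚ) / M) m]
      refine (congrArg (ψ (x k) * ·) ?_).trans (mul_assoc _ _ _).symm
      simp only [E]
      rw [← Complex.exp_add]
      congr 1
      have hxm : (fun i => ((k i : ℕ) : ℚ) / M + R * m i) = x k + (R : ℚ) • fun i => (m i : ℚ) := by
        ext i; simp [x]
      rw [hxm, bil_add_right, bil_add_right, bil_add_left, bil_add_left, bil_smul_right,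
        bil_smul_right, bil_smul_left, bil_smul_right, bil_smul_left,
        bil_comm hQ (fun i => (m i : ℚ)) (x k)]
      have hl : ∑ i, u k i * (m i : ℂ) = R * (ω * (bil Q (x k) (fun i => (m i : ℚ)) : ℚ) +
          z * (bil Q a (fun i => (m i : ℚ)) : ℚ)) := by
        change u k ⬝ᵥ (fun i => (m i : ℂ)) = _
        simp only [u]
        rw [smul_dotProduct, dotProduct_comm]
        change (R : ℂ) • bil Q (fun i => (m i : ℂ)) (ω • xc k + z • ac) = _
        rw [bil_comm hQ, bil_add_left, bil_smul_left, bil_smul_left, ratCast_bil, ratCast_bil,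
          smul_eq_mul]
        simp [xc, ac]
      have hq : (fun i => (m i : ℂ)) ⬝ᵥ P.map ofReal *ᵥ (fun i => (m i : ℂ)) =
          R ^ 2 * (bil Q (fun i => (m i : ℚ)) (fun i => (m i : ℚ)) : ℚ) := by
        rw [hPc, smul_mulVec, dotProduct_smul, ratCast_bil, smul_eq_mul, bil]
        simp
      rw [hl, hq]
      push_cast
      ring
    · rw [hD]
      ring
  let y : (n → ℤ) → n → ℚ := fun κ =>
    (R : ℚ)⁻¹ • ((Q.map (Int.cast : ℤ → ℚ))⁻¹ *ᵥ fun i => (κ i : ℚ))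
  have hRy : ∀ κ, (R : ℚ) • (Q.map (Int.cast : ℤ → ℚ) *ᵥ y κ) = fun i => (κ i : ℚ) := by
    intro κ
    simp only [y]
    rw [mulVec_smul, mulVec_mulVec, mul_nonsing_inv _ hu, one_mulVec, smul_smul,
      mul_inv_cancel₀ hRq, one_smul]
  have hyinj : Function.Injective y := by
    intro κ κ' h
    have h1 := hRy κ
    rw [h, hRy κ'] at h1
    ext i
    exact_mod_cast (congrFun h1 i).symm
  have hdualy : ∀ κ, InDual Q R (y κ) := fun κ => ⟨κ, fun i => congrFun (hRy κ) i⟩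
  have hkey : ∀ k κ, ratExp (bil Q (x k) (y κ)) * cexp (Real.pi * I *
        (-(bil Q (y κ) (y κ) : ℚ) / ω + 2 * (bil Q a (y κ) : ℚ) * (z / ω) -
          (bil Q a a : ℚ) * (z ^ 2 / ω))) = E k * dual k κ := by
    intro k κ
    let yc : n → ℂ := fun i => (y κ i : ℂ)
    have hRyc : (R : ℂ) • (Q.map (Int.cast : ℤ → ℂ) *ᵥ yc) = fun i => (κ i : ℂ) := by
      ext i
      have := congrArg (Rat.cast : ℚ → ℂ) (congrFun (hRy κ) i)
      simp only [Pi.smul_apply, smul_eq_mul, mulVec, dotProduct, map_apply, yc] at this ⊢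
      push_cast at this
      exact this
    -- Completing the square: `u - κ` is `P` applied to `R⁻¹(ω x_k + z a - y)`, so its dual form is
    -- the value of `Q` at `ω x_k + z a - y`.
    have hw : (fun i => u k i - (κ i : ℂ)) =
        P.map ofReal *ᵥ ((R : ℂ)⁻¹ • (ω • xc k + z • ac - yc)) := by
      rw [hPc, mulVec_smul, smul_mulVec, smul_smul, mulVec_sub, smul_sub]
      have : (R : ℂ)⁻¹ * (R : ℂ) ^ 2 = R := by field_simp
      rw [this, hRyc]
      rfl
    have hPt : (P.map ofReal)ᵀ = P.map ofReal := by
      rw [hPc, transpose_smul, ← transpose_map, hQ.eq]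
    have hval : (fun i => u k i - (κ i : ℂ)) ⬝ᵥ (P⁻¹).map ofReal *ᵥ (fun i => u k i - (κ i : ℂ)) =
        bil Q (ω • xc k + z • ac - yc) (ω • xc k + z • ac - yc) := by
      rw [hw, inv_dotProduct_self hPu, hPt, hPc, smul_mulVec, mulVec_smul, smul_dotProduct,
        dotProduct_smul, dotProduct_smul, bil]
      simp only [smul_eq_mul]
      field_simp
    simp only [ratExp, E, dual]
    rw [hval, ← Complex.exp_add, ← Complex.exp_add]
    congr 1
    simp only [bil_sub_left, bil_sub_right, bil_add_left, bil_add_right, bil_smul_left,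
      bil_smul_right]
    rw [bil_comm hQ yc (xc k), bil_comm hQ yc ac, bil_comm hQ (xc k) ac]
    simp only [ratCast_bil]
    change 2 * Real.pi * I * bil Q (xc k) yc + Real.pi * I * (-bil Q yc yc / ω +
      2 * bil Q ac yc * (z / ω) - bil Q ac ac * (z ^ 2 / ω)) = Real.pi * I *
      (2 * bil Q ac (xc k) * z + bil Q (xc k) (xc k) * ω) + _
    field_simp
    ring
  have hright : HasSum (fun y : n → ℚ => latticeFourier Q M R ψ y * cexp (Real.pi * I *
      (-(bil Q y y : ℚ) / ω + 2 * (bil Q a y : ℚ) * (z / ω) - (bil Q a a : ℚ) * (z ^ 2 / ω))))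
      (∑ k, D * (ψ (x k) * (E k * ∑' κ, dual k κ))) := by
    refine (hyinj.hasSum_iff fun w hw => ?_).1 ?_
    · rw [latticeFourier, if_neg, zero_mul]
      rintro ⟨v, hv⟩
      refine hw ⟨v, ?_⟩
      have h1 : (R : ℚ) • (Q.map (Int.cast : ℤ → ℚ) *ᵥ w) = fun i => (v i : ℚ) := funext hv
      simp only [y]
      rw [← h1, mulVec_smul, mulVec_mulVec, nonsing_inv_mul _ hu, one_mulVec, smul_smul,
        inv_mul_cancel₀ hRq, one_smul]
    · refine (hasSum_sum (s := Finset.univ) fun k _ =>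
        (((hdual k).hasSum.mul_left (E k)).mul_left (ψ (x k))).mul_left D).congr_fun ?_
      intro κ
      simp only [Function.comp_apply]
      rw [latticeFourier, if_pos (hdualy κ), mul_assoc, Finset.sum_mul, Finset.mul_sum]
      refine Finset.sum_congr rfl fun k _ => ?_
      rw [← hkey, mul_assoc]
  refine ⟨_, hright, ?_⟩
  rw [Finset.mul_sum]
  refine hasSum_split hM hR (fun w hw => hsupp w (left_ne_zero_of_mul hw)) hleft

end

noncomputable section

open Complex

variable {n : Type*} [Fintype n]

/-! ## Positivity of the trace form -/

/-- With `Q = SᵀS` the trace is a sum of values of the binary form `Y` at the rows of `S V`, so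
positivity in two columns reduces to positivity of `Y`. -/
theorem exists_trace_eq_sum [DecidableEq n] {Q : Matrix n n ℝ} (hQ : Q.PosDef) :
    ∃ S : Matrix n n ℝ, Q = Sᵀ * S ∧ ∀ (V : Matrix n (Fin 2) ℝ) (Y : Matrix (Fin 2) (Fin 2) ℝ),
      (Vᵀ * Q * V * Y).trace = ∑ i, (S * V) i ⬝ᵥ Y *ᵥ (S * V) i := by
  obtain ⟨S, hS⟩ : ∃ S : Matrix n n ℝ, Q = Sᵀ * S := by
    open scoped MatrixOrder in
    obtain ⟨S, hS⟩ := CStarAlgebra.nonneg_iff_eq_star_mul_self.1 hQ.posSemidef.nonneg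
    exact ⟨S, by simpa [Matrix.star_eq_conjTranspose, conjTranspose_eq_transpose_of_trivial] using hS⟩
  refine ⟨S, hS, fun V Y => ?_⟩
  have h1 : Vᵀ * Q * V * Y = (S * V)ᵀ * ((S * V) * Y) := by
    rw [hS, transpose_mul]; simp only [Matrix.mul_assoc]
  rw [h1, trace_mul_comm, trace]
  refine Finset.sum_congr rfl fun i _ => ?_
  rw [diag_apply, Matrix.mul_apply, dotProduct_mulVec]
  rfl

theorem trace_form_nonneg [DecidableEq n] {Q : Matrix n n ℝ} (hQ : Q.PosDef)
    {Y : Matrix (Fin 2) (Fin 2) ℝ} (hY : Y.PosSemidef) (V : Matrix n (Fin 2) ℝ) :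
    0 ≤ (Vᵀ * Q * V * Y).trace := by
  obtain ⟨S, -, h⟩ := exists_trace_eq_sum hQ
  rw [h]
  exact Finset.sum_nonneg fun i _ => by simpa using hY.dotProduct_mulVec_nonneg ((S * V) i)

theorem exists_trace_form_ge [DecidableEq n] {Q : Matrix n n ℝ} (hQ : Q.PosDef)
    {Y : Matrix (Fin 2) (Fin 2) ℝ} (hY : Y.PosDef) :
    ∃ c : ℝ, 0 < c ∧ ∀ V : Matrix n (Fin 2) ℝ,
      c * ∑ i, ∑ j, V i j ^ 2 ≤ (Vᵀ * Q * V * Y).trace := by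
  obtain ⟨S, hS, h⟩ := exists_trace_eq_sum hQ
  obtain ⟨c₁, hc₁, h₁⟩ := hY.exists_pos_mul_sum_sq_le
  obtain ⟨c₂, hc₂, h₂⟩ := hQ.exists_pos_mul_sum_sq_le
  refine ⟨c₁ * c₂, by positivity, fun V => ?_⟩
  rw [h]
  calc c₁ * c₂ * ∑ i, ∑ j, V i j ^ 2 = c₁ * ∑ j, c₂ * ∑ i, V i j ^ 2 := by
        rw [Finset.sum_comm, ← Finset.mul_sum]; ring
    _ ≤ c₁ * ∑ j, (fun i => V i j) ⬝ᵥ Q *ᵥ (fun i => V i j) := by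
        gcongr with j
        exact h₂ _
    _ = c₁ * ∑ i, ∑ j, (S * V) i j ^ 2 := by
        rw [Finset.sum_comm]
        congr 1
        refine Finset.sum_congr rfl fun j _ => ?_
        rw [hS, ← mulVec_mulVec, dotProduct_mulVec, vecMul_transpose, dotProduct]
        refine Finset.sum_congr rfl fun i _ => ?_
        rw [sq]
        rfl
    _ ≤ _ := by
        rw [Finset.mul_sum]
        exact Finset.sum_le_sum fun i _ => h₁ _

/-! ## Theta series of lattice functions -/

/-- The Gram matrix `Nᵀ Q N`. -/
def gramMat (Q : Matrix n n ℤ) (N : Matrix n (Fin 2) ℚ) : Matrix (Fin 2) (Fin 2) ℚ :=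
  Nᵀ * Q.map (Int.cast : ℤ → ℚ) * N

/-- `e(½ tr(Nᵀ Q N Ω))`. -/
def thetaTerm (Q : Matrix n n ℤ) (N : Matrix n (Fin 2) ℚ) (Ω : Matrix (Fin 2) (Fin 2) ℂ) : ℂ :=
  cexp (Real.pi * I * ((gramMat Q N).map (Rat.cast : ℚ → ℂ) * Ω).trace)

/-- The theta series of a function on rational matrices. -/
def thetaSum (Q : Matrix n n ℤ) (φ : Matrix n (Fin 2) ℚ → ℂ) (Ω : Matrix (Fin 2) (Fin 2) ℂ) : ℂ :=
  ∑' N, φ N * thetaTerm Q N Ω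

theorem gramMat_apply (Q : Matrix n n ℤ) (N : Matrix n (Fin 2) ℚ) (i j : Fin 2) :
    gramMat Q N i j = bil Q (N.col i) (N.col j) := by
  rw [gramMat, Matrix.mul_assoc, Matrix.mul_apply]
  rfl

theorem gramMat_mul (Q : Matrix n n ℤ) (N : Matrix n (Fin 2) ℚ) (a : Matrix (Fin 2) (Fin 2) ℚ) :
    gramMat Q (N * a) = aᵀ * gramMat Q N * a := by
  simp only [gramMat, transpose_mul, Matrix.mul_assoc]

theorem thetaTerm_eq (Q : Matrix n n ℤ) (N : Matrix n (Fin 2) ℚ)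
    (Ω : Matrix (Fin 2) (Fin 2) ℂ) :
    thetaTerm Q N Ω = cexp (Real.pi * I *
      ((bil Q (N.col 0) (N.col 0) : ℚ) * Ω 0 0 + (bil Q (N.col 0) (N.col 1) : ℚ) * Ω 1 0 +
        ((bil Q (N.col 1) (N.col 0) : ℚ) * Ω 0 1 + (bil Q (N.col 1) (N.col 1) : ℚ) * Ω 1 1))) := by
  simp [thetaTerm, trace_fin_two, Matrix.mul_apply, Fin.sum_univ_two, gramMat_apply]

/-- The function is supported on a lattice and bounded. -/
structure LatticeBdd (φ : Matrix n (Fin 2) ℚ → ℂ) : Prop where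
  supp : ∃ M : ℕ, 0 < M ∧ ∀ N, φ N ≠ 0 → ∀ i j, ∃ m : ℤ, N i j = m / M
  bdd : ∃ C : ℝ, ∀ N, ‖φ N‖ ≤ C

/-- The sum of the squares of the entries. -/
def sqSum (N : Matrix n (Fin 2) ℚ) : ℝ := ∑ i, ∑ j, (N i j : ℝ) ^ 2

theorem sqSum_nonneg (N : Matrix n (Fin 2) ℚ) : 0 ≤ sqSum N :=
  Finset.sum_nonneg fun _ _ => Finset.sum_nonneg fun _ _ => sq_nonneg _

theorem norm_thetaTerm (Q : Matrix n n ℤ) (N : Matrix n (Fin 2) ℚ) (Ω : Matrix (Fin 2) (Fin 2) ℂ) :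
    ‖thetaTerm Q N Ω‖ = Real.exp (-Real.pi * ((N.map (Rat.cast : ℚ → ℝ))ᵀ *
      Q.map (Int.cast : ℤ → ℝ) * N.map (Rat.cast : ℚ → ℝ) * Ω.map Complex.im).trace) := by
  have hg : (N.map (Rat.cast : ℚ → ℝ))ᵀ * Q.map (Int.cast : ℤ → ℝ) * N.map (Rat.cast : ℚ → ℝ) =
      (gramMat Q N).map (Rat.cast : ℚ → ℝ) := by
    ext i j
    simp [gramMat, Matrix.mul_apply]
  rw [thetaTerm, Complex.norm_exp, hg]
  congr 1
  simp only [trace_fin_two, Matrix.mul_apply, Fin.sum_univ_two, map_apply]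
  have : ∀ (q : ℚ) (w : ℂ), ((q : ℂ) * w).im = q * w.im := by
    intro q w
    rw [← ofReal_ratCast, im_ofReal_mul]
  rw [mul_assoc, re_ofReal_mul, I_mul_re]
  simp only [add_im, this]
  ring

variable [DecidableEq n] {Q : Matrix n n ℤ}

omit [DecidableEq n] in
theorem summable_gaussian_matrix {c : ℝ} (hc : 0 < c) :
    Summable fun V : Matrix n (Fin 2) ℤ => Real.exp (-c * ∑ i, ∑ j, (V i j : ℝ) ^ 2) := by
  have h := summable_exp_neg_mul_sum_sq (n := n × Fin 2) hc
  rw [← (Equiv.curry n (Fin 2) ℤ).symm.summable_iff] at h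
  refine h.congr fun V => ?_
  simp only [Function.comp_apply]
  rw [Fintype.sum_prod_type]
  rfl

omit [DecidableEq n] in
-- Clearing the denominator `M` moves the support into the integral matrices and changes the decay
-- rate to `c / M²`.
theorem summable_of_supp {M : ℕ} (hM : 0 < M) {u : Matrix n (Fin 2) ℚ → ℝ}
    (hu : ∀ N, u N ≠ 0 → ∀ i j, ∃ m : ℤ, N i j = m / M) {K c : ℝ} (hc : 0 < c)
    (h0 : ∀ N, 0 ≤ u N) (hb : ∀ N, u N ≤ K * Real.exp (-c * sqSum N)) : Summable u := by
  have hMq : (M : ℚ) ≠ 0 := by positivity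
  have hMr : (M : ℝ) ≠ 0 := by positivity
  let ι : Matrix n (Fin 2) ℤ → Matrix n (Fin 2) ℚ := fun V => V.map fun m => (m : ℚ) / M
  have hι : Function.Injective ι := by
    intro a b hab
    ext i j
    have := congrFun (congrFun hab i) j
    simp only [ι, map_apply] at this
    field_simp at this
    exact_mod_cast this
  refine (hι.summable_iff fun N hN => ?_).1 ?_
  · by_contra hne
    choose m hm using hu N hne
    exact hN ⟨Matrix.of m, by ext i j; simp [ι, hm]⟩
  · refine Summable.of_nonneg_of_le (fun V => h0 _) (fun V => hb _)
      (((summable_gaussian_matrix (n := n) (c := c / M ^ 2) (by positivity)).mul_left K).congr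
        fun V => ?_)
    congr 2
    simp only [sqSum, ι, map_apply, Finset.mul_sum]
    refine Finset.sum_congr rfl fun i _ => Finset.sum_congr rfl fun j _ => ?_
    push_cast
    field_simp

/-- A summable majorant of the terms of a theta series. -/
theorem LatticeBdd.exists_majorant {φ : Matrix n (Fin 2) ℚ → ℂ} (hφ : LatticeBdd φ)
    (hpos : (Q.map (Int.cast : ℤ → ℝ)).PosDef) {Y : Matrix (Fin 2) (Fin 2) ℝ} (hY : Y.PosDef) :
    ∃ u : Matrix n (Fin 2) ℚ → ℝ, Summable u ∧ ∀ N (Ω : Matrix (Fin 2) (Fin 2) ℂ),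
      (Ω.map Complex.im - Y).PosSemidef → ‖φ N * thetaTerm Q N Ω‖ * (1 + sqSum N) ≤ u N := by
  obtain ⟨M, hM, hsupp⟩ := hφ.supp
  obtain ⟨C, hC⟩ := hφ.bdd
  obtain ⟨c, hc, hle⟩ := exists_trace_form_ge hpos hY
  set d := Real.pi * c with hd
  have hdpos : 0 < d := by positivity
  have hC0 : 0 ≤ C := (norm_nonneg _).trans (hC 0)
  refine ⟨fun N => ‖φ N‖ * (Real.exp (-d * sqSum N) * (1 + sqSum N)),
    summable_of_supp hM (fun N hN => hsupp N (by
      intro h; simp [h] at hN)) (half_pos hdpos) (fun N => ?_) (K := C * (1 + 2 / d))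
      fun N => ?_, fun N Ω hΩ => ?_⟩
  · have := sqSum_nonneg N
    positivity
  · have hs := sqSum_nonneg N
    set s := sqSum N
    -- Half of the decay absorbs the polynomial factor. That factor is carried along because
    -- differentiating in `Ω` brings down a quadratic expression in `N`.
    have h1 : 1 + s ≤ (1 + 2 / d) * Real.exp (d / 2 * s) := by
      have h2 := Real.add_one_le_exp (d / 2 * s)
      have h3 : (2 / d) * (d / 2 * s) = s := by field_simp
      have h4 : 1 ≤ Real.exp (d / 2 * s) := Real.one_le_exp (by positivity)
      have h5 : (2 / d) * (d / 2 * s) ≤ (2 / d) * Real.exp (d / 2 * s) := by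
        gcongr; linarith
      linarith
    have h6 : Real.exp (-d * s) * Real.exp (d / 2 * s) = Real.exp (-(d / 2) * s) := by
      rw [← Real.exp_add]; ring_nf
    calc _ ≤ C * (Real.exp (-d * s) * ((1 + 2 / d) * Real.exp (d / 2 * s))) := by
          gcongr
          exact hC N
      _ = _ := by rw [← h6]; ring
  · rw [norm_mul, mul_assoc]
    have hs := sqSum_nonneg N
    refine mul_le_mul_of_nonneg_left (mul_le_mul_of_nonneg_right ?_ (by positivity))
      (norm_nonneg _)
    rw [norm_thetaTerm, Real.exp_le_exp]
    set V := N.map (Rat.cast : ℚ → ℝ)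
    have h1 := trace_form_nonneg hpos hΩ V
    have h2 := hle V
    rw [Matrix.mul_sub, trace_sub] at h1
    have h3 : c * sqSum N ≤ (Vᵀ * Q.map (Int.cast : ℤ → ℝ) * V * Ω.map Complex.im).trace := by
      refine le_trans h2 ?_
      linarith
    have := mul_le_mul_of_nonneg_left h3 Real.pi_pos.le
    rw [hd]
    linarith

theorem LatticeBdd.summable_norm {φ : Matrix n (Fin 2) ℚ → ℂ} (hφ : LatticeBdd φ)
    (hpos : (Q.map (Int.cast : ℤ → ℝ)).PosDef) {Ω : Matrix (Fin 2) (Fin 2) ℂ}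
    (hΩ : Ω ∈ siegelHalfSpace) : Summable fun N => ‖φ N * thetaTerm Q N Ω‖ := by
  obtain ⟨u, hu, hle⟩ := hφ.exists_majorant hpos hΩ.2
  refine Summable.of_nonneg_of_le (fun _ => norm_nonneg _) (fun N => ?_) hu
  refine le_trans ?_ (hle N Ω (by rw [sub_self]; exact PosSemidef.zero))
  have := sqSum_nonneg N
  have := norm_nonneg (φ N * thetaTerm Q N Ω)
  nlinarith

theorem LatticeBdd.hasSum {φ : Matrix n (Fin 2) ℚ → ℂ} (hφ : LatticeBdd φ)
    (hpos : (Q.map (Int.cast : ℤ → ℝ)).PosDef) {Ω : Matrix (Fin 2) (Fin 2) ℂ}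
    (hΩ : Ω ∈ siegelHalfSpace) : HasSum (fun N => φ N * thetaTerm Q N Ω) (thetaSum Q φ Ω) :=
  (hφ.summable_norm hpos hΩ).of_norm.hasSum

/-- Theta series are bounded on `{Im Ω > Y₀}`. -/
theorem LatticeBdd.bounded {φ : Matrix n (Fin 2) ℚ → ℂ} (hφ : LatticeBdd φ)
    (hpos : (Q.map (Int.cast : ℤ → ℝ)).PosDef) {Y : Matrix (Fin 2) (Fin 2) ℝ} (hY : Y.PosDef) :
    ∃ C : ℝ, ∀ Ω ∈ siegelHalfSpace, (Ω.map Complex.im - Y).PosDef → ‖thetaSum Q φ Ω‖ ≤ C := by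
  obtain ⟨u, hu, hle⟩ := hφ.exists_majorant hpos hY
  refine ⟨∑' N, u N, fun Ω hΩ hYΩ => ?_⟩
  refine (norm_tsum_le_tsum_norm (hφ.summable_norm hpos hΩ)).trans
    ((hφ.summable_norm hpos hΩ).tsum_le_tsum (fun N => ?_) hu)
  refine le_trans ?_ (hle N Ω hYΩ.posSemidef)
  have := sqSum_nonneg N
  have := norm_nonneg (φ N * thetaTerm Q N Ω)
  nlinarith

end

noncomputable section

open Complex

variable {n : Type*} [Fintype n] {Q : Matrix n n ℤ}

/-! ## The slash action on theta series -/

theorem thetaSum_slash_upper (k : ℤ) (φ : Matrix n (Fin 2) ℚ → ℂ) (b : Matrix (Fin 2) (Fin 2) ℚ)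
    (hb : b.IsSymm) (Ω : Matrix (Fin 2) (Fin 2) ℂ) :
    slash k (thetaSum Q φ) (Sp2Q.upper b hb) Ω =
      thetaSum Q (fun N => φ N * ratExp (1 / 2 * (gramMat Q N * b).trace)) Ω := by
  rw [slash_upper]
  refine tsum_congr fun N => ?_
  rw [mul_assoc]
  congr 1
  rw [thetaTerm, thetaTerm, ratExp, ← Complex.exp_add]
  congr 1
  have h : (((gramMat Q N * b).trace : ℚ) : ℂ) =
      ((gramMat Q N).map (Rat.cast : ℚ → ℂ) * b.map (Rat.cast : ℚ → ℂ)).trace := by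
    simp [trace_fin_two, Matrix.mul_apply, Fin.sum_univ_two]
  rw [Matrix.mul_add, trace_add, Rat.cast_mul, h]
  push_cast
  ring

theorem thetaSum_slash_levi (k : ℤ) (φ : Matrix n (Fin 2) ℚ → ℂ) (a : GL (Fin 2) ℚ)
    (Ω : Matrix (Fin 2) (Fin 2) ℂ) :
    slash k (thetaSum Q φ) (Sp2Q.levi a) Ω =
      thetaSum Q (fun N => ((a.1.det : ℚ) : ℂ) ^ k * φ (N * (a⁻¹ : GL (Fin 2) ℚ).1)) Ω := by
  rw [slash_levi, thetaSum, ← tsum_mul_left, thetaSum]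
  have h1 : a.1 * (a⁻¹ : GL (Fin 2) ℚ).1 = 1 := by rw [← Units.val_mul]; simp
  have h2 : (a⁻¹ : GL (Fin 2) ℚ).1 * a.1 = 1 := by rw [← Units.val_mul]; simp
  let e : Matrix n (Fin 2) ℚ ≃ Matrix n (Fin 2) ℚ :=
    ⟨fun N => N * a.1, fun N => N * (a⁻¹ : GL (Fin 2) ℚ).1,
      fun N => by simp only [Matrix.mul_assoc, h1, Matrix.mul_one],
      fun N => by simp only [Matrix.mul_assoc, h2, Matrix.mul_one]⟩
  refine Eq.trans ?_ (e.tsum_eq _)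
  refine tsum_congr fun N => ?_
  change _ = ((a.1.det : ℚ) : ℂ) ^ k * φ (N * a.1 * (a⁻¹ : GL (Fin 2) ℚ).1) *
    thetaTerm Q (N * a.1) Ω
  rw [Matrix.mul_assoc N, h1, Matrix.mul_one]
  refine Eq.trans ?_ (mul_assoc _ _ _).symm
  refine congrArg (fun w => ((a.1.det : ℚ) : ℂ) ^ k * (φ N * w)) ?_
  rw [thetaTerm, thetaTerm, gramMat_mul]
  congr 2
  have : (a.1ᵀ * gramMat Q N * a.1).map (Rat.cast : ℚ → ℂ) =
      (a.1.map (Rat.cast : ℚ → ℂ))ᵀ * (gramMat Q N).map (Rat.cast : ℚ → ℂ) *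
        a.1.map (Rat.cast : ℚ → ℂ) := by
    ext i j; simp [Matrix.mul_apply, Fin.sum_univ_two]
  rw [this, ← Matrix.mul_assoc, trace_mul_comm]
  simp only [Matrix.mul_assoc]

/-- Replace the second column. -/
def setCol (N : Matrix n (Fin 2) ℚ) (x : n → ℚ) : Matrix n (Fin 2) ℚ :=
  Matrix.of fun i => ![N i 0, x i]

/-- The Fourier transform in the second column. -/
def partialFourier [DecidableEq n] (Q : Matrix n n ℤ) (M R : ℕ) (φ : Matrix n (Fin 2) ℚ → ℂ)
    (N : Matrix n (Fin 2) ℚ) : ℂ :=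
  latticeFourier Q M R (fun x => φ (setCol N x)) (N.col 1)

variable [DecidableEq n]

theorem det_ne_zero_of_posDef (hpos : (Q.map (Int.cast : ℤ → ℝ)).PosDef) : Q.det ≠ 0 := by
  have h3 := hpos.det_pos
  rw [det_real_eq] at h3
  exact_mod_cast h3.ne'

/-- Cramer's rule: applying the adjugate bounds the denominators of the dual lattice by the
determinant. -/
theorem InDual.exists_div (hpos : (Q.map (Int.cast : ℤ → ℝ)).PosDef) {R : ℕ} (hR : 0 < R)
    {y : n → ℚ} (hy : InDual Q R y) (i : n) : ∃ m : ℤ, y i = m / ((R * Q.det.natAbs : ℕ) : ℚ) := by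
  obtain ⟨v, hv⟩ := hy
  have hdet := det_ne_zero_of_posDef hpos
  have hdet' : 0 < Q.det := by
    have h3 := hpos.det_pos
    rw [det_real_eq] at h3
    exact_mod_cast h3
  have h1 : (Q.map (Int.cast : ℤ → ℚ)).adjugate *ᵥ ((R : ℚ) • (Q.map (Int.cast : ℤ → ℚ) *ᵥ y)) =
      (Q.map (Int.cast : ℤ → ℚ)).adjugate *ᵥ fun i => (v i : ℚ) := by
    congr 1; ext i; exact hv i
  rw [mulVec_smul, mulVec_mulVec, adjugate_mul, smul_mulVec, one_mulVec] at h1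
  have h2 := congrFun h1 i
  have hdetq : (Q.map (Int.cast : ℤ → ℚ)).det = (Q.det : ℚ) :=
    (RingHom.map_det (Int.castRingHom ℚ) Q).symm
  have hadj : (Q.map (Int.cast : ℤ → ℚ)).adjugate = Q.adjugate.map (Int.cast : ℤ → ℚ) :=
    (RingHom.map_adjugate (Int.castRingHom ℚ) Q).symm
  rw [hadj, hdetq] at h2
  refine ⟨(Q.adjugate *ᵥ v) i, ?_⟩
  have h3 : ((Q.adjugate.map (Int.cast : ℤ → ℚ)) *ᵥ fun i => (v i : ℚ)) i =
      ((Q.adjugate *ᵥ v) i : ℤ) := by simp [mulVec, dotProduct]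
  have hnat : ((Q.det.natAbs : ℕ) : ℚ) = (Q.det : ℚ) := by
    rw [Nat.cast_natAbs, abs_of_pos hdet']
  rw [← h3, ← h2]
  rw [Nat.cast_mul, hnat]
  have : (R : ℚ) ≠ 0 := by positivity
  have : (Q.det : ℚ) ≠ 0 := by exact_mod_cast hdet
  simp only [Pi.smul_apply, smul_eq_mul]
  field_simp

theorem exists_common_denom {x : ℚ} {M K : ℕ} (hM : 0 < M) (hK : 0 < K)
    (h : ∃ m : ℤ, x = m / M) : ∃ m : ℤ, x = m / ((M * K : ℕ) : ℚ) := by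
  obtain ⟨m, rfl⟩ := h
  refine ⟨m * K, ?_⟩
  have : (M : ℚ) ≠ 0 := by positivity
  have : (K : ℚ) ≠ 0 := by positivity
  push_cast
  field_simp

theorem norm_latticeFourier_le (M R : ℕ) {ψ : (n → ℚ) → ℂ} {C : ℝ} (hC : ∀ x, ‖ψ x‖ ≤ C)
    (y : n → ℚ) : ‖latticeFourier Q M R ψ y‖ ≤
      ‖((R : ℂ) ^ Fintype.card n * (√(Q.det : ℝ) : ℝ))⁻¹‖ *
        (Fintype.card (n → Fin (R * M)) * C) := by
  have hC0 : 0 ≤ C := (norm_nonneg _).trans (hC 0)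
  rw [latticeFourier]
  split_ifs
  · rw [norm_mul]
    gcongr
    refine (norm_sum_le _ _).trans ?_
    refine (Finset.sum_le_card_nsmul _ _ C fun k _ => ?_).trans ?_
    · rw [norm_mul, norm_ratExp, mul_one]
      exact hC _
    · simp
  · simp only [norm_zero]
    positivity

theorem LatticeBdd.partialFourier {φ : Matrix n (Fin 2) ℚ → ℂ} (hφ : LatticeBdd φ)
    (hpos : (Q.map (Int.cast : ℤ → ℝ)).PosDef) {M R : ℕ} (hR : 0 < R) :
    LatticeBdd (partialFourier Q M R φ) := by
  obtain ⟨M₀, hM₀, hsupp⟩ := hφ.supp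
  obtain ⟨C, hC⟩ := hφ.bdd
  have hdet : 0 < Q.det.natAbs := Int.natAbs_pos.2 (det_ne_zero_of_posDef hpos)
  refine ⟨⟨M₀ * (R * Q.det.natAbs), by positivity, fun N hN i j => ?_⟩, ?_⟩
  · rw [_root_.partialFourier, latticeFourier] at hN
    split_ifs at hN with hd
    · fin_cases j
      · obtain ⟨k, -, hk⟩ := Finset.exists_ne_zero_of_sum_ne_zero (right_ne_zero_of_mul hN)
        exact exists_common_denom hM₀ (by positivity) (hsupp _ (left_ne_zero_of_mul hk) i 0)
      · have := exists_common_denom (by positivity) hM₀ (hd.exists_div hpos hR i)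
        rwa [mul_comm] at this
    · exact (hN rfl).elim
  · exact ⟨_, fun N => norm_latticeFourier_le M R (fun x => hC _) _⟩

/-- Inversion in the second variable acts on theta series by partial Fourier transform. -/
theorem thetaSum_slash_inversion (hQ : Q.IsSymm) (hpos : (Q.map (Int.cast : ℤ → ℝ)).PosDef)
    (hcard : Fintype.card n = 8) {M R : ℕ} (hM : 0 < M) (hR : 0 < R)
    {φ : Matrix n (Fin 2) ℚ → ℂ} (hφ : LatticeBdd φ)
    (hsupp : ∀ N, φ N ≠ 0 → ∀ i, ∃ m : ℤ, N i 1 = m / M)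
    (hper : ∀ N (v : n → ℤ), φ (setCol N fun i => N i 1 + R * v i) = φ N)
    {Ω : Matrix (Fin 2) (Fin 2) ℂ} (hΩ : Ω ∈ siegelHalfSpace) :
    slash 4 (thetaSum Q φ) Sp2Q.inversion Ω = thetaSum Q (partialFourier Q M R φ) Ω := by
  have him := im_pos_of_mem hΩ 1
  have h0 : Ω 1 1 ≠ 0 := fun h => by simp [h] at him
  have h10 : Ω 1 0 = Ω 0 1 := hΩ.1.apply 0 1
  rw [slash_inversion 4 _ hΩ.1 h0]
  let e : Matrix n (Fin 2) ℚ ≃ (n → ℚ) × (n → ℚ) :=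
    ⟨fun N => (N.col 0, N.col 1), fun p => Matrix.of fun i => ![p.1 i, p.2 i],
      fun N => by ext i j; fin_cases j <;> rfl, fun p => rfl⟩
  have hl := (hφ.hasSum hpos (invertSecond_mem hΩ))
  have hr := (hφ.partialFourier hpos (M := M) hR).hasSum hpos hΩ
  rw [← e.symm.hasSum_iff] at hl hr
  set ω := -(1 / Ω 1 1) with hω
  set z := -(Ω 0 1 / Ω 1 1) with hz
  have hωim : 0 < ω.im := im_pos_of_mem (invertSecond_mem hΩ) 1
  have hω0 : ω ≠ 0 := fun h => by simp [h] at hωim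
  have hω11 : Ω 1 1 = -1 / ω := by rw [hω]; field_simp
  have hz01 : Ω 0 1 = z / ω := by rw [hω, hz]; field_simp
  -- For a fixed first column the sum over the second obeys the one-column functional equation at `ω
  -- = -1/Ω₂₂`, `z = -Ω₁₂/Ω₂₂`. What is left of the exponent is `q(a)` times a factor depending on
  -- `Ω` only.
  have inner : ∀ a : n → ℚ, ∃ t : ℂ,
      HasSum (fun y => (partialFourier Q M R φ (e.symm (a, y)) * thetaTerm Q (e.symm (a, y)) Ω)) t ∧
      HasSum (fun x => φ (e.symm (a, x)) * thetaTerm Q (e.symm (a, x)) (invertSecond Ω))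
        (((-I * ω)⁻¹) ^ 4 * t) := by
    intro a
    obtain ⟨t, ht1, ht2⟩ := summable_column_dual_and_hasSum hQ hpos (j := 4) (by rw [hcard]) hM hR
      (ψ := fun x => φ (e.symm (a, x))) (fun x hx i => hsupp _ hx i)
      (fun x v => hper (e.symm (a, x)) v) hωim z a
    refine ⟨t * cexp (Real.pi * I * ((bil Q a a : ℚ) * (Ω 0 0 - Ω 0 1 ^ 2 / Ω 1 1))), ?_, ?_⟩
    · refine (ht1.mul_right _).congr_fun fun y => ?_
      refine Eq.trans ?_ (mul_assoc _ _ _).symm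
      refine congrArg (latticeFourier Q M R (fun x => φ (e.symm (a, x))) y * ·) ?_
      rw [thetaTerm_eq, ← Complex.exp_add]
      congr 1
      change Real.pi * I * ((bil Q a a : ℚ) * Ω 0 0 + (bil Q a y : ℚ) * Ω 1 0 +
        ((bil Q y a : ℚ) * Ω 0 1 + (bil Q y y : ℚ) * Ω 1 1)) = _
      rw [h10, hω11, hz01, bil_comm hQ y a]
      field_simp
      ring
    · rw [← mul_assoc]
      refine (ht2.mul_right _).congr_fun fun x => ?_
      refine Eq.trans ?_ (mul_assoc _ _ _).symm
      refine congrArg (φ (e.symm (a, x)) * ·) ?_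
      rw [thetaTerm_eq, ← Complex.exp_add]
      congr 1
      change Real.pi * I * ((bil Q a a : ℚ) * (Ω 0 0 - Ω 0 1 ^ 2 / Ω 1 1) + (bil Q a x : ℚ) * z +
        ((bil Q x a : ℚ) * z + (bil Q x x : ℚ) * ω)) = _
      rw [bil_comm hQ x a]
      ring
  choose t ht1 ht2 using inner
  have h1 := hr.prod_fiberwise ht1
  have h2 := (hl.prod_fiberwise ht2).unique (h1.mul_left _)
  rw [h2, ← mul_assoc, hω]
  -- Eight variables contribute the fourth power of `(-iω)⁻¹`. Since `i⁴ = 1` it equals `Ω₂₂⁴`,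
  -- which cancels the automorphy factor of weight four.
  have h3 : (-I * -(1 / Ω 1 1))⁻¹ ^ 4 = Ω 1 1 ^ 4 := by
    have : (-I * -(1 / Ω 1 1))⁻¹ = Ω 1 1 * (-I) := by
      rw [neg_mul_neg, mul_inv, inv_I]; field_simp
    rw [this, mul_pow, neg_pow, I_pow_four]; ring
  rw [h3, _root_.zpow_neg]
  have h4 : (-Ω 1 1) ^ (4 : ℤ) = Ω 1 1 ^ 4 := by
    rw [show (4 : ℤ) = ((4 : ℕ) : ℤ) from rfl, zpow_natCast]; ring
  rw [h4, inv_mul_cancel₀ (pow_ne_zero 4 h0), one_mul]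

end

noncomputable section

open Complex

variable {n : Type*} [Fintype n] {Q : Matrix n n ℤ}

/-! ## Holomorphy -/

theorem posDef_fin_two_iff {a b d : ℝ} :
    (!![a, b; b, d] : Matrix (Fin 2) (Fin 2) ℝ).PosDef ↔ 0 < a ∧ 0 < a * d - b ^ 2 := by
  constructor
  · intro h
    refine ⟨by simpa using h.diag_pos (i := 0), ?_⟩
    have := h.det_pos
    rw [det_fin_two] at this
    simp at this
    linarith [sq b]
  · rintro ⟨ha, hd⟩
    refine Matrix.PosDef.of_dotProduct_mulVec_pos ?_ fun v hv => ?_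
    · ext i j; fin_cases i <;> fin_cases j <;> simp
    · have h : star v ⬝ᵥ !![a, b; b, d] *ᵥ v =
          ((a * v 0 + b * v 1) ^ 2 + (a * d - b ^ 2) * v 1 ^ 2) / a := by
        simp [dotProduct, mulVec, Fin.sum_univ_two]
        field_simp
        ring
      rw [h]
      refine div_pos ?_ ha
      by_cases h1 : v 1 = 0
      · have h0 : v 0 ≠ 0 := by
          intro h0
          exact hv (by ext i; fin_cases i <;> simp [h0, h1])
        rw [h1]
        have : a * v 0 ≠ 0 := mul_ne_zero ha.ne' h0
        have := pow_pos (abs_pos.2 this) 2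
        rw [sq_abs] at this
        simpa using this
      · have : 0 < v 1 ^ 2 := by positivity
        have := mul_pos hd this
        nlinarith [sq_nonneg (a * v 0 + b * v 1)]

/-- The symmetric matrix with given coordinates. -/
def symMat (x : ℂ × ℂ × ℂ) : Matrix (Fin 2) (Fin 2) ℂ := !![x.1, x.2.1; x.2.1, x.2.2]

theorem symMat_mem_iff (x : ℂ × ℂ × ℂ) :
    symMat x ∈ siegelHalfSpace ↔ 0 < x.1.im ∧ 0 < x.1.im * x.2.2.im - x.2.1.im ^ 2 := by
  rw [← posDef_fin_two_iff]
  have h1 : (symMat x).IsSymm := by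
    ext i j; fin_cases i <;> fin_cases j <;> simp [symMat]
  have h2 : (symMat x).map Complex.im = !![x.1.im, x.2.1.im; x.2.1.im, x.2.2.im] := by
    ext i j; fin_cases i <;> fin_cases j <;> simp [symMat]
  rw [← h2]
  exact and_iff_right h1

/-- The linear form `Ω ↦ tr(Nᵀ Q N Ω)` in coordinates. -/
def traceForm (Q : Matrix n n ℤ) (N : Matrix n (Fin 2) ℚ) : ℂ × ℂ × ℂ →L[ℂ] ℂ :=
  ((bil Q (N.col 0) (N.col 0) : ℚ) : ℂ) • ContinuousLinearMap.fst ℂ ℂ (ℂ × ℂ) +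
    ((bil Q (N.col 0) (N.col 1) + bil Q (N.col 1) (N.col 0) : ℚ) : ℂ) •
      (ContinuousLinearMap.fst ℂ ℂ ℂ).comp (ContinuousLinearMap.snd ℂ ℂ (ℂ × ℂ)) +
    ((bil Q (N.col 1) (N.col 1) : ℚ) : ℂ) •
      (ContinuousLinearMap.snd ℂ ℂ ℂ).comp (ContinuousLinearMap.snd ℂ ℂ (ℂ × ℂ))

theorem thetaTerm_symMat (Q : Matrix n n ℤ) (N : Matrix n (Fin 2) ℚ) (x : ℂ × ℂ × ℂ) :
    thetaTerm Q N (symMat x) = cexp (Real.pi * I * traceForm Q N x) := by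
  rw [thetaTerm_eq]
  congr 2
  simp [symMat, traceForm]
  ring

theorem norm_bil_col_le (N : Matrix n (Fin 2) ℚ) (j k : Fin 2) :
    ‖((bil Q (N.col j) (N.col k) : ℚ) : ℂ)‖ ≤ (∑ a, ∑ b, |(Q a b : ℝ)|) * sqSum N := by
  have hle : ∀ (a : n) (j : Fin 2), (N a j : ℝ) ^ 2 ≤ sqSum N := by
    intro a j
    refine le_trans ?_ (Finset.single_le_sum (f := fun i => ∑ j, (N i j : ℝ) ^ 2)
      (fun i _ => Finset.sum_nonneg fun _ _ => sq_nonneg _) (Finset.mem_univ a))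
    exact Finset.single_le_sum (f := fun j => (N a j : ℝ) ^ 2)
      (fun _ _ => sq_nonneg _) (Finset.mem_univ j)
  have h1 : ‖((bil Q (N.col j) (N.col k) : ℚ) : ℂ)‖ =
      |∑ a, ∑ b, (N a j : ℝ) * (Q a b * N b k)| := by
    rw [← ofReal_ratCast, Complex.norm_real, Real.norm_eq_abs]
    congr 1
    simp [bil, dotProduct, mulVec, Finset.mul_sum]
  rw [h1, Finset.sum_mul]
  refine (Finset.abs_sum_le_sum_abs _ _).trans (Finset.sum_le_sum fun a _ => ?_)
  rw [Finset.sum_mul]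
  refine (Finset.abs_sum_le_sum_abs _ _).trans (Finset.sum_le_sum fun b _ => ?_)
  rw [abs_mul, abs_mul]
  have h2 : |(N a j : ℝ)| * |(N b k : ℝ)| ≤ sqSum N := by
    have := hle a j
    have := hle b k
    nlinarith [sq_nonneg (|(N a j : ℝ)| - |(N b k : ℝ)|), sq_abs (N a j : ℝ), sq_abs (N b k : ℝ)]
  calc _ = |(Q a b : ℝ)| * (|(N a j : ℝ)| * |(N b k : ℝ)|) := by ring
    _ ≤ _ := by gcongr

theorem norm_traceForm_le (N : Matrix n (Fin 2) ℚ) :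
    ‖traceForm Q N‖ ≤ 4 * (∑ a, ∑ b, |(Q a b : ℝ)|) * sqSum N := by
  have h := fun j k => norm_bil_col_le (Q := Q) N j k
  set K := (∑ a, ∑ b, |(Q a b : ℝ)|) * sqSum N with hK
  refine ContinuousLinearMap.opNorm_le_bound _ (by
    have := (norm_nonneg _).trans (h 0 0); rw [mul_assoc, ← hK]; positivity) fun x => ?_
  have hx1 : ‖x.1‖ ≤ ‖x‖ := norm_fst_le x
  have hx2 : ‖x.2.1‖ ≤ ‖x‖ := (norm_fst_le x.2).trans (norm_snd_le x)
  have hx3 : ‖x.2.2‖ ≤ ‖x‖ := (norm_snd_le x.2).trans (norm_snd_le x)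
  have hx : traceForm Q N x = (bil Q (N.col 0) (N.col 0) : ℚ) * x.1 +
      ((bil Q (N.col 0) (N.col 1) : ℚ) + (bil Q (N.col 1) (N.col 0) : ℚ)) * x.2.1 +
      (bil Q (N.col 1) (N.col 1) : ℚ) * x.2.2 := by simp [traceForm]
  rw [hx]
  have hK0 : 0 ≤ K := (norm_nonneg _).trans (h 0 0)
  calc _ ≤ K * ‖x‖ + (K + K) * ‖x‖ + K * ‖x‖ := by
        refine (norm_add_le _ _).trans (add_le_add ((norm_add_le _ _).trans (add_le_add ?_ ?_)) ?_)
        · rw [norm_mul]; exact mul_le_mul (h 0 0) hx1 (norm_nonneg _) hK0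
        · rw [norm_mul]
          exact mul_le_mul ((norm_add_le _ _).trans (add_le_add (h 0 1) (h 1 0))) hx2
            (norm_nonneg _) (by positivity)
        · rw [norm_mul]; exact mul_le_mul (h 1 1) hx3 (norm_nonneg _) hK0
    _ = _ := by rw [hK]; ring

/-- Termwise differentiation: the derivative of a term is the term times a linear form of norm
`O(sqSum N)`, and the weight `1 + sqSum N` in `LatticeBdd.exists_majorant` was put there to cover
it. -/
theorem LatticeBdd.differentiableOn [DecidableEq n] {φ : Matrix n (Fin 2) ℚ → ℂ}
    (hφ : LatticeBdd φ) (hpos : (Q.map (Int.cast : ℤ → ℝ)).PosDef) :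
    DifferentiableOn ℂ (fun x => thetaSum Q φ (symMat x)) {x | symMat x ∈ siegelHalfSpace} := by
  intro x₀ hx₀
  refine DifferentiableAt.differentiableWithinAt ?_
  have hx₀' := (symMat_mem_iff x₀).1 hx₀
  -- Half of the imaginary part at the base point, so that `Im Ω - Y` stays positive near that
  -- point.
  set Y : Matrix (Fin 2) (Fin 2) ℝ :=
    !![x₀.1.im / 2, x₀.2.1.im / 2; x₀.2.1.im / 2, x₀.2.2.im / 2] with hY
  have hYpos : Y.PosDef := posDef_fin_two_iff.2 ⟨by linarith [hx₀'.1], by nlinarith [hx₀'.2]⟩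
  obtain ⟨u, hu, hle⟩ := hφ.exists_majorant hpos hYpos
  let U : Set (ℂ × ℂ × ℂ) := {x | 0 < x.1.im - x₀.1.im / 2} ∩ {x |
    0 < (x.1.im - x₀.1.im / 2) * (x.2.2.im - x₀.2.2.im / 2) - (x.2.1.im - x₀.2.1.im / 2) ^ 2}
  have hU : IsOpen U := by
    exact IsOpen.inter
      (isOpen_lt (g := fun x : ℂ × ℂ × ℂ => x.1.im - x₀.1.im / 2) continuous_const (by fun_prop))
      (isOpen_lt (g := fun x : ℂ × ℂ × ℂ => (x.1.im - x₀.1.im / 2) *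
        (x.2.2.im - x₀.2.2.im / 2) - (x.2.1.im - x₀.2.1.im / 2) ^ 2) continuous_const (by fun_prop))
  have hx₀U : x₀ ∈ U := by
    refine ⟨?_, ?_⟩ <;> simp only [Set.mem_ofPred_eq]
    · linarith [hx₀'.1]
    · nlinarith [hx₀'.2]
  obtain ⟨r, hr, hball⟩ := Metric.isOpen_iff.1 hU x₀ hx₀U
  have hUpos : ∀ x ∈ U, ((symMat x).map Complex.im - Y).PosSemidef := by
    intro x hx
    have h2 : (symMat x).map Complex.im - Y = !![x.1.im - x₀.1.im / 2, x.2.1.im - x₀.2.1.im / 2;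
        x.2.1.im - x₀.2.1.im / 2, x.2.2.im - x₀.2.2.im / 2] := by
      ext i j; fin_cases i <;> fin_cases j <;> simp [symMat, hY]
    rw [h2]
    exact (posDef_fin_two_iff.2 hx).posSemidef
  set K := 4 * (∑ a, ∑ b, |(Q a b : ℝ)|) with hK
  have hK0 : 0 ≤ K := by positivity
  have := hasFDerivAt_tsum_of_isPreconnected (𝕜 := ℂ) (u := fun N => Real.pi * K * u N)
    (f := fun N x => φ N * thetaTerm Q N (symMat x))
    (f' := fun N x => (φ N * thetaTerm Q N (symMat x)) • ((Real.pi * I : ℂ) • traceForm Q N))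
    (hu.mul_left _) Metric.isOpen_ball (convex_ball x₀ r).isPreconnected
    (fun N x _ => ?_) (fun N x hx => ?_) (Metric.mem_ball_self hr)
    ((hφ.summable_norm hpos hx₀).of_norm) (Metric.mem_ball_self hr)
  · exact this.differentiableAt
  · simp_rw [thetaTerm_symMat]
    have h := ((((traceForm Q N).hasFDerivAt (x := x)).const_mul (Real.pi * I : ℂ)).cexp).const_mul
      (φ N)
    refine h.congr_fderiv ?_
    rw [smul_smul]
  · rw [norm_smul, norm_smul]
    have h1 := hle N (symMat x) (hUpos x (hball hx))
    have h2 := norm_traceForm_le (Q := Q) N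
    have h3 : ‖(Real.pi * I : ℂ)‖ = Real.pi := by simp [abs_of_pos Real.pi_pos]
    have hs := sqSum_nonneg N
    rw [h3]
    calc _ ≤ ‖φ N * thetaTerm Q N (symMat x)‖ * (Real.pi * (K * sqSum N)) := by gcongr
      _ = Real.pi * K * (‖φ N * thetaTerm Q N (symMat x)‖ * sqSum N) := by ring
      _ ≤ Real.pi * K * (‖φ N * thetaTerm Q N (symMat x)‖ * (1 + sqSum N)) := by
          gcongr
          linarith
      _ ≤ _ := by
          have := Real.pi_pos
          gcongr

/-! ## Schwartz functions -/

/-- Schwartz functions on rational matrices: bounded, supported on a lattice, periodic. -/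
structure IsSchwartz (φ : Matrix n (Fin 2) ℚ → ℂ) : Prop extends LatticeBdd φ where
  per : ∃ R : ℕ, 0 < R ∧ ∀ N (V : Matrix n (Fin 2) ℤ),
    φ (N + (R : ℚ) • V.map (Int.cast : ℤ → ℚ)) = φ N

/-- `e(½ x)` only depends on `x` modulo `2`. -/
theorem ratExp_half_add_even {x y : ℚ} (h : ∃ m : ℤ, y = 2 * m) :
    ratExp (1 / 2 * (x + y)) = ratExp (1 / 2 * x) := by
  obtain ⟨m, rfl⟩ := h
  rw [mul_add, ← mul_assoc, one_div_mul_cancel two_ne_zero, one_mul, ratExp_add_int]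

omit [Fintype n] in
theorem LatticeBdd.mul_unit {φ : Matrix n (Fin 2) ℚ → ℂ} (hφ : LatticeBdd φ)
    {χ : Matrix n (Fin 2) ℚ → ℂ} (hχ : ∀ N, ‖χ N‖ = 1) : LatticeBdd fun N => φ N * χ N := by
  obtain ⟨M, hM, hsupp⟩ := hφ.supp
  obtain ⟨C, hC⟩ := hφ.bdd
  refine ⟨⟨M, hM, fun N hN => hsupp N (left_ne_zero_of_mul hN)⟩, C, fun N => ?_⟩
  rw [norm_mul, hχ, mul_one]
  exact hC N

theorem IsSchwartz.upper {φ : Matrix n (Fin 2) ℚ → ℂ} (hφ : IsSchwartz φ)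
    (b : Matrix (Fin 2) (Fin 2) ℤ) :
    IsSchwartz fun N => φ N * ratExp (1 / 2 * (gramMat Q N * b.map (Int.cast : ℤ → ℚ)).trace) := by
  obtain ⟨M, hM, hsupp⟩ := hφ.supp
  obtain ⟨R, hR, hper⟩ := hφ.per
  -- In the period `2MR` the factor `R` preserves `φ`, `M` makes the cross terms with `N` integral,
  -- and `2` makes the half trace change by an integer.
  refine ⟨hφ.toLatticeBdd.mul_unit fun N => norm_ratExp _, 2 * M * R, by positivity,
    fun N V => ?_⟩
  have hmul : ((2 * M * R : ℕ) : ℚ) • V.map (Int.cast : ℤ → ℚ) =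
      (R : ℚ) • ((2 * M : ℤ) • V).map (Int.cast : ℤ → ℚ) := by
    ext i j; simp; ring
  by_cases h0 : φ N = 0
  · rw [hmul, hper, h0, zero_mul, zero_mul]
  have hφN : φ (N + ((2 * M * R : ℕ) : ℚ) • V.map (Int.cast : ℤ → ℚ)) = φ N := by
    rw [hmul, hper]
  rw [hφN]
  congr 1
  choose m hm using hsupp N h0
  set m' : Matrix n (Fin 2) ℤ := Matrix.of m
  have hMq : (M : ℚ) ≠ 0 := by positivity
  have hN : (M : ℚ) • N = m'.map (Int.cast : ℤ → ℚ) := by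
    ext i j; simp [m', hm]; field_simp
  set E : Matrix (Fin 2) (Fin 2) ℤ := Matrix.of fun i j =>
    R * ((m'ᵀ * Q * V) i j + (Vᵀ * Q * m') i j) + 2 * M ^ 2 * R ^ 2 * (Vᵀ * Q * V) i j
  have hg : gramMat Q (N + ((2 * M * R : ℕ) : ℚ) • V.map (Int.cast : ℤ → ℚ)) =
      gramMat Q N + (2 : ℚ) • E.map (Int.cast : ℤ → ℚ) := by
    have hE : E.map (Int.cast : ℤ → ℚ) = (R : ℚ) •
        ((m'.map (Int.cast : ℤ → ℚ))ᵀ * Q.map (Int.cast : ℤ → ℚ) * V.map (Int.cast : ℤ → ℚ) +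
          (V.map (Int.cast : ℤ → ℚ))ᵀ * Q.map (Int.cast : ℤ → ℚ) * m'.map (Int.cast : ℤ → ℚ)) +
        (2 * M ^ 2 * R ^ 2 : ℚ) • ((V.map (Int.cast : ℤ → ℚ))ᵀ * Q.map (Int.cast : ℤ → ℚ) *
          V.map (Int.cast : ℤ → ℚ)) := by
      ext i j
      simp [E, Matrix.mul_apply]
      ring
    rw [hE, ← hN]
    simp only [gramMat, transpose_add, transpose_smul, Matrix.add_mul, Matrix.mul_add,
      Matrix.smul_mul, Matrix.mul_smul, smul_add, smul_smul]
    push_cast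
    module
  rw [hg, Matrix.add_mul, trace_add]
  refine ratExp_half_add_even ⟨(E * b).trace, ?_⟩
  rw [Matrix.smul_mul, trace_smul, smul_eq_mul]
  congr 1
  simp [trace_fin_two, Matrix.mul_apply, Fin.sum_univ_two]

/-- An integral element of `GL₂(ℚ)`. -/
def leviZ (a : GL (Fin 2) ℤ) : Sp2Q :=
  Sp2Q.levi (GeneralLinearGroup.map (Int.castRingHom ℚ) a)

omit [Fintype n] in
theorem IsSchwartz.levi {φ : Matrix n (Fin 2) ℚ → ℂ} (hφ : IsSchwartz φ)
    (a : GL (Fin 2) ℤ) (c : ℂ) :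
    IsSchwartz fun N => c * φ (N * a.1.map (Int.cast : ℤ → ℚ)) := by
  obtain ⟨M, hM, hsupp⟩ := hφ.supp
  obtain ⟨C, hC⟩ := hφ.bdd
  obtain ⟨R, hR, hper⟩ := hφ.per
  have hinv : a.1.map (Int.cast : ℤ → ℚ) * (a⁻¹).1.map (Int.cast : ℤ → ℚ) = 1 := by
    have h : a.1 * (a⁻¹ : GL (Fin 2) ℤ).1 = 1 := by rw [← Units.val_mul]; simp
    have := congrArg (fun M : Matrix (Fin 2) (Fin 2) ℤ => M.map (Int.castRingHom ℚ)) h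
    simp only [Matrix.map_mul] at this
    rw [Matrix.map_one _ (map_zero _) (map_one _)] at this
    exact this
  refine ⟨⟨⟨M, hM, fun N hN i j => ?_⟩, ‖c‖ * C, fun N => ?_⟩, R, hR, fun N V => ?_⟩
  · choose m hm using hsupp _ (right_ne_zero_of_mul hN)
    have hN' : N = N * a.1.map (Int.cast : ℤ → ℚ) * (a⁻¹).1.map (Int.cast : ℤ → ℚ) := by
      rw [Matrix.mul_assoc, hinv, Matrix.mul_one]
    refine ⟨∑ l, m i l * (a⁻¹).1 l j, ?_⟩
    rw [hN', Matrix.mul_apply]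
    simp_rw [hm]
    push_cast
    rw [Finset.sum_div]
    refine Finset.sum_congr rfl fun l _ => ?_
    simp only [map_apply]
    ring
  · rw [norm_mul]
    gcongr
    exact hC _
  · have : (N + (R : ℚ) • V.map (Int.cast : ℤ → ℚ)) * a.1.map (Int.cast : ℤ → ℚ) =
        N * a.1.map (Int.cast : ℤ → ℚ) + (R : ℚ) • (V * a.1).map (Int.cast : ℤ → ℚ) := by
      rw [Matrix.add_mul, Matrix.smul_mul]
      congr 2
      exact (Matrix.map_mul (f := Int.castRingHom ℚ)).symm
    rw [this, hper]

omit [Fintype n] in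
theorem IsSchwartz.setCol_per {φ : Matrix n (Fin 2) ℚ → ℂ} {R : ℕ}
    (hper : ∀ N (V : Matrix n (Fin 2) ℤ), φ (N + (R : ℚ) • V.map (Int.cast : ℤ → ℚ)) = φ N)
    (N : Matrix n (Fin 2) ℚ) (v : n → ℤ) : φ (setCol N fun i => N i 1 + R * v i) = φ N := by
  rw [← hper N (Matrix.of fun i => ![0, v i])]
  congr 1
  ext i j
  fin_cases j <;> simp [setCol]

theorem IsSchwartz.partialFourier [DecidableEq n] {φ : Matrix n (Fin 2) ℚ → ℂ} (hφ : IsSchwartz φ)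
    (hpos : (Q.map (Int.cast : ℤ → ℝ)).PosDef) {M R : ℕ} (hM : 0 < M) (hR : 0 < R)
    (hper : ∀ N (V : Matrix n (Fin 2) ℤ), φ (N + (R : ℚ) • V.map (Int.cast : ℤ → ℚ)) = φ N) :
    IsSchwartz (partialFourier Q M R φ) := by
  -- The factor `R` of the new period serves the first column, where `φ` is untouched; the factor
  -- `M` makes the pairing with vectors of `M⁻¹ℤⁿ` integral in the second.
  refine ⟨hφ.toLatticeBdd.partialFourier hpos hR, M * R, by positivity, fun N V => ?_⟩
  have hMq : (M : ℚ) ≠ 0 := by positivity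
  set N' := N + ((M * R : ℕ) : ℚ) • V.map (Int.cast : ℤ → ℚ) with hN'
  have h1 : ∀ x, φ (setCol N' x) = φ (setCol N x) := by
    intro x
    rw [← hper (setCol N x) (Matrix.of fun i => ![M * V i 0, 0])]
    congr 1
    ext i j
    fin_cases j
    · simp [setCol, hN']; ring
    · simp [setCol]
  have hcol : N'.col 1 = N.col 1 + ((M * R : ℕ) : ℚ) • fun i => (V i 1 : ℚ) := by
    ext i; simp [hN']
  have h2 : InDual Q R (N'.col 1) ↔ InDual Q R (N.col 1) := by
    rw [hcol]
    have hQV : ∀ i, (Q.map (Int.cast : ℤ → ℚ) *ᵥ fun i => (V i 1 : ℚ)) i =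
        ((Q *ᵥ fun i => V i 1) i : ℤ) := by
      intro i; simp [mulVec, dotProduct]
    constructor
    · rintro ⟨v, hv⟩
      refine ⟨v - (R * (M * R) : ℤ) • (Q *ᵥ fun i => V i 1), fun i => ?_⟩
      have := hv i
      rw [mulVec_add, mulVec_smul, Pi.add_apply, Pi.smul_apply, hQV] at this
      simp only [Pi.sub_apply, Pi.smul_apply, smul_eq_mul] at this ⊢
      push_cast at this ⊢
      linarith
    · rintro ⟨v, hv⟩
      refine ⟨v + (R * (M * R) : ℤ) • (Q *ᵥ fun i => V i 1), fun i => ?_⟩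
      have := hv i
      rw [mulVec_add, mulVec_smul, Pi.add_apply, Pi.smul_apply, hQV]
      simp only [Pi.add_apply, Pi.smul_apply, smul_eq_mul]
      push_cast at this ⊢
      linarith
  simp only [_root_.partialFourier, latticeFourier, h1]
  by_cases hd : InDual Q R (N.col 1)
  · rw [if_pos (h2.2 hd), if_pos hd]
    congr 1
    refine Finset.sum_congr rfl fun k _ => ?_
    congr 1
    rw [hcol, bil_add_right, bil_smul_right]
    have : ((M * R : ℕ) : ℚ) * bil Q (fun i => ((k i : ℕ) : ℚ) / M) (fun i => (V i 1 : ℚ)) =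
        ((R * bil Q (fun i => ((k i : ℕ) : ℤ)) (fun i => V i 1) : ℤ) : ℚ) := by
      have h3 : (fun i => ((k i : ℕ) : ℚ) / M) = (M : ℚ)⁻¹ • fun i => (((k i : ℕ) : ℤ) : ℚ) := by
        ext i; simp; ring
      rw [h3, bil_smul_left, Int.cast_mul, intCast_bil]
      push_cast
      field_simp
    rw [this, ratExp_add_int]
  · rw [if_neg (mt h2.1 hd), if_neg hd]

end

noncomputable section

/-! ## Generators of `Γ₀(N)` in degree two -/

/-- `Sp₂(ℤ)` as a group of integral matrices. -/
abbrev SpZ : Type := Matrix.symplecticGroup (Fin 2) ℤ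

namespace SpZ

/-- The inclusion `Sp₂(ℤ) → Sp₂(ℚ)`. -/
def toQ : SpZ →* Sp2Q where
  toFun g := ⟨g.1.map (Int.castRingHom ℚ), SymplecticGroup.map_mem g.2 (Int.castRingHom ℚ)⟩
  map_one' := Subtype.ext (Matrix.map_one _ (map_zero _) (map_one _))
  map_mul' _ _ := Subtype.ext Matrix.map_mul

/-- Integral translations. -/
def upper (b : Matrix (Fin 2) (Fin 2) ℤ) (hb : b.IsSymm) : SpZ :=
  ⟨fromBlocks 1 b 0 1, SymplecticGroup.fromBlocks_mem_iff.2 (by simp [hb.eq])⟩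

/-- Integral lower unipotent elements. -/
def lower (b : Matrix (Fin 2) (Fin 2) ℤ) (hb : b.IsSymm) : SpZ :=
  ⟨fromBlocks 1 0 b 1, SymplecticGroup.fromBlocks_mem_iff.2 (by simp [hb.eq])⟩

/-- Integral Levi elements. -/
def levi (a : GL (Fin 2) ℤ) : SpZ :=
  ⟨fromBlocks a 0 0 (a⁻¹ : GL (Fin 2) ℤ).1ᵀ, SymplecticGroup.fromBlocks_mem_iff.2 (by
    simp [← transpose_mul])⟩

/-- The embedded `SL₂(ℤ)`. -/
def emb (σ : SpecialLinearGroup (Fin 2) ℤ) : SpZ :=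
  ⟨fromBlocks !![1, 0; 0, σ 0 0] !![0, 0; 0, σ 0 1] !![0, 0; 0, σ 1 0]
    !![1, 0; 0, σ 1 1], SymplecticGroup.fromBlocks_mem_iff.2 (by
      have h := σ.det_coe
      rw [det_fin_two] at h
      refine ⟨?_, ?_, ?_⟩ <;> ext i j <;> fin_cases i <;> fin_cases j <;>
        simp [Matrix.mul_apply, Fin.sum_univ_two, Matrix.sub_apply] <;>
        first | ring1 | linear_combination h)⟩

theorem toQ_upper (b : Matrix (Fin 2) (Fin 2) ℤ) (hb : b.IsSymm) :
    toQ (upper b hb) = Sp2Q.upper (b.map (Int.cast : ℤ → ℚ))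
      (show (b.map (Int.cast : ℤ → ℚ))ᵀ = _ by rw [← transpose_map, hb.eq]) := by
  apply Subtype.ext
  change (fromBlocks 1 b 0 1).map (Int.castRingHom ℚ) = fromBlocks 1 _ 0 1
  rw [fromBlocks_map, Matrix.map_one _ (map_zero _) (map_one _), Matrix.map_zero _ (map_zero _)]
  rfl

theorem toQ_levi (a : GL (Fin 2) ℤ) : toQ (levi a) = leviZ a := by
  apply Subtype.ext
  change (fromBlocks a.1 0 0 (a⁻¹ : GL (Fin 2) ℤ).1ᵀ).map (Int.castRingHom ℚ) = fromBlocks _ 0 0 _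
  rw [fromBlocks_map, Matrix.map_zero _ (map_zero _), transpose_map, ← map_inv]
  rfl

theorem toQ_emb (σ : SpecialLinearGroup (Fin 2) ℤ) :
    toQ (emb σ) = Sp2Q.embSL (SpecialLinearGroup.map (Int.castRingHom ℚ) σ) := by
  apply Subtype.ext
  change (fromBlocks _ _ _ _).map (Int.castRingHom ℚ) = fromBlocks _ _ _ _
  rw [fromBlocks_map]
  congr 1 <;> ext i j <;> fin_cases i <;> fin_cases j <;> simp

variable {N : ℤ} {H : Subgroup SpZ}

theorem lower_add {s t : Matrix (Fin 2) (Fin 2) ℤ} (hs : s.IsSymm) (ht : t.IsSymm) :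
    lower (s + t) (hs.add ht) = lower s hs * lower t ht := by
  apply Subtype.ext
  change fromBlocks _ _ _ _ = fromBlocks _ _ _ _ * fromBlocks _ _ _ _
  rw [fromBlocks_multiply]
  simp

theorem lower_conj {s : Matrix (Fin 2) (Fin 2) ℤ} (hs : s.IsSymm) (a : GL (Fin 2) ℤ) :
    lower (a.1ᵀ * s * a.1) (by rw [Matrix.IsSymm, transpose_mul, transpose_mul,
      transpose_transpose, hs.eq, Matrix.mul_assoc]) = levi a⁻¹ * lower s hs * levi a := by
  apply Subtype.ext
  change fromBlocks _ _ _ _ = fromBlocks _ _ _ _ * fromBlocks _ _ _ _ * fromBlocks _ _ _ _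
  rw [fromBlocks_multiply, fromBlocks_multiply]
  simp [← transpose_mul]

variable (hU : ∀ b hb, upper b hb ∈ H) (hL : ∀ a, levi a ∈ H)
  (hE : ∀ σ : SpecialLinearGroup (Fin 2) ℤ, N ∣ σ 1 0 → emb σ ∈ H)

include hE in
theorem lower_single_mem {t : ℤ} (ht : N ∣ t) (hs : (!![0, 0; 0, t]).IsSymm) :
    lower !![0, 0; 0, t] hs ∈ H := by
  have h := hE ⟨!![1, 0; t, 1], by simp [det_fin_two]⟩ (by simpa using ht)
  convert h using 1
  apply Subtype.ext
  change fromBlocks _ _ _ _ = fromBlocks _ _ _ _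
  congr 1 <;> ext i j <;> fin_cases i <;> fin_cases j <;> simp

include hL hE in
-- The matrix is `(x - y) e₁e₁' + y (e₁ + e₂)(e₁ + e₂)' - y e₂e₂'`, and `GL₂(ℤ)` conjugates each
-- summand to one concentrated in the last entry, which comes from the embedded `SL₂`.
theorem lower_mem {x y : ℤ} (hx : N ∣ x) (hy : N ∣ y) (hs : (!![x, y; y, 0]).IsSymm) :
    lower !![x, y; y, 0] hs ∈ H := by
  have hsing : ∀ t : ℤ, (!![0, 0; 0, t]).IsSymm := by
    intro t; ext i j; fin_cases i <;> fin_cases j <;> simp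
  have hconj : ∀ (t : ℤ) (a : GL (Fin 2) ℤ) (h), N ∣ t →
      lower (a.1ᵀ * !![0, 0; 0, t] * a.1) h ∈ H := by
    intro t a h ht
    rw [lower_conj (hsing t)]
    exact H.mul_mem (H.mul_mem (hL _) (lower_single_mem hE ht _)) (hL _)
  let V₁ : GL (Fin 2) ℤ := ⟨!![0, 1; 1, 0], !![0, 1; 1, 0], by
    ext i j; fin_cases i <;> fin_cases j <;> simp, by
    ext i j; fin_cases i <;> fin_cases j <;> simp⟩
  let V₂ : GL (Fin 2) ℤ := ⟨!![1, 0; 1, 1], !![1, 0; -1, 1], by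
    ext i j; fin_cases i <;> fin_cases j <;> simp, by
    ext i j; fin_cases i <;> fin_cases j <;> simp⟩
  have e1 : V₁.1ᵀ * !![0, 0; 0, x - y] * V₁.1 = !![x - y, 0; 0, 0] := by
    ext i j; fin_cases i <;> fin_cases j <;> simp [V₁, Matrix.mul_apply, Fin.sum_univ_two]
  have e2 : V₂.1ᵀ * !![0, 0; 0, y] * V₂.1 = !![y, y; y, y] := by
    ext i j; fin_cases i <;> fin_cases j <;> simp [V₂, Matrix.mul_apply, Fin.sum_univ_two]
  have hs1 : (!![x - y, 0; 0, 0]).IsSymm := by ext i j; fin_cases i <;> fin_cases j <;> simp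
  have hs2 : (!![y, y; y, y]).IsSymm := by ext i j; fin_cases i <;> fin_cases j <;> simp
  have m1 : lower !![x - y, 0; 0, 0] hs1 ∈ H := by
    have := hconj (x - y) V₁ (by rw [e1]; exact hs1) (dvd_sub hx hy)
    simpa only [e1] using this
  have m2 : lower !![y, y; y, y] hs2 ∈ H := by
    have := hconj y V₂ (by rw [e2]; exact hs2) hy
    simpa only [e2] using this
  have m3 : lower !![0, 0; 0, -y] (hsing _) ∈ H := lower_single_mem hE hy.neg_right _
  have e : !![x, y; y, 0] = !![x - y, 0; 0, 0] + !![y, y; y, y] + !![0, 0; 0, -y] := by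
    ext i j; fin_cases i <;> fin_cases j <;> simp
  have := H.mul_mem (H.mul_mem m1 m2) m3
  rw [← lower_add, ← lower_add] at this
  simpa only [e] using this

include hU hL in
-- An element of the Siegel parabolic is a translation times a Levi element.
theorem mem_of_lower_eq_zero {A B D : Matrix (Fin 2) (Fin 2) ℤ}
    (h : fromBlocks A B 0 D ∈ symplecticGroup (Fin 2) ℤ) : (⟨_, h⟩ : SpZ) ∈ H := by
  obtain ⟨-, h2, h3⟩ := SymplecticGroup.fromBlocks_mem_iff.1 h
  simp only [transpose_zero, Matrix.zero_mul, sub_zero] at h3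
  have h4 : D * Aᵀ = 1 := mul_eq_one_comm.1 h3
  have h5 : A * Dᵀ = 1 := by rw [← transpose_transpose A, ← transpose_mul, h4, transpose_one]
  let a : GL (Fin 2) ℤ := ⟨A, Dᵀ, h5, mul_eq_one_comm.1 h5⟩
  have hb : (B * Aᵀ).IsSymm := by
    have : A * (Bᵀ * D) * Aᵀ = A * (Dᵀ * B) * Aᵀ := by rw [h2]
    rw [Matrix.mul_assoc, Matrix.mul_assoc, h4, Matrix.mul_one, ← Matrix.mul_assoc A, h5,
      Matrix.one_mul] at this
    rw [Matrix.IsSymm, transpose_mul, transpose_transpose, this]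
  have := H.mul_mem (hU (B * Aᵀ) hb) (hL a)
  convert this using 1
  apply Subtype.ext
  change fromBlocks _ _ _ _ = fromBlocks _ _ _ _ * fromBlocks A _ _ (Dᵀ)ᵀ
  rw [fromBlocks_multiply, transpose_transpose]
  simp [Matrix.mul_assoc, h3]

include hU hL hE in
-- When the first column is `e₁`, the second and fourth rows and columns carry an element of
-- `SL₂(ℤ)`; multiplying by its inverse clears the lower left block.
theorem mem_of_first_col {A B C D : Matrix (Fin 2) (Fin 2) ℤ}
    (h : fromBlocks A B C D ∈ symplecticGroup (Fin 2) ℤ) (hC : ∀ i j, N ∣ C i j)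
    (hA0 : A 0 0 = 1) (hA1 : A 1 0 = 0) (hC0 : C 0 0 = 0) (hC1 : C 1 0 = 0) :
    (⟨_, h⟩ : SpZ) ∈ H := by
  obtain ⟨h1, h2, h3⟩ := SymplecticGroup.fromBlocks_mem_iff.1 h
  have e1 := congrFun (congrFun h1 0) 1
  have e2 := congrFun (congrFun h3 0) 0
  have e3 := congrFun (congrFun h3 0) 1
  have e4 := congrFun (congrFun h3 1) 1
  simp [Matrix.mul_apply, Fin.sum_univ_two, Matrix.sub_apply, hA0, hA1, hC0, hC1] at e1 e2 e3 e4
  rw [e1, e3] at e4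
  have hdet : A 1 1 * D 1 1 - B 1 1 * C 1 1 = 1 := by linear_combination e4
  let σ : SpecialLinearGroup (Fin 2) ℤ := ⟨!![A 1 1, B 1 1; C 1 1, D 1 1], by
    rw [det_fin_two]; simpa using hdet⟩
  let τ : SpecialLinearGroup (Fin 2) ℤ := ⟨!![D 1 1, -B 1 1; -C 1 1, A 1 1], by
    rw [det_fin_two]; simp; linear_combination hdet⟩
  have hτ : emb τ ∈ H := hE τ (by simpa [τ] using hC 1 1)
  rw [← H.mul_mem_cancel_right hτ]
  have hmul : (⟨_, h⟩ * emb τ : SpZ).1 = fromBlocks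
      (A * !![1, 0; 0, D 1 1] + B * !![0, 0; 0, -C 1 1])
      (A * !![0, 0; 0, -B 1 1] + B * !![1, 0; 0, A 1 1]) 0
      (C * !![0, 0; 0, -B 1 1] + D * !![1, 0; 0, A 1 1]) := by
    change fromBlocks _ _ _ _ * fromBlocks !![1, 0; 0, D 1 1] !![0, 0; 0, -B 1 1]
      !![0, 0; 0, -C 1 1] !![1, 0; 0, A 1 1] = _
    rw [fromBlocks_multiply]
    congr 1
    ext i j
    fin_cases i <;> fin_cases j <;>
      simp [Matrix.mul_apply, Fin.sum_univ_two, hC0, hC1, e1, e3]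
    ring
  have hmem := ((⟨_, h⟩ : SpZ) * emb τ).2
  rw [hmul] at hmem
  have := mem_of_lower_eq_zero hU hL hmem
  convert this using 1
  exact Subtype.ext hmul

include hU hL hE in
-- A lower unipotent element clears the first column of `C`. It is available because its entries are
-- multiples of `N`.
theorem mem_of_unit_col {A B C D : Matrix (Fin 2) (Fin 2) ℤ}
    (h : fromBlocks A B C D ∈ symplecticGroup (Fin 2) ℤ) (hC : ∀ i j, N ∣ C i j)
    (hA0 : A 0 0 = 1) (hA1 : A 1 0 = 0) : (⟨_, h⟩ : SpZ) ∈ H := by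
  have hs : (!![-C 0 0, -C 1 0; -C 1 0, 0]).IsSymm := by
    ext i j; fin_cases i <;> fin_cases j <;> simp
  rw [← H.mul_mem_cancel_left (lower_mem hL hE (hC 0 0).neg_right (hC 1 0).neg_right hs)]
  have hmul : (lower _ hs * ⟨_, h⟩ : SpZ).1 = fromBlocks A B
      (!![-C 0 0, -C 1 0; -C 1 0, 0] * A + C) (!![-C 0 0, -C 1 0; -C 1 0, 0] * B + D) := by
    change fromBlocks _ _ _ _ * fromBlocks _ _ _ _ = _
    rw [fromBlocks_multiply]
    simp
  have hmem := (lower _ hs * (⟨_, h⟩ : SpZ)).2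
  rw [hmul] at hmem
  have := mem_of_first_col hU hL hE hmem (fun i j => ?_) hA0 hA1 (by
    rw [Matrix.add_apply, Matrix.mul_apply, Fin.sum_univ_two]; simp [hA0, hA1]) (by
    rw [Matrix.add_apply, Matrix.mul_apply, Fin.sum_univ_two]; simp [hA0, hA1])
  · convert this using 1
    exact Subtype.ext hmul
  · rw [Matrix.add_apply, Matrix.mul_apply, Fin.sum_univ_two]
    refine dvd_add (dvd_add (Dvd.dvd.mul_right ?_ _) (Dvd.dvd.mul_right ?_ _)) (hC i j) <;>
      fin_cases i <;> simp [hC]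

theorem levi_mul_mk {A B C D : Matrix (Fin 2) (Fin 2) ℤ}
    (h : fromBlocks A B C D ∈ symplecticGroup (Fin 2) ℤ) (a : GL (Fin 2) ℤ) :
    (levi a * ⟨_, h⟩ : SpZ).1 = fromBlocks (a.1 * A) (a.1 * B) ((a⁻¹ : GL (Fin 2) ℤ).1ᵀ * C)
      ((a⁻¹ : GL (Fin 2) ℤ).1ᵀ * D) := by
  change fromBlocks _ _ _ _ * fromBlocks _ _ _ _ = _
  rw [fromBlocks_multiply]
  simp

theorem dvd_mul_apply {U C : Matrix (Fin 2) (Fin 2) ℤ} (hC : ∀ i j, N ∣ C i j) (i j : Fin 2) :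
    N ∣ (U * C) i j := by
  rw [Matrix.mul_apply]
  exact Finset.dvd_sum fun k _ => (hC k j).mul_left _

include hU hL hE in
-- A Bézout relation gives a Levi element that moves the first column of `A` to `(1, 0)`.
theorem mem_of_coprime_col {A B C D : Matrix (Fin 2) (Fin 2) ℤ}
    (h : fromBlocks A B C D ∈ symplecticGroup (Fin 2) ℤ) (hC : ∀ i j, N ∣ C i j)
    (hA : IsCoprime (A 0 0) (A 1 0)) : (⟨_, h⟩ : SpZ) ∈ H := by
  obtain ⟨x, y, hxy⟩ := hA
  let U : GL (Fin 2) ℤ := ⟨!![x, y; -A 1 0, A 0 0], !![A 0 0, -y; A 1 0, x], by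
    ext i j; fin_cases i <;> fin_cases j <;> simp [Matrix.mul_apply, Fin.sum_univ_two] <;>
      first | ring1 | linear_combination hxy, by
    ext i j; fin_cases i <;> fin_cases j <;> simp [Matrix.mul_apply, Fin.sum_univ_two] <;>
      first | ring1 | linear_combination hxy⟩
  rw [← H.mul_mem_cancel_left (hL U)]
  have hmul := levi_mul_mk h U
  have hmem := (levi U * (⟨_, h⟩ : SpZ)).2
  rw [hmul] at hmem
  have := mem_of_unit_col hU hL hE hmem (dvd_mul_apply hC)
    (by simp [U, Matrix.mul_apply, Fin.sum_univ_two]; linear_combination hxy)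
    (by simp [U, Matrix.mul_apply, Fin.sum_univ_two]; ring)
  convert this using 1
  exact Subtype.ext hmul

theorem exists_gcd_decomp (x y : ℤ) : ∃ g u v : ℤ, x = g * u ∧ y = g * v ∧ IsCoprime u v := by
  by_cases h : x = 0 ∧ y = 0
  · exact ⟨0, 1, 0, by simp [h.1], by simp [h.2], isCoprime_one_left⟩
  · have hg : 0 < Int.gcd x y := Int.gcd_pos_iff.2 (by tauto)
    refine ⟨Int.gcd x y, x / Int.gcd x y, y / Int.gcd x y,
      (Int.mul_ediv_cancel' (Int.gcd_dvd_left ..)).symm,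
      (Int.mul_ediv_cancel' (Int.gcd_dvd_right ..)).symm, ?_⟩
    rw [Int.isCoprime_iff_gcd_eq_one]
    exact Int.gcd_ediv_gcd_ediv_gcd hg

include hU hL hE in
-- A translation is sought that makes the first column of `A` primitive. Write the first column of
-- `C` as `N g (u, v)` with `u, v` coprime, and let `w u² + b v = 1`. The symmetric matrix `(-vw,
-- uw; uw, b)` sends that column to `(0, N g)`, and the relation `AᵀD - CᵀB = 1` shows that `A₁₁` is
-- prime to `N g`.
theorem mem_of_right_zero {A B C D : Matrix (Fin 2) (Fin 2) ℤ}
    (h : fromBlocks A B C D ∈ symplecticGroup (Fin 2) ℤ) (hC : ∀ i j, N ∣ C i j)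
    (hA1 : A 1 0 = 0) : (⟨_, h⟩ : SpZ) ∈ H := by
  obtain ⟨-, -, h3⟩ := SymplecticGroup.fromBlocks_mem_iff.1 h
  obtain ⟨x, hx⟩ := hC 0 0
  obtain ⟨y, hy⟩ := hC 1 0
  obtain ⟨g, u, v, hu, hv, huv⟩ := exists_gcd_decomp x y
  obtain ⟨w, b, hwb⟩ : IsCoprime (u ^ 2) v := huv.pow_left
  have e2 := congrFun (congrFun h3 0) 0
  simp [Matrix.mul_apply, Fin.sum_univ_two, Matrix.sub_apply, hA1, hx, hy, hu, hv] at e2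
  have hs : (!![-(v * w), u * w; u * w, b]).IsSymm := by
    ext i j; fin_cases i <;> fin_cases j <;> simp
  rw [← H.mul_mem_cancel_left (hU _ hs)]
  have hmul : (upper _ hs * ⟨_, h⟩ : SpZ).1 = fromBlocks
      (A + !![-(v * w), u * w; u * w, b] * C) (B + !![-(v * w), u * w; u * w, b] * D) C D := by
    change fromBlocks _ _ _ _ * fromBlocks _ _ _ _ = _
    rw [fromBlocks_multiply]
    simp
  have hmem := (upper _ hs * (⟨_, h⟩ : SpZ)).2
  rw [hmul] at hmem
  have := mem_of_coprime_col hU hL hE hmem hC (by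
    refine ⟨D 0 0, -(u * B 0 0 + v * B 1 0), ?_⟩
    rw [Matrix.add_apply, Matrix.mul_apply, Fin.sum_univ_two, Matrix.add_apply, Matrix.mul_apply,
      Fin.sum_univ_two]
    simp [hA1, hx, hy, hu, hv]
    linear_combination e2 - N * g * (u * B 0 0 + v * B 1 0) * hwb)
  convert this using 1
  exact Subtype.ext hmul

include hU hL hE in
/-- `Γ₀(N)` is generated by translations, the Levi subgroup and an embedded `Γ₀(N) ⊆ SL₂(ℤ)`. -/
theorem mem_of_dvd {A B C D : Matrix (Fin 2) (Fin 2) ℤ}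
    (h : fromBlocks A B C D ∈ symplecticGroup (Fin 2) ℤ) (hC : ∀ i j, N ∣ C i j) :
    (⟨_, h⟩ : SpZ) ∈ H := by
  obtain ⟨g, u, v, hu, hv, x, y, hxy⟩ := exists_gcd_decomp (A 0 0) (A 1 0)
  let U : GL (Fin 2) ℤ := ⟨!![x, y; -v, u], !![u, -y; v, x], by
    ext i j; fin_cases i <;> fin_cases j <;> simp [Matrix.mul_apply, Fin.sum_univ_two] <;>
      first | ring1 | linear_combination hxy, by
    ext i j; fin_cases i <;> fin_cases j <;> simp [Matrix.mul_apply, Fin.sum_univ_two] <;>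
      first | ring1 | linear_combination hxy⟩
  rw [← H.mul_mem_cancel_left (hL U)]
  have hmul := levi_mul_mk h U
  have hmem := (levi U * (⟨_, h⟩ : SpZ)).2
  rw [hmul] at hmem
  have := mem_of_right_zero hU hL hE hmem (dvd_mul_apply hC)
    (by simp [U, Matrix.mul_apply, Fin.sum_univ_two, hu, hv]; ring)
  convert this using 1
  exact Subtype.ext hmul

end SpZ

theorem exists_toQ {g : Sp2Q} (hg : ∀ i j, ∃ m : ℤ, (g : Matrix Idx Idx ℚ) i j = m) :
    ∃ G : SpZ, SpZ.toQ G = g := by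
  choose m hm using hg
  have hmap : (Matrix.of m : Matrix Idx Idx ℤ).map (Int.castRingHom ℚ) = g := by
    ext i j; simp [hm]
  refine ⟨⟨Matrix.of m, ?_⟩, Subtype.ext hmap⟩
  have h := SymplecticGroup.mem_iff.1 g.2
  rw [SymplecticGroup.mem_iff]
  have hinj : Function.Injective fun M : Matrix Idx Idx ℤ => M.map (Int.castRingHom ℚ) :=
    Matrix.map_injective Int.cast_injective
  apply hinj
  simp only [Matrix.map_mul, transpose_map, hmap]
  rw [Matrix.map_J]
  exact h

/-- Membership in a subgroup containing the standard generators of `Γ₀(N)`. -/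
theorem mem_of_gamma0_generators {N : ℤ} {H : Subgroup Sp2Q}
    (hU : ∀ (b : Matrix (Fin 2) (Fin 2) ℤ) (hb : (b.map (Int.cast : ℤ → ℚ)).IsSymm),
      Sp2Q.upper (b.map (Int.cast : ℤ → ℚ)) hb ∈ H)
    (hL : ∀ a : GL (Fin 2) ℤ, leviZ a ∈ H)
    (hE : ∀ σ : SpecialLinearGroup (Fin 2) ℤ, N ∣ σ 1 0 →
      Sp2Q.embSL (SpecialLinearGroup.map (Int.castRingHom ℚ) σ) ∈ H)
    {g : Sp2Q} (hg : ∀ i j, ∃ m : ℤ, (g : Matrix Idx Idx ℚ) i j = m)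
    (hC : ∀ i j, ∃ m : ℤ, (g : Matrix Idx Idx ℚ) (Sum.inr i) (Sum.inl j) = N * m) : g ∈ H := by
  obtain ⟨G, rfl⟩ := exists_toQ hg
  have hmem := G.2
  rw [← fromBlocks_toBlocks G.1] at hmem
  have h := SpZ.mem_of_dvd (N := N) (H := H.comap SpZ.toQ)
    (fun b hb => by rw [Subgroup.mem_comap, SpZ.toQ_upper]; exact hU b _)
    (fun a => by rw [Subgroup.mem_comap, SpZ.toQ_levi]; exact hL a)
    (fun σ hσ => by rw [Subgroup.mem_comap, SpZ.toQ_emb]; exact hE σ hσ) hmem (fun i j => by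
      obtain ⟨m, hm⟩ := hC i j
      refine ⟨m, ?_⟩
      have : ((G.1 (Sum.inr i) (Sum.inl j) : ℤ) : ℚ) = N * m := hm
      exact_mod_cast this)
  rw [Subgroup.mem_comap] at h
  convert h using 2
  exact Subtype.ext (fromBlocks_toBlocks _).symm

end

noncomputable section

variable {n : Type*} [Fintype n] {Q : Matrix n n ℤ}

/-! ## Stabilizers and lattices -/

/-- The stabilizer of a function under the slash action. -/
def slashStabilizer (k : ℤ) (f : Matrix (Fin 2) (Fin 2) ℂ → ℂ) : Subgroup Sp2Q where
  carrier := {γ | ∀ Ω ∈ siegelHalfSpace, slash k f γ Ω = f Ω}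
  one_mem' := fun Ω _ => slash_one k f Ω
  mul_mem' := by
    intro γ δ hγ hδ Ω hΩ
    rw [slash_mul k f γ δ hΩ, slash_congr k hγ δ hΩ]
    exact hδ Ω hΩ
  inv_mem' := by
    intro γ hγ Ω hΩ
    rw [← slash_congr k hγ γ⁻¹ hΩ, ← slash_mul k f γ γ⁻¹ hΩ, mul_inv_cancel, slash_one]

theorem mem_slashStabilizer {k : ℤ} {f : Matrix (Fin 2) (Fin 2) ℂ → ℂ} {γ : Sp2Q} :
    γ ∈ slashStabilizer k f ↔ ∀ Ω ∈ siegelHalfSpace, slash k f γ Ω = f Ω := Iff.rfl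

/-- The lattice `ℤⁿ`. -/
def intLattice (n : Type*) : AddSubgroup (n → ℚ) where
  carrier := {x | ∃ v : n → ℤ, x = fun i => (v i : ℚ)}
  zero_mem' := ⟨0, by ext; simp⟩
  add_mem' := by
    rintro _ _ ⟨v, rfl⟩ ⟨w, rfl⟩
    exact ⟨v + w, by ext; simp⟩
  neg_mem' := by
    rintro _ ⟨v, rfl⟩
    exact ⟨-v, by ext; simp⟩

theorem mem_intLattice {n : Type*} {x : n → ℚ} :
    x ∈ intLattice n ↔ ∃ v : n → ℤ, x = fun i => (v i : ℚ) := Iff.rfl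

/-- The dual lattice `Q⁻¹ℤⁿ`. -/
def dualLattice (Q : Matrix n n ℤ) : AddSubgroup (n → ℚ) :=
  (intLattice n).comap (Q.map (Int.cast : ℤ → ℚ)).mulVecLin.toAddMonoidHom

theorem mem_dualLattice {x : n → ℚ} :
    x ∈ dualLattice Q ↔ ∃ v : n → ℤ, Q.map (Int.cast : ℤ → ℚ) *ᵥ x = fun i => (v i : ℚ) := Iff.rfl

theorem inDual_one_iff {x : n → ℚ} : InDual Q 1 x ↔ x ∈ dualLattice Q := by
  rw [InDual, mem_dualLattice]
  refine exists_congr fun v => ?_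
  rw [funext_iff]
  simp

theorem intLattice_le_dualLattice : intLattice n ≤ dualLattice Q := by
  rintro _ ⟨v, rfl⟩
  exact mem_dualLattice.2 ⟨Q *ᵥ v, by ext i; simp [mulVec, dotProduct]⟩

theorem bil_int_dual {x y : n → ℚ} (hx : x ∈ intLattice n) (hy : y ∈ dualLattice Q) :
    ∃ m : ℤ, bil Q x y = m := by
  obtain ⟨v, rfl⟩ := hx
  obtain ⟨w, hw⟩ := hy
  refine ⟨v ⬝ᵥ w, ?_⟩
  change Q.map (Int.cast : ℤ → ℚ) *ᵥ y = _ at hw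
  rw [bil, hw]
  simp [dotProduct]

/-- The quadratic form `½ xᵀ Q x`. -/
def quad (Q : Matrix n n ℤ) (x : n → ℚ) : ℚ := bil Q x x / 2

theorem quad_add (hQ : Q.IsSymm) (x y : n → ℚ) : quad Q (x + y) = quad Q x + quad Q y + bil Q x y := by
  rw [quad, quad, quad, bil_add_left, bil_add_right, bil_add_right, bil_comm hQ y x]
  ring

theorem quad_smul (c : ℚ) (x : n → ℚ) : quad Q (c • x) = c ^ 2 * quad Q x := by
  rw [quad, quad, bil_smul_left, bil_smul_right]
  ring

theorem quad_int [DecidableEq n] (hQ : IsEvenForm Q) {x : n → ℚ} (hx : x ∈ intLattice n) :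
    ∃ m : ℤ, quad Q x = m := by
  obtain ⟨v, rfl⟩ := hx
  obtain ⟨m, hm⟩ := hQ.even_bil v
  refine ⟨m, ?_⟩
  have h := intCast_bil (R := ℚ) (Q := Q) v v
  rw [hm] at h
  rw [quad, ← h]
  push_cast
  ring

/-- An even positive form in eight variables, of determinant `p ^ 4` and level `p`. -/
structure IsLevelForm [DecidableEq n] (p : ℕ) (Q : Matrix n n ℤ) : Prop where
  even : IsEvenForm Q
  pos : (Q.map (Int.cast : ℤ → ℝ)).PosDef
  card : Fintype.card n = 8
  det : Q.det = (p : ℤ) ^ 4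
  smul_dual : ∀ y ∈ dualLattice Q, (p : ℚ) • y ∈ intLattice n
  quad_dual : ∀ y ∈ dualLattice Q, ∃ m : ℤ, p * quad Q y = m

/-! ## Products of functions of the columns -/

/-- The function `N = (x, y) ↦ f x * g y`. -/
def colProd (f g : (n → ℚ) → ℂ) (N : Matrix n (Fin 2) ℚ) : ℂ := f (N.col 0) * g (N.col 1)

/-- The indicator function of a lattice. -/
def ind {n : Type*} (S : AddSubgroup (n → ℚ)) : (n → ℚ) → ℂ := (S : Set (n → ℚ)).indicator 1

theorem ind_of_mem {n : Type*} {S : AddSubgroup (n → ℚ)} {x : n → ℚ} (h : x ∈ S) : ind S x = 1 :=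
  Set.indicator_of_mem (s := (S : Set (n → ℚ))) h 1

theorem ind_of_notMem {n : Type*} {S : AddSubgroup (n → ℚ)} {x : n → ℚ} (h : x ∉ S) : ind S x = 0 :=
  Set.indicator_of_notMem (s := (S : Set (n → ℚ))) h 1

/-- A bounded function supported on `M⁻¹ ℤⁿ`, periodic under `R ℤⁿ`. -/
structure IsSchwartzCol {n : Type*} (M R : ℕ) (g : (n → ℚ) → ℂ) : Prop where
  supp : ∀ x, g x ≠ 0 → ∀ i, ∃ m : ℤ, x i = m / M
  per : ∀ x (v : n → ℤ), (g fun i => x i + R * v i) = g x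
  bdd : ∃ C : ℝ, ∀ x, ‖g x‖ ≤ C

omit [Fintype n] in
theorem IsSchwartzCol.latticeBdd {M R M' R' : ℕ} {f g : (n → ℚ) → ℂ} (hf : IsSchwartzCol M R f)
    (hg : IsSchwartzCol M' R' g) (hM : 0 < M) (hM' : 0 < M') : LatticeBdd (colProd f g) := by
  obtain ⟨C, hC⟩ := hf.bdd
  obtain ⟨C', hC'⟩ := hg.bdd
  refine ⟨⟨M * M', by positivity, fun N hN i j => ?_⟩, C * C', fun N => ?_⟩
  · fin_cases j
    · obtain ⟨m, hm⟩ := hf.supp _ (left_ne_zero_of_mul hN) i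
      refine ⟨m * M', ?_⟩
      change N i 0 = _
      rw [show N i 0 = _ from hm]
      push_cast
      field_simp
    · obtain ⟨m, hm⟩ := hg.supp _ (right_ne_zero_of_mul hN) i
      refine ⟨m * M, ?_⟩
      change N i 1 = _
      rw [show N i 1 = _ from hm]
      push_cast
      field_simp
  · rw [colProd, norm_mul]
    have := (norm_nonneg _).trans (hC 0)
    gcongr
    · exact hC _
    · exact hC' _

theorem isSchwartzCol_ind_int {n : Type*} : IsSchwartzCol 1 1 (ind (intLattice n)) where
  supp := fun x hx i => by
    by_cases h : x ∈ intLattice n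
    · obtain ⟨v, rfl⟩ := h
      exact ⟨v i, by simp⟩
    · exact (hx (ind_of_notMem h)).elim
  per := fun x v => by
    have hv : (fun i => (v i : ℚ)) ∈ intLattice n := ⟨v, rfl⟩
    have hx : (fun i => x i + ((1 : ℕ) : ℚ) * v i) = x + fun i => (v i : ℚ) := by ext i; simp
    rw [hx]
    by_cases h : x ∈ intLattice n
    · rw [ind_of_mem h, ind_of_mem (add_mem h hv)]
    · rw [ind_of_notMem h, ind_of_notMem (by rwa [(intLattice n).add_mem_cancel_right hv])]
  bdd := ⟨1, fun x => by
    by_cases h : x ∈ intLattice n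
    · simp [ind_of_mem h]
    · simp [ind_of_notMem h]⟩

theorem isSymm_diag (u v : ℚ) : (!![u, 0; 0, v]).IsSymm := by
  ext i j; fin_cases i <;> fin_cases j <;> simp

theorem half_trace_diag (N : Matrix n (Fin 2) ℚ) (u v : ℚ) :
    1 / 2 * (gramMat Q N * !![u, 0; 0, v]).trace = u * quad Q (N.col 0) + v * quad Q (N.col 1) := by
  simp [trace_fin_two, Matrix.mul_apply, Fin.sum_univ_two, gramMat_apply, quad]
  ring

theorem slash_upper_colProd (k : ℤ) (f g : (n → ℚ) → ℂ) (u v : ℚ) (Ω : Matrix (Fin 2) (Fin 2) ℂ) :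
    slash k (thetaSum Q (colProd f g)) (Sp2Q.upper !![u, 0; 0, v] (isSymm_diag u v)) Ω =
      thetaSum Q (colProd (fun x => f x * ratExp (u * quad Q x))
        (fun x => g x * ratExp (v * quad Q x))) Ω := by
  rw [thetaSum_slash_upper]
  congr 1
  ext N
  rw [half_trace_diag, ratExp_add, colProd, colProd]
  ring

/-- Invertible diagonal matrices. -/
def diagGL (u v : ℚ) (hu : u ≠ 0) (hv : v ≠ 0) : GL (Fin 2) ℚ :=
  ⟨!![u, 0; 0, v], !![u⁻¹, 0; 0, v⁻¹], by
    ext i j; fin_cases i <;> fin_cases j <;> simp [hu, hv], by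
    ext i j; fin_cases i <;> fin_cases j <;> simp [hu, hv]⟩

theorem slash_levi_colProd (k : ℤ) (f g : (n → ℚ) → ℂ) {u v : ℚ} (hu : u ≠ 0) (hv : v ≠ 0)
    (Ω : Matrix (Fin 2) (Fin 2) ℂ) :
    slash k (thetaSum Q (colProd f g)) (Sp2Q.levi (diagGL u v hu hv)) Ω =
      thetaSum Q (colProd (fun x => (u : ℂ) ^ k * f (u⁻¹ • x)) fun x => (v : ℂ) ^ k * g (v⁻¹ • x)) Ω := by
  rw [thetaSum_slash_levi]
  congr 1
  ext N
  have h0 : (N * !![u⁻¹, 0; 0, v⁻¹]).col 0 = u⁻¹ • N.col 0 := by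
    ext i; simp [Matrix.mul_apply, Fin.sum_univ_two, mul_comm]
  have h1 : (N * !![u⁻¹, 0; 0, v⁻¹]).col 1 = v⁻¹ • N.col 1 := by
    ext i; simp [Matrix.mul_apply, Fin.sum_univ_two, mul_comm]
  change ((!![u, 0; 0, v].det : ℚ) : ℂ) ^ k * (f ((N * !![u⁻¹, 0; 0, v⁻¹]).col 0) *
    g ((N * !![u⁻¹, 0; 0, v⁻¹]).col 1)) = _
  rw [h0, h1, colProd, det_fin_two]
  simp [mul_zpow]
  ring

variable [DecidableEq n]

theorem slash_inversion_colProd (hQ : Q.IsSymm) (hpos : (Q.map (Int.cast : ℤ → ℝ)).PosDef)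
    (hcard : Fintype.card n = 8) {M R M' R' : ℕ} (hM : 0 < M) (hM' : 0 < M') (hR' : 0 < R')
    {f g : (n → ℚ) → ℂ} (hf : IsSchwartzCol M R f) (hg : IsSchwartzCol M' R' g)
    {Ω : Matrix (Fin 2) (Fin 2) ℂ} (hΩ : Ω ∈ siegelHalfSpace) :
    slash 4 (thetaSum Q (colProd f g)) Sp2Q.inversion Ω =
      thetaSum Q (colProd f (latticeFourier Q M' R' g)) Ω := by
  rw [thetaSum_slash_inversion hQ hpos hcard hM' hR' (hf.latticeBdd hg hM hM')
    (fun N hN => hg.supp _ (right_ne_zero_of_mul hN)) (fun N v => ?_) hΩ]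
  · congr 1
    ext N
    rw [partialFourier, latticeFourier, colProd, latticeFourier]
    split_ifs
    · refine (congrArg _ ?_).trans (mul_left_comm _ _ _)
      rw [Finset.mul_sum]
      refine Finset.sum_congr rfl fun k _ => ?_
      rw [← mul_assoc]
      rfl
    · rw [mul_zero]
  · change f (N.col 0) * g (fun i => N i 1 + R' * v i) = f (N.col 0) * g (N.col 1)
    rw [show (fun i => N i 1 + R' * v i) = fun i => (N.col 1) i + R' * v i from rfl, hg.per]

omit [DecidableEq n] in
theorem slash_swap_colProd (f g : (n → ℚ) → ℂ) {W : GL (Fin 2) ℤ} (hW : W.1 = !![0, 1; 1, 0])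
    (hW' : (W⁻¹).1 = !![0, 1; 1, 0]) (Ω : Matrix (Fin 2) (Fin 2) ℂ) :
    slash 4 (thetaSum Q (colProd f g)) (leviZ W) Ω = thetaSum Q (colProd g f) Ω := by
  rw [leviZ, thetaSum_slash_levi]
  congr 1
  ext N
  have h1 : (GeneralLinearGroup.map (Int.castRingHom ℚ) W).1 = !![0, 1; 1, 0] := by
    change W.1.map (Int.castRingHom ℚ) = _
    rw [hW]; ext i j; fin_cases i <;> fin_cases j <;> simp
  have h2 : ((GeneralLinearGroup.map (Int.castRingHom ℚ) W)⁻¹ : GL (Fin 2) ℚ).1 = !![0, 1; 1, 0] := by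
    rw [← map_inv]
    change (W⁻¹).1.map (Int.castRingHom ℚ) = _
    rw [hW']; ext i j; fin_cases i <;> fin_cases j <;> simp
  rw [h1, h2, colProd, colProd, det_fin_two]
  have h3 : (N * (!![0, 1; 1, 0] : Matrix (Fin 2) (Fin 2) ℚ)).col 0 = N.col 1 := by
    ext i; simp [Matrix.mul_apply, Fin.sum_univ_two]
  have h4 : (N * (!![0, 1; 1, 0] : Matrix (Fin 2) (Fin 2) ℚ)).col 1 = N.col 0 := by
    ext i; simp [Matrix.mul_apply, Fin.sum_univ_two]
  rw [h3, h4]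
  norm_num
  ring

end

noncomputable section

/-! ## Gauss sums of quadratic forms -/

theorem exists_diagonalization {n K : Type*} [Fintype n] [DecidableEq n] [Field K]
    (h2 : (2 : K) ≠ 0) {S : Matrix n n K} (hS : S.IsSymm) :
    ∃ P : Matrix n n K, IsUnit P.det ∧ ∃ w : n → K, Pᵀ * S * P = diagonal w := by
  have : Invertible (2 : K) := invertibleOfNonzero h2
  obtain ⟨v₀, hv₀⟩ := LinearMap.BilinForm.exists_orthogonal_basis (B := Matrix.toBilin' S)
    ⟨fun x y => by
      rw [toBilin'_apply', toBilin'_apply', RingHom.id_apply, dotProduct_mulVec, ← mulVec_transpose,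
        hS.eq, dotProduct_comm]⟩
  let e : Fin (Module.finrank K (n → K)) ≃ n := Fintype.equivOfCardEq (by simp)
  let v := v₀.reindex e
  refine ⟨(Pi.basisFun K n).toMatrix v, ?_, fun i => v i ⬝ᵥ S *ᵥ v i, ?_⟩
  · have := (Pi.basisFun K n).isUnit_det v
    rwa [Module.Basis.det_apply] at this
  · ext i j
    have h1 : (((Pi.basisFun K n).toMatrix v)ᵀ * S * (Pi.basisFun K n).toMatrix v) i j =
        v i ⬝ᵥ S *ᵥ v j := by
      rw [Matrix.mul_assoc, Matrix.mul_apply]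
      rfl
    rw [h1]
    by_cases hij : i = j
    · subst hij; simp
    · rw [diagonal_apply_ne _ hij, ← toBilin'_apply']
      have := hv₀ (i := e.symm i) (j := e.symm j) (by simpa using hij)
      simpa [v] using this

section Gauss

variable {F : Type*} [Field F] [Fintype F] [DecidableEq F]

/-- The quadratic character with complex values. -/
def quadCharC (F : Type*) [Field F] [Fintype F] [DecidableEq F] : MulChar F ℂ :=
  (quadraticChar F).ringHomComp (Int.castRingHom ℂ)

theorem quadCharC_apply (a : F) : quadCharC F a = (quadraticChar F a : ℂ) := rfl

theorem quadCharC_sq {a : F} (ha : a ≠ 0) : quadCharC F (a ^ 2) = 1 := by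
  rw [quadCharC_apply, quadraticChar_sq_one' ha, Int.cast_one]

theorem isQuadratic_quadCharC : (quadCharC F).IsQuadratic :=
  (quadraticChar_isQuadratic F).comp _

theorem quadCharC_ne_one (hF : ringChar F ≠ 2) : quadCharC F ≠ 1 :=
  MulChar.ringHomComp_ne_one_iff (Int.cast_injective (α := ℂ)) |>.2 (quadraticChar_ne_one hF)

/-- An element `a` has `1 + χ(a)` square roots. The constant part contributes a complete character
sum, which vanishes, and the rest is a Gauss sum. -/
theorem sum_addChar_mul_sq (hF : ringChar F ≠ 2) {ψ : AddChar F ℂ} (hψ : ψ.IsPrimitive) {w : F}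
    (hw : w ≠ 0) : ∑ x, ψ (w * x ^ 2) = quadCharC F w * gaussSum (quadCharC F) ψ := by
  rw [← Finset.sum_fiberwise_of_maps_to (s := Finset.univ) (t := Finset.univ)
    (g := fun x : F => x ^ 2) (fun _ _ => Finset.mem_univ _)]
  have h1 : ∀ a : F, ∑ x with x ^ 2 = a, ψ (w * x ^ 2) =
      quadCharC F a * ψ (w * a) + ψ (w * a) := by
    intro a
    rw [Finset.sum_congr rfl (g := fun _ => ψ (w * a)) (fun x hx => by
      rw [(Finset.mem_filter.1 hx).2]), Finset.sum_const, nsmul_eq_mul]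
    have h := quadraticChar_card_sqrts hF a
    have hc : ({x : F | x ^ 2 = a}.toFinset) = Finset.univ.filter fun x : F => x ^ 2 = a := by
      ext x; simp
    rw [hc] at h
    have h' : ((Finset.univ.filter fun x : F => x ^ 2 = a).card : ℂ) = quadraticChar F a + 1 := by
      exact_mod_cast congrArg (Int.cast : ℤ → ℂ) h
    rw [h', quadCharC_apply]
    ring
  rw [Finset.sum_congr rfl fun a _ => h1 a, Finset.sum_add_distrib]
  have h2 : ∑ a, ψ (w * a) = 0 := by
    have := AddChar.sum_mulShift w hψ
    simpa [hw, mul_comm] using this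
  rw [h2, add_zero]
  have h3 := gaussSum_mulShift_eq (quadCharC F) ψ (Units.mk0 w hw)
  rw [isQuadratic_quadCharC.inv] at h3
  exact h3

/-- After diagonalization the sum is a product over the coordinates; the determinant has changed by
a square only, which the quadratic character does not see. -/
theorem sum_addChar_quadratic {n : Type*} [Fintype n] [DecidableEq n] (hF : ringChar F ≠ 2)
    {ψ : AddChar F ℂ} (hψ : ψ.IsPrimitive) {S : Matrix n n F} (hS : S.IsSymm) (hdet : S.det ≠ 0) :
    ∑ x : n → F, ψ (x ⬝ᵥ S *ᵥ x) =
      quadCharC F S.det * gaussSum (quadCharC F) ψ ^ Fintype.card n := by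
  obtain ⟨P, hP, w, hw⟩ := exists_diagonalization (Ring.two_ne_zero hF) hS
  have hdetw : P.det ^ 2 * S.det = ∏ i, w i := by
    rw [← det_diagonal, ← hw, det_mul, det_mul, det_transpose]; ring
  have hw0 : ∀ i, w i ≠ 0 := by
    have : ∏ i, w i ≠ 0 := by
      rw [← hdetw]; exact mul_ne_zero (pow_ne_zero _ hP.ne_zero) hdet
    exact fun i => Finset.prod_ne_zero_iff.1 this i (Finset.mem_univ i)
  have hbij : Function.Bijective (P.mulVec) := by
    have hPu : IsUnit P := (Matrix.isUnit_iff_isUnit_det P).2 hP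
    exact ⟨Matrix.mulVec_injective_iff_isUnit.2 hPu, Matrix.mulVec_surjective_iff_isUnit.2 hPu⟩
  rw [← Function.Bijective.sum_comp hbij]
  have hval : ∀ x : n → F, ψ (P *ᵥ x ⬝ᵥ S *ᵥ (P *ᵥ x)) = ∏ i, ψ (w i * x i ^ 2) := by
    intro x
    have : P *ᵥ x ⬝ᵥ S *ᵥ (P *ᵥ x) = ∑ i, w i * x i ^ 2 := by
      have h : P *ᵥ x ⬝ᵥ S *ᵥ (P *ᵥ x) = x ⬝ᵥ (Pᵀ * S * P) *ᵥ x := by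
        rw [Matrix.mul_assoc, ← mulVec_mulVec, ← mulVec_mulVec, dotProduct_mulVec x, vecMul_transpose]
      rw [h, hw]
      simp only [dotProduct, mulVec_diagonal]
      exact Finset.sum_congr rfl fun i _ => by ring
    rw [this]
    exact map_prod ψ.toMonoidHom (fun i => Multiplicative.ofAdd (w i * x i ^ 2)) _
  rw [Finset.sum_congr rfl fun x _ => hval x]
  have := Finset.prod_univ_sum (fun _ : n => (Finset.univ : Finset F)) fun i x => ψ (w i * x ^ 2)
  rw [Fintype.piFinset_univ] at this
  rw [← this, Finset.prod_congr rfl fun i _ => sum_addChar_mul_sq hF hψ (hw0 i),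
    Finset.prod_mul_distrib, Finset.prod_const, Finset.card_univ, ← map_prod, ← hdetw, map_mul,
    quadCharC_sq hP.ne_zero, one_mul]

end Gauss

/-- The eighth power of the Gauss sum is `(χ(-1) d)⁴ = d⁴`, so no sign survives. -/
theorem sum_stdAddChar_even_form {n : Type*} [Fintype n] [DecidableEq n] {d : ℕ} [Fact d.Prime]
    (hd : d ≠ 2) (hcard : Fintype.card n = 8) {S : Matrix n n (ZMod d)} (hS : S.IsSymm)
    (hdet : S.det ≠ 0) (hsq : IsSquare S.det) :
    ∑ x : n → ZMod d, ZMod.stdAddChar (x ⬝ᵥ S *ᵥ x) = (d : ℂ) ^ 4 := by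
  have hF : ringChar (ZMod d) ≠ 2 := by rwa [ZMod.ringChar_zmod_n]
  have hψ := ZMod.isPrimitive_stdAddChar d
  obtain ⟨r, hr⟩ := hsq
  have hr0 : r ≠ 0 := by rintro rfl; simp [hr] at hdet
  rw [sum_addChar_quadratic hF hψ hS hdet, hr, ← sq, quadCharC_sq hr0, one_mul, hcard,
    show 8 = 2 * 4 from rfl, pow_mul, gaussSum_sq (quadCharC_ne_one hF) isQuadratic_quadCharC hψ,
    mul_pow, ← map_pow, ZMod.card]
  norm_num

end

noncomputable section

variable {n : Type*} [Fintype n] {Q : Matrix n n ℤ}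

/-! ## Invariance of the theta series -/

theorem sum_fin_eq_sum_zmod {n : Type*} [Fintype n] [DecidableEq n] {d : ℕ} [NeZero d]
    {f : (n → ℤ) → ℂ} {F : (n → ZMod d) → ℂ} (h : ∀ k, f k = F fun i => (k i : ZMod d)) :
    ∑ k : n → Fin (1 * d), f (fun i => ((k i : ℕ) : ℤ)) = ∑ κ, F κ := by
  refine Fintype.sum_bijective (fun (k : n → Fin (1 * d)) i => (((k i : ℕ) : ℤ) : ZMod d)) ?_ _ _
    fun k => h _
  rw [Fintype.bijective_iff_injective_and_card]
  refine ⟨fun k l hkl => ?_, by simp⟩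
  ext i
  have h1 := congrFun hkl i
  simp only [Int.cast_natCast] at h1
  rw [ZMod.natCast_eq_natCast_iff'] at h1
  have hk : (k i : ℕ) < d := (k i).2.trans_eq (one_mul d)
  have hl : (l i : ℕ) < d := (l i).2.trans_eq (one_mul d)
  rwa [Nat.mod_eq_of_lt hk, Nat.mod_eq_of_lt hl] at h1

theorem exists_zmod_function {n : Type*} {d : ℕ} [NeZero d] {f : (n → ℤ) → ℂ}
    (hf : ∀ k v : n → ℤ, f (k + (d : ℤ) • v) = f k) :
    ∃ F : (n → ZMod d) → ℂ, ∀ k, f k = F fun i => (k i : ZMod d) := by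
  refine ⟨fun κ => f fun i => ((κ i).val : ℤ), fun k => ?_⟩
  have h : ∀ i, ∃ v : ℤ, k i = (((k i : ZMod d).val : ℕ) : ℤ) + d * v := by
    intro i
    obtain ⟨v, hv⟩ := (ZMod.intCast_eq_intCast_iff_dvd_sub ((k i : ZMod d).val : ℤ) (k i) d).1 (by simp)
    exact ⟨v, by linarith⟩
  choose v hv using h
  conv_lhs => rw [show k = (fun i => (((k i : ZMod d).val : ℕ) : ℤ)) + (d : ℤ) • v from funext hv]
  exact hf _ _

theorem ratExp_eq_of_sub {x y : ℚ} (h : ∃ m : ℤ, x - y = m) : ratExp x = ratExp y := by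
  obtain ⟨m, hm⟩ := h
  rw [← ratExp_add_int y m, ← hm]
  congr 1
  ring

theorem ratExp_div_eq_stdAddChar {d : ℕ} [NeZero d] (m : ℤ) :
    ratExp (m / d) = ZMod.stdAddChar (m : ZMod d) := by
  rw [ZMod.stdAddChar_coe, ratExp]
  push_cast
  congr 1
  ring

variable [DecidableEq n]

/-- The phase is the standard character at the form `(b/2) Q` over `𝔽_d`, whose determinant `(b/2)⁸
p⁴` is a nonzero square. -/
theorem quad_sum_zero {p : ℕ} (hQ : IsLevelForm p Q) {d : ℕ} [hd : Fact d.Prime] (hd2 : d ≠ 2)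
    (hp : p.Prime) (hdp : d ≠ p) {b : ℤ} (hb : ¬ (d : ℤ) ∣ b) :
    ∑ k : n → Fin (1 * d), ratExp (b / d * quad Q fun i => (((k i : ℕ) : ℤ) : ℚ)) = (d : ℂ) ^ 4 := by
  have h2 : (2 : ZMod d) ≠ 0 := by
    refine Ring.two_ne_zero ?_
    rwa [ZMod.ringChar_zmod_n]
  set S : Matrix n n (ZMod d) := ((b : ZMod d) / 2) • Q.map (Int.cast : ℤ → ZMod d)
  have hdet : S.det = (((b : ZMod d) / 2) ^ 4 * (p : ZMod d) ^ 2) * (((b : ZMod d) / 2) ^ 4 * (p : ZMod d) ^ 2) := by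
    rw [det_smul, hQ.card]
    have : (Q.map (Int.cast : ℤ → ZMod d)).det = ((Q.det : ℤ) : ZMod d) :=
      ((Int.castRingHom (ZMod d)).map_det Q).symm
    rw [this, hQ.det]
    push_cast
    ring
  have hb0 : (b : ZMod d) ≠ 0 := by rwa [Ne, ZMod.intCast_zmod_eq_zero_iff_dvd]
  have hp0 : (p : ZMod d) ≠ 0 := by
    rw [Ne, ZMod.natCast_eq_zero_iff]
    exact fun h => hdp ((Nat.prime_dvd_prime_iff_eq hd.out hp).1 h)
  have hS : S.IsSymm := by
    rw [Matrix.IsSymm, transpose_smul, ← transpose_map, hQ.even.1.eq]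
  rw [← sum_stdAddChar_even_form (d := d) hd2 hQ.card hS (by rw [hdet]; positivity) ⟨_, hdet⟩]
  refine sum_fin_eq_sum_zmod (f := fun k => ratExp (b / d * quad Q fun i => (k i : ℚ))) fun k => ?_
  obtain ⟨m, hm⟩ := hQ.even.even_bil k
  have h3 : quad Q (fun i => (k i : ℚ)) = m := by
    rw [quad, ← intCast_bil, hm]; push_cast; ring
  have h4 : (fun i => (k i : ZMod d)) ⬝ᵥ S *ᵥ (fun i => (k i : ZMod d)) = ((b * m : ℤ) : ZMod d) := by
    rw [smul_mulVec, dotProduct_smul]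
    change _ • bil Q (fun i => (k i : ZMod d)) (fun i => (k i : ZMod d)) = _
    rw [← intCast_bil, hm, smul_eq_mul]
    push_cast
    field_simp
    ring
  rw [h4, ← ratExp_div_eq_stdAddChar, h3]
  push_cast
  congr 1
  ring

/-- Complete the square by `k ↦ k + c y`, a shift by an integral vector because `p ∣ c`. The
relation `ad - bc = 1` makes the new linear term integral and leaves the phase `e(c q(y) / d)`. -/
theorem quad_sum_dual {p : ℕ} (hQ : IsLevelForm p Q) {d : ℕ} [hd : Fact d.Prime] (hd2 : d ≠ 2)
    (hp : p.Prime) (hdp : d ≠ p) {a b c : ℤ} (hdet : a * d - b * c = 1) (hc : (p : ℤ) ∣ c)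
    {y : n → ℚ} (hy : y ∈ dualLattice Q) :
    ∑ k : n → Fin (1 * d), ratExp (b / d * quad Q fun i => (((k i : ℕ) : ℤ) : ℚ)) *
        ratExp (bil Q (fun i => (((k i : ℕ) : ℤ) : ℚ)) y / d) =
      (d : ℂ) ^ 4 * ratExp (c / d * quad Q y) := by
  have hd0 : (d : ℚ) ≠ 0 := Nat.cast_ne_zero.2 hd.out.ne_zero
  have hb : ¬ (d : ℤ) ∣ b := by
    intro h
    have : (d : ℤ) ∣ 1 := hdet ▸ dvd_sub (dvd_mul_left _ _) (h.mul_right c)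
    exact (Nat.prime_iff_prime_int.1 hd.out).not_isUnit (isUnit_of_dvd_one this)
  have hdetq : (a : ℚ) * d - b * c = 1 := by exact_mod_cast hdet
  have hint : ∀ v : n → ℤ, (fun i => (v i : ℚ)) ∈ intLattice n := fun v => ⟨v, rfl⟩
  let f : (n → ℚ) → (n → ℤ) → ℂ := fun z k => ratExp (b / d * quad Q fun i => (k i : ℚ)) *
    ratExp (bil Q (fun i => (k i : ℚ)) z / d)
  have hcast : ∀ k v : n → ℤ, (fun i => ((k + (d : ℤ) • v) i : ℚ)) =
      (fun i => (k i : ℚ)) + (d : ℚ) • fun i => (v i : ℚ) := by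
    intro k v; ext i; simp
  have hper : ∀ z ∈ dualLattice Q, ∀ k v : n → ℤ, f z (k + (d : ℤ) • v) = f z k := by
    intro z hz k v
    simp only [f, ← ratExp_add]
    apply ratExp_eq_of_sub
    obtain ⟨m₁, h₁⟩ := bil_int_dual (Q := Q) (hint k) (intLattice_le_dualLattice (hint v))
    obtain ⟨m₂, h₂⟩ := quad_int hQ.even (hint v)
    obtain ⟨m₃, h₃⟩ := bil_int_dual (hint v) hz
    refine ⟨b * m₁ + b * d * m₂ + m₃, ?_⟩
    rw [hcast, quad_add hQ.even.1, quad_smul, bil_add_left, bil_smul_right, bil_smul_left,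
      h₁, h₂, h₃]
    push_cast
    field_simp
    ring
  obtain ⟨F, hF⟩ := exists_zmod_function (hper y hy)
  obtain ⟨F₀, hF₀⟩ := exists_zmod_function (hper 0 (zero_mem _))
  obtain ⟨c', rfl⟩ := hc
  obtain ⟨w, hw⟩ := hQ.smul_dual y hy
  obtain ⟨t, ht⟩ := hQ.quad_dual y hy
  have hshift : ∀ k, f y (k + c' • w) = f 0 k * ratExp ((p * c' : ℤ) / d * quad Q y) := by
    intro k
    simp only [f, ← ratExp_add]
    apply ratExp_eq_of_sub
    obtain ⟨m₁, h₁⟩ := bil_int_dual (hint k) hy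
    have hk : (fun i => ((k + c' • w) i : ℚ)) = (fun i => (k i : ℚ)) + (p * c' : ℚ) • y := by
      rw [mul_comm, mul_smul, hw]; ext i; simp
    refine ⟨a * m₁ + a * c' * t, ?_⟩
    have hyy : bil Q y y = 2 * quad Q y := by rw [quad]; ring
    rw [hk, quad_add hQ.even.1, quad_smul, bil_add_left, bil_smul_right, bil_smul_left, h₁, hyy,
      bil_zero_right]
    push_cast at hdetq ⊢
    rw [← ht]
    field_simp
    linear_combination (-m₁ - c' * p * quad Q y) * hdetq
  have hF' : ∀ κ, F (κ + fun i => ((c' • w) i : ZMod d)) = F₀ κ * ratExp ((p * c' : ℤ) / d * quad Q y) := by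
    intro κ
    have h1 : κ = fun i => (((κ i).val : ℤ) : ZMod d) := by ext i; simp
    rw [h1, ← hF₀, ← hshift, hF]
    congr 1
    ext i
    simp
  calc _ = ∑ κ, F κ := sum_fin_eq_sum_zmod (f := f y) hF
    _ = ∑ κ, F (κ + fun i => ((c' • w) i : ZMod d)) :=
      (Equiv.sum_comp (Equiv.addRight (fun i => ((c' • w) i : ZMod d))) F).symm
    _ = (∑ κ, F₀ κ) * ratExp ((p * c' : ℤ) / d * quad Q y) := by
      rw [Finset.sum_mul]; exact Finset.sum_congr rfl fun κ _ => hF' κ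
    _ = _ := by
      rw [← sum_fin_eq_sum_zmod hF₀, ← quad_sum_zero hQ hd2 hp hdp hb]
      congr 1
      refine Finset.sum_congr rfl fun k _ => ?_
      simp only [f, bil_zero_right, zero_div]
      rw [show ratExp 0 = 1 by simpa using ratExp_int 0, mul_one]

end

/-! ### The embedded `SL₂` acting on the theta series of `ℤⁿ`. -/

noncomputable section

variable {n : Type*} [Fintype n] {Q : Matrix n n ℤ}

/-- The element `(a, b; c, d)` of `SL₂`. -/
def mkSL {R : Type*} [CommRing R] (a b c d : R) (h : a * d - b * c = 1) :
    SpecialLinearGroup (Fin 2) R := ⟨!![a, b; c, d], by rw [det_fin_two]; exact h⟩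

section mkSL

variable {R : Type*} [CommRing R] (a b c d : R) (h : a * d - b * c = 1)

@[simp] theorem mkSL_zero_zero : mkSL a b c d h 0 0 = a := rfl

@[simp] theorem mkSL_zero_one : mkSL a b c d h 0 1 = b := rfl

@[simp] theorem mkSL_one_zero : mkSL a b c d h 1 0 = c := rfl

@[simp] theorem mkSL_one_one : mkSL a b c d h 1 1 = d := rfl

theorem sl_mul_apply (σ τ : SpecialLinearGroup (Fin 2) R) (i j : Fin 2) :
    (σ * τ) i j = σ i 0 * τ 0 j + σ i 1 * τ 1 j := by
  change (σ.1 * τ.1) i j = _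
  rw [Matrix.mul_apply, Fin.sum_univ_two]

theorem sl_ext {σ τ : SpecialLinearGroup (Fin 2) R} (h₀ : σ 0 0 = τ 0 0) (h₁ : σ 0 1 = τ 0 1)
    (h₂ : σ 1 0 = τ 1 0) (h₃ : σ 1 1 = τ 1 1) : σ = τ := by
  ext i j
  fin_cases i <;> fin_cases j <;> assumption

end mkSL

theorem embSL_upper (t : ℚ) (h) :
    Sp2Q.embSL (mkSL 1 t 0 1 h) = Sp2Q.upper !![0, 0; 0, t] (isSymm_diag 0 t) := by
  apply Subtype.ext
  change fromBlocks _ _ _ _ = fromBlocks _ _ _ _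
  congr 1 <;> ext i j <;> fin_cases i <;> fin_cases j <;> simp

theorem embSL_diag {u : ℚ} (hu : u ≠ 0) (h) :
    Sp2Q.embSL (mkSL u 0 0 u⁻¹ h) = Sp2Q.levi (diagGL 1 u one_ne_zero hu) := by
  apply Subtype.ext
  change fromBlocks _ _ _ _ = fromBlocks !![1, 0; 0, u] 0 0 (!![(1 : ℚ)⁻¹, 0; 0, u⁻¹])ᵀ
  congr 1 <;> ext i j <;> fin_cases i <;> fin_cases j <;> simp

/-- The Bruhat decomposition relative to `σ₂₂ = d`. It lets an element of `Γ₀(p)` act through two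
rational translations, a scaling and a single Fourier transform. -/
theorem embSL_mul_inversion {σ : SpecialLinearGroup (Fin 2) ℚ} {d : ℚ} (hd : d ≠ 0)
    (hσ : σ 1 1 = d) :
    Sp2Q.embSL σ * Sp2Q.inversion =
      Sp2Q.upper !![0, 0; 0, σ 0 1 / d] (isSymm_diag 0 _) *
        Sp2Q.levi (diagGL 1 d⁻¹ one_ne_zero (inv_ne_zero hd)) * Sp2Q.inversion *
        Sp2Q.upper !![0, 0; 0, -(σ 1 0 / d)] (isSymm_diag 0 _) := by
  have h := σ.det_coe
  rw [det_fin_two, hσ] at h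
  rw [← embSL_upper _ (by simp), ← embSL_upper _ (by simp), ← embSL_diag _ (by simp [hd]),
    show Sp2Q.inversion = Sp2Q.embSL (mkSL 0 1 (-1) 0 (by simp)) from rfl, ← map_mul, ← map_mul,
    ← map_mul, ← map_mul]
  congr 1
  apply sl_ext <;> simp [sl_mul_apply, hσ, hd] <;> field_simp
  linear_combination h

variable [DecidableEq n]

theorem IsSchwartzCol.quad_twist {p : ℕ} (hQ : IsLevelForm p Q) {d : ℕ} (hd : 0 < d) (b : ℤ) (c : ℂ) :
    IsSchwartzCol d 1 fun x : n → ℚ => c * (ind (intLattice n) ((d : ℚ) • x) *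
      ratExp (b / d * quad Q ((d : ℚ) • x))) where
  supp := fun x hx i => by
    have h1 := left_ne_zero_of_mul (right_ne_zero_of_mul hx)
    by_cases h : (d : ℚ) • x ∈ intLattice n
    · obtain ⟨v, hv⟩ := h
      refine ⟨v i, ?_⟩
      have := congrFun hv i
      simp only [Pi.smul_apply, smul_eq_mul] at this
      have hd' : (d : ℚ) ≠ 0 := by positivity
      field_simp
      linarith
    · exact (h1 (ind_of_notMem h)).elim
  per := fun x v => by
    have hv : (fun i => (v i : ℚ)) ∈ intLattice n := ⟨v, rfl⟩
    have hdv : (d : ℚ) • (fun i => (v i : ℚ)) ∈ intLattice n := ⟨(d : ℤ) • v, by ext i; simp⟩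
    have hx : (fun i => x i + ((1 : ℕ) : ℚ) * v i) = x + fun i => (v i : ℚ) := by ext i; simp
    rw [hx, smul_add]
    by_cases h : (d : ℚ) • x ∈ intLattice n
    · rw [ind_of_mem h, ind_of_mem (add_mem h hdv)]
      congr 2
      apply ratExp_eq_of_sub
      obtain ⟨m₁, h₁⟩ := bil_int_dual (Q := Q) h (intLattice_le_dualLattice hv)
      obtain ⟨m₂, h₂⟩ := quad_int hQ.even hv
      refine ⟨b * m₁ + b * d * m₂, ?_⟩
      have hd' : (d : ℚ) ≠ 0 := by positivity
      rw [quad_add hQ.even.1, bil_smul_right, h₁, quad_smul _ (fun i => (v i : ℚ)), h₂]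
      push_cast
      field_simp
      ring
    · rw [ind_of_notMem h, ind_of_notMem (by rwa [(intLattice n).add_mem_cancel_right hdv])]
      simp
  bdd := ⟨‖c‖, fun x => by
    rw [norm_mul, norm_mul, norm_ratExp, mul_one]
    by_cases h : (d : ℚ) • x ∈ intLattice n
    · simp [ind_of_mem h]
    · simp [ind_of_notMem h]⟩

theorem sqrt_det_eq {p : ℕ} (hQ : IsLevelForm p Q) : √(Q.det : ℝ) = (p : ℝ) ^ 2 := by
  rw [hQ.det]
  push_cast
  rw [show (p : ℝ) ^ 4 = ((p : ℝ) ^ 2) ^ 2 by ring, Real.sqrt_sq (by positivity)]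

theorem latticeFourier_ind_int {p : ℕ} (hQ : IsLevelForm p Q) :
    latticeFourier Q 1 1 (ind (intLattice n)) = fun y => ((p : ℂ) ^ 2)⁻¹ * ind (dualLattice Q) y := by
  ext y
  rw [latticeFourier, inDual_one_iff, sqrt_det_eq hQ]
  split_ifs with h
  · rw [ind_of_mem h]
    have : Unique (n → Fin (1 * 1)) := inferInstanceAs (Unique (n → Fin 1))
    rw [Fintype.sum_unique]
    have h0 : ∀ k : n → Fin (1 * 1), (fun i => ((k i : ℕ) : ℚ) / ((1 : ℕ) : ℚ)) = 0 := by
      intro k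
      ext i
      simp
    rw [h0, ind_of_mem (zero_mem _), bil_zero_left, show ratExp 0 = 1 by simpa using ratExp_int 0]
    simp
  · rw [ind_of_notMem h, mul_zero]

/-- The sum defining the transform is the Gauss sum of `quad_sum_dual`; its value `d⁴` cancels the
factor `d⁻⁴` that the scaling produced in weight four. -/
theorem latticeFourier_quad_twist {p : ℕ} (hQ : IsLevelForm p Q) {d : ℕ} [hd : Fact d.Prime]
    (hd2 : d ≠ 2) (hp : p.Prime) (hdp : d ≠ p) {a b c : ℤ} (hdet : a * d - b * c = 1)
    (hc : (p : ℤ) ∣ c) :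
    latticeFourier Q d 1 (fun x : n → ℚ => ((d : ℂ) ^ 4)⁻¹ * (ind (intLattice n) ((d : ℚ) • x) *
      ratExp (b / d * quad Q ((d : ℚ) • x)))) =
      fun y => ((p : ℂ) ^ 2)⁻¹ * ind (dualLattice Q) y * ratExp (c / d * quad Q y) := by
  have hd0 : (d : ℚ) ≠ 0 := Nat.cast_ne_zero.2 hd.out.ne_zero
  have hdC : (d : ℂ) ≠ 0 := Nat.cast_ne_zero.2 hd.out.ne_zero
  ext y
  rw [latticeFourier, inDual_one_iff, sqrt_det_eq hQ]
  split_ifs with h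
  · rw [ind_of_mem h]
    have hsum : ∀ k : n → Fin (1 * d), ((d : ℂ) ^ 4)⁻¹ * (ind (intLattice n)
        ((d : ℚ) • fun i => ((k i : ℕ) : ℚ) / d) *
        ratExp (b / d * quad Q ((d : ℚ) • fun i => ((k i : ℕ) : ℚ) / d))) *
        ratExp (bil Q (fun i => ((k i : ℕ) : ℚ) / d) y) =
        ((d : ℂ) ^ 4)⁻¹ * (ratExp (b / d * quad Q fun i => (((k i : ℕ) : ℤ) : ℚ)) *
        ratExp (bil Q (fun i => (((k i : ℕ) : ℤ) : ℚ)) y / d)) := by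
      intro k
      have h1 : ((d : ℚ) • fun i => ((k i : ℕ) : ℚ) / d) = fun i => (((k i : ℕ) : ℤ) : ℚ) := by
        ext i; simp; field_simp
      have h2 : (fun i => ((k i : ℕ) : ℚ) / d) = (d : ℚ)⁻¹ • fun i => (((k i : ℕ) : ℤ) : ℚ) := by
        ext i; simp; field_simp
      rw [h1, h2, bil_smul_left, ind_of_mem (mem_intLattice.2 ⟨fun i => ((k i : ℕ) : ℤ), rfl⟩), one_mul, mul_assoc,
        inv_mul_eq_div _ (bil Q _ y)]
    rw [Finset.sum_congr rfl fun k _ => hsum k, ← Finset.mul_sum, quad_sum_dual hQ hd2 hp hdp hdet hc h]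
    push_cast
    field_simp
    simp
  · rw [ind_of_notMem h]
    simp

/-- The theta series of the lattice `ℤⁿ`. -/
abbrev latticeTheta (Q : Matrix n n ℤ) : Matrix (Fin 2) (Fin 2) ℂ → ℂ :=
  thetaSum Q (colProd (ind (intLattice n)) (ind (intLattice n)))

theorem latticeTheta_slash_inversion {p : ℕ} (hQ : IsLevelForm p Q) {Ω : Matrix (Fin 2) (Fin 2) ℂ}
    (hΩ : Ω ∈ siegelHalfSpace) :
    slash 4 (latticeTheta Q) Sp2Q.inversion Ω = thetaSum Q (colProd (ind (intLattice n))
      fun y => ((p : ℂ) ^ 2)⁻¹ * ind (dualLattice Q) y) Ω := by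
  rw [slash_inversion_colProd hQ.even.1 hQ.pos hQ.card one_pos one_pos one_pos isSchwartzCol_ind_int
    isSchwartzCol_ind_int hΩ, latticeFourier_ind_int hQ]

/-- By the Bruhat decomposition of `σ` times the inversion, the transformed function in the second
column is `p⁻² 1_{L^#}` times the phase `e(c q / d)`. The final translation by `-c/d` removes the
phase and leaves the effect of the inversion alone, which is then cancelled. -/
theorem embSL_mem_slashStabilizer_of_prime {p : ℕ} (hQ : IsLevelForm p Q) (hp : p.Prime)
    {σ : SpecialLinearGroup (Fin 2) ℤ} (hc : (p : ℤ) ∣ σ 1 0) {d : ℕ} [hd : Fact d.Prime]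
    (hd2 : d ≠ 2) (hdp : d ≠ p) (hσ : σ 1 1 = d) :
    Sp2Q.embSL (SpecialLinearGroup.map (Int.castRingHom ℚ) σ) ∈
      slashStabilizer 4 (latticeTheta Q) := by
  have hd0 : (d : ℚ) ≠ 0 := Nat.cast_ne_zero.2 hd.out.ne_zero
  have hdet := σ.det_coe
  rw [det_fin_two, hσ] at hdet
  have key : ∀ Ω ∈ siegelHalfSpace, slash 4 (latticeTheta Q)
      (Sp2Q.embSL (SpecialLinearGroup.map (Int.castRingHom ℚ) σ) * Sp2Q.inversion) Ω =
      slash 4 (latticeTheta Q) Sp2Q.inversion Ω := by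
    intro Ω hΩ
    rw [embSL_mul_inversion (d := d) hd0 (by simp [hσ])]
    rw [slash_mul _ _ _ _ hΩ]
    have h1 : ∀ Ω ∈ siegelHalfSpace, slash 4 (latticeTheta Q)
        (Sp2Q.upper !![0, 0; 0, (SpecialLinearGroup.map (Int.castRingHom ℚ) σ) 0 1 / (d : ℚ)]
          (isSymm_diag 0 _) * Sp2Q.levi (diagGL 1 (d : ℚ)⁻¹ one_ne_zero (inv_ne_zero hd0)) *
          Sp2Q.inversion) Ω =
        thetaSum Q (colProd (ind (intLattice n)) fun y =>
          ((p : ℂ) ^ 2)⁻¹ * ind (dualLattice Q) y * ratExp ((σ 1 0 : ℤ) / d * quad Q y)) Ω := by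
      intro Ω hΩ
      have h2 : ∀ Ω ∈ siegelHalfSpace, slash 4 (latticeTheta Q)
          (Sp2Q.upper !![0, 0; 0, (SpecialLinearGroup.map (Int.castRingHom ℚ) σ) 0 1 / (d : ℚ)]
          (isSymm_diag 0 _) * Sp2Q.levi (diagGL 1 (d : ℚ)⁻¹ one_ne_zero (inv_ne_zero hd0))) Ω =
          thetaSum Q (colProd (ind (intLattice n)) fun x =>
            ((d : ℂ) ^ 4)⁻¹ * (ind (intLattice n) ((d : ℚ) • x) *
            ratExp ((σ 0 1 : ℤ) / d * quad Q ((d : ℚ) • x)))) Ω := by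
        intro Ω hΩ
        rw [slash_mul _ _ _ _ hΩ, slash_congr 4 (fun Ω _ => slash_upper_colProd 4 _ _ _ _ Ω) _ hΩ,
          slash_levi_colProd]
        congr 2
        · ext x
          simp [show ratExp 0 = 1 by simpa using ratExp_int 0]
        · ext x
          simp
      rw [slash_mul _ _ _ _ hΩ, slash_congr 4 h2 _ hΩ,
        slash_inversion_colProd hQ.even.1 hQ.pos hQ.card one_pos hd.out.pos one_pos
          isSchwartzCol_ind_int (IsSchwartzCol.quad_twist hQ hd.out.pos _ _) hΩ,
        latticeFourier_quad_twist hQ hd2 hp hdp hdet hc]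
    rw [slash_congr 4 h1 _ hΩ, slash_upper_colProd, latticeTheta_slash_inversion hQ hΩ]
    congr 2
    · ext x
      simp [show ratExp 0 = 1 by simpa using ratExp_int 0]
    · ext x
      rw [mul_assoc, ← ratExp_add]
      simp [show ratExp 0 = 1 by simpa using ratExp_int 0]
  intro Ω hΩ
  have h3 := slash_congr 4 key Sp2Q.inversion⁻¹ hΩ
  rw [← slash_mul _ _ _ _ hΩ, ← slash_mul _ _ _ _ hΩ, mul_inv_cancel_right, mul_inv_cancel,
    slash_one] at h3
  exact h3

/-- Invariance under the embedded `Γ₀(p) ⊆ SL₂(ℤ)`. -/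
theorem embSL_mem_slashStabilizer {p : ℕ} (hQ : IsLevelForm p Q) (hp : p.Prime)
    {σ : SpecialLinearGroup (Fin 2) ℤ} (hc : (p : ℤ) ∣ σ 1 0) :
    Sp2Q.embSL (SpecialLinearGroup.map (Int.castRingHom ℚ) σ) ∈
      slashStabilizer 4 (latticeTheta Q) := by
  let H := (slashStabilizer 4 (latticeTheta Q)).comap
    (Sp2Q.embSL.comp (SpecialLinearGroup.map (Int.castRingHom ℚ)))
  change σ ∈ H
  have hT : ∀ t : ℤ, mkSL 1 t 0 1 (by simp) ∈ H := by
    intro t Ω hΩ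
    have he : (Sp2Q.embSL.comp (SpecialLinearGroup.map (Int.castRingHom ℚ)))
        (mkSL 1 t 0 1 (by simp)) =
        Sp2Q.upper !![0, 0; 0, (t : ℚ)] (isSymm_diag 0 t) := by
      rw [← embSL_upper _ (by simp), MonoidHom.comp_apply]
      congr 1
      apply sl_ext <;> simp
    rw [he, slash_upper_colProd]
    congr 2
    · ext x
      simp [show ratExp 0 = 1 by simpa using ratExp_int 0]
    · ext x
      by_cases hx : x ∈ intLattice n
      · obtain ⟨m, hm⟩ := quad_int hQ.even hx
        rw [hm, ← Int.cast_mul, ratExp_int, mul_one]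
      · rw [ind_of_notMem hx, zero_mul]
  have main : ∀ σ : SpecialLinearGroup (Fin 2) ℤ, (p : ℤ) ∣ σ 1 0 → σ 1 0 ≠ 0 → σ ∈ H := by
    intro σ hc h0
    have hdet := σ.det_coe
    rw [det_fin_two] at hdet
    have hco : IsCoprime (σ 1 1) ((σ 1 0).natAbs : ℤ) := by
      rw [Int.isCoprime_iff_gcd_eq_one, Int.gcd, Int.natAbs_natCast, ← Int.gcd, ← Int.isCoprime_iff_gcd_eq_one]
      exact ⟨σ 0 0, -σ 0 1, by linear_combination hdet⟩
    -- Dirichlet's theorem: an integral translation changes `σ₂₂` by a multiple of `σ₂₁`, so it may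
    -- be replaced by a prime exceeding both `p` and `2`.
    obtain ⟨d, hdgt, hd, hmod⟩ := Nat.forall_exists_prime_gt_and_zmodEq (max p 2)
      (Int.natAbs_ne_zero.2 h0) hco
    obtain ⟨t, ht⟩ : σ 1 0 ∣ (d : ℤ) - σ 1 1 := by
      rw [← Int.natAbs_dvd]
      exact hmod.symm.dvd
    rw [← H.mul_mem_cancel_right (hT t)]
    have : Fact d.Prime := ⟨hd⟩
    have hmax := le_max_left p 2
    have hmax' := le_max_right p 2
    refine embSL_mem_slashStabilizer_of_prime hQ hp (d := d) ?_ (by omega) (by omega) ?_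
    · simpa [sl_mul_apply] using hc
    · simp [sl_mul_apply]
      linarith
  by_cases h0 : σ 1 0 = 0
  -- If `σ₂₁ = 0`, multiplication by `(1, 0; p, 1)` makes this entry nonzero.
  · let τ : SpecialLinearGroup (Fin 2) ℤ := mkSL 1 0 p 1 (by simp)
    have hp0 : (p : ℤ) ≠ 0 := by exact_mod_cast hp.ne_zero
    have hτ : τ ∈ H := main τ (by simp [τ]) (by simpa [τ] using hp0)
    rw [← H.mul_mem_cancel_right hτ]
    have hdet := σ.det_coe
    rw [det_fin_two, h0] at hdet
    refine main _ ?_ ?_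
    · simp [τ, sl_mul_apply, h0]
    · have h11 : σ 1 1 ≠ 0 := by intro h; simp [h] at hdet
      simpa [τ, sl_mul_apply, h0, hp.ne_zero] using h11
  · exact main σ hc h0

end

/-! ### Invariance under all of `Γ₀(p)`. -/

noncomputable section

variable {n : Type*} [Fintype n] {Q : Matrix n n ℤ}

omit [Fintype n] in
theorem colProd_ind_eq_one (V : Matrix n (Fin 2) ℤ) :
    colProd (ind (intLattice n)) (ind (intLattice n)) (V.map (Int.cast : ℤ → ℚ)) = 1 := by
  have h : ∀ j, (V.map (Int.cast : ℤ → ℚ)).col j ∈ intLattice n := fun j => ⟨V.col j, rfl⟩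
  rw [colProd, ind_of_mem (h 0), ind_of_mem (h 1), one_mul]

omit [Fintype n] in
theorem exists_of_colProd_ind_ne_zero {N : Matrix n (Fin 2) ℚ}
    (h : colProd (ind (intLattice n)) (ind (intLattice n)) N ≠ 0) :
    ∃ V : Matrix n (Fin 2) ℤ, N = V.map (Int.cast : ℤ → ℚ) := by
  have h0 : N.col 0 ∈ intLattice n := by
    by_contra h'; exact left_ne_zero_of_mul h (ind_of_notMem h')
  have h1 : N.col 1 ∈ intLattice n := by
    by_contra h'; exact right_ne_zero_of_mul h (ind_of_notMem h')
  obtain ⟨v, hv⟩ := h0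
  obtain ⟨w, hw⟩ := h1
  refine ⟨Matrix.of fun i => ![v i, w i], ?_⟩
  ext i j
  fin_cases j
  · exact congrFun hv i
  · exact congrFun hw i

omit [Fintype n] in
theorem colProd_ind_mul_leviZ (a : GL (Fin 2) ℤ) (N : Matrix n (Fin 2) ℚ) :
    colProd (ind (intLattice n)) (ind (intLattice n)) (N * a.1.map (Int.cast : ℤ → ℚ)) =
      colProd (ind (intLattice n)) (ind (intLattice n)) N := by
  have key : ∀ (a : GL (Fin 2) ℤ) (N : Matrix n (Fin 2) ℚ),
      colProd (ind (intLattice n)) (ind (intLattice n)) N ≠ 0 →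
      colProd (ind (intLattice n)) (ind (intLattice n)) (N * a.1.map (Int.cast : ℤ → ℚ)) =
      colProd (ind (intLattice n)) (ind (intLattice n)) N := by
    intro a N h
    obtain ⟨V, rfl⟩ := exists_of_colProd_ind_ne_zero h
    rw [colProd_ind_eq_one, ← colProd_ind_eq_one (V * a.1)]
    congr 1
    exact (Matrix.map_mul (f := Int.castRingHom ℚ)).symm
  by_cases h : colProd (ind (intLattice n)) (ind (intLattice n)) N = 0
  · by_contra hne
    have h' : colProd (ind (intLattice n)) (ind (intLattice n)) (N * a.1.map (Int.cast : ℤ → ℚ)) ≠ 0 := by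
      rwa [h] at hne
    have := key a⁻¹ _ h'
    have hinv : a.1.map (Int.cast : ℤ → ℚ) * (a⁻¹).1.map (Int.cast : ℤ → ℚ) = 1 := by
      have h : a.1 * (a⁻¹ : GL (Fin 2) ℤ).1 = 1 := by rw [← Units.val_mul]; simp
      have := congrArg (fun M : Matrix (Fin 2) (Fin 2) ℤ => M.map (Int.castRingHom ℚ)) h
      simp only [Matrix.map_mul] at this
      rw [Matrix.map_one _ (map_zero _) (map_one _)] at this
      exact this
    rw [Matrix.mul_assoc, hinv, Matrix.mul_one] at this
    exact hne this.symm
  · exact key a N h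

theorem slash_leviZ (φ : Matrix n (Fin 2) ℚ → ℂ) (a : GL (Fin 2) ℤ) (Ω : Matrix (Fin 2) (Fin 2) ℂ) :
    slash 4 (thetaSum Q φ) (leviZ a) Ω =
      thetaSum Q (fun N => φ (N * (a⁻¹).1.map (Int.cast : ℤ → ℚ))) Ω := by
  rw [leviZ, thetaSum_slash_levi]
  congr 1
  ext N
  have hdet : (GeneralLinearGroup.map (Int.castRingHom ℚ) a).1.det = ((a.1.det : ℤ) : ℚ) :=
    ((Int.castRingHom ℚ).map_det a.1).symm
  have hu : IsUnit a.1.det := (Matrix.isUnit_iff_isUnit_det _).1 a.isUnit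
  rw [hdet, ← map_inv]
  change _ * φ (N * (a⁻¹).1.map (Int.cast : ℤ → ℚ)) = _
  -- The determinant is `±1` and the weight is even.
  rcases Int.isUnit_iff.1 hu with h | h <;> rw [h] <;> norm_num

variable [DecidableEq n]

/-- The theta series is invariant under `Γ₀(p)`. -/
theorem mem_slashStabilizer_latticeTheta {p : ℕ} (hQ : IsLevelForm p Q) (hp : p.Prime) {g : Sp2Q}
    (hg : g ∈ Sp2Z) (hC : ∀ i j, ∃ m : ℤ, (g : Matrix Idx Idx ℚ) (Sum.inr i) (Sum.inl j) = p * m) :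
    g ∈ slashStabilizer 4 (latticeTheta Q) := by
  refine mem_of_gamma0_generators (N := p)
    (fun b hb => mem_slashStabilizer.2 fun Ω _ => ?_) (fun a => mem_slashStabilizer.2 fun Ω _ => ?_)
    (fun σ hσ => embSL_mem_slashStabilizer hQ hp hσ) (fun i j => ?_) (by simpa using hC)
  · rw [thetaSum_slash_upper]
    congr 1
    ext N
    by_cases h : colProd (ind (intLattice n)) (ind (intLattice n)) N = 0
    · rw [h, zero_mul]
    obtain ⟨V, rfl⟩ := exists_of_colProd_ind_ne_zero h
    rw [colProd_ind_eq_one, one_mul]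
    have hint : ∀ v : n → ℤ, (fun i => (v i : ℚ)) ∈ intLattice n := fun v => ⟨v, rfl⟩
    obtain ⟨m₀, h₀⟩ := quad_int hQ.even (hint (V.col 0))
    obtain ⟨m₁, h₁⟩ := quad_int hQ.even (hint (V.col 1))
    obtain ⟨m₂, h₂⟩ := bil_int_dual (Q := Q) (hint (V.col 0)) (intLattice_le_dualLattice (hint (V.col 1)))
    have hb' : b 1 0 = b 0 1 := by
      have := congrFun (congrFun hb 0) 1
      simpa using this
    have : 1 / 2 * (gramMat Q (V.map (Int.cast : ℤ → ℚ)) * b.map (Int.cast : ℤ → ℚ)).trace =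
        ((m₀ * b 0 0 + m₁ * b 1 1 + m₂ * b 0 1 : ℤ) : ℚ) := by
      simp only [trace_fin_two, Matrix.mul_apply, Fin.sum_univ_two, gramMat_apply, map_apply, hb']
      rw [quad] at h₀ h₁
      change 1 / 2 * (bil Q (fun i => (V.col 0 i : ℚ)) (fun i => (V.col 0 i : ℚ)) * _ +
        bil Q (fun i => (V.col 0 i : ℚ)) (fun i => (V.col 1 i : ℚ)) * _ +
        (bil Q (fun i => (V.col 1 i : ℚ)) (fun i => (V.col 0 i : ℚ)) * _ +
        bil Q (fun i => (V.col 1 i : ℚ)) (fun i => (V.col 1 i : ℚ)) * _)) = _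
      rw [bil_comm hQ.even.1 (fun i => (V.col 1 i : ℚ)) (fun i => (V.col 0 i : ℚ)), h₂]
      push_cast
      linear_combination (b 0 0 : ℚ) * h₀ + (b 1 1 : ℚ) * h₁
    rw [this, ratExp_int]
  · rw [slash_leviZ]
    congr 1
    ext N
    exact colProd_ind_mul_leviZ _ N
  · obtain ⟨m, hm⟩ := hg i j
    exact ⟨m, by simpa using hm⟩

/-! ## Boundedness at all cusps -/

/-- The elements preserving the space of theta series of Schwartz functions. -/
def schwartzGroup (Q : Matrix n n ℤ) : Subgroup Sp2Q where
  -- The condition is imposed on `γ⁻¹` too, which builds in closure under inverses.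
  carrier := {γ | ∀ δ ∈ ({γ, γ⁻¹} : Set Sp2Q), ∀ φ, IsSchwartz φ → ∃ φ', IsSchwartz φ' ∧
    ∀ Ω ∈ siegelHalfSpace, slash 4 (thetaSum Q φ) δ Ω = thetaSum Q φ' Ω}
  one_mem' := by
    intro δ hδ φ hφ
    simp only [inv_one, Set.insert_eq_of_mem, Set.mem_singleton_iff] at hδ
    exact ⟨φ, hφ, fun Ω _ => by rw [hδ, slash_one]⟩
  mul_mem' := by
    intro γ δ hγ hδ
    have key : ∀ γ δ : Sp2Q, (∀ φ, IsSchwartz φ → ∃ φ', IsSchwartz φ' ∧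
        ∀ Ω ∈ siegelHalfSpace, slash 4 (thetaSum Q φ) γ Ω = thetaSum Q φ' Ω) →
        (∀ φ, IsSchwartz φ → ∃ φ', IsSchwartz φ' ∧
        ∀ Ω ∈ siegelHalfSpace, slash 4 (thetaSum Q φ) δ Ω = thetaSum Q φ' Ω) →
        ∀ φ, IsSchwartz φ → ∃ φ', IsSchwartz φ' ∧
        ∀ Ω ∈ siegelHalfSpace, slash 4 (thetaSum Q φ) (γ * δ) Ω = thetaSum Q φ' Ω := by
      intro γ δ hγ hδ φ hφ
      obtain ⟨φ₁, h₁, e₁⟩ := hγ φ hφ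
      obtain ⟨φ₂, h₂, e₂⟩ := hδ φ₁ h₁
      exact ⟨φ₂, h₂, fun Ω hΩ => by rw [slash_mul _ _ _ _ hΩ, slash_congr 4 e₁ _ hΩ, e₂ Ω hΩ]⟩
    rintro ε (rfl | rfl)
    · exact key _ _ (hγ _ (by simp)) (hδ _ (by simp))
    · rw [_root_.mul_inv_rev]
      exact key _ _ (hδ _ (by simp)) (hγ _ (by simp))
  inv_mem' := by
    intro γ hγ δ hδ
    rw [inv_inv] at hδ
    exact hγ δ (by rcases hδ with rfl | rfl <;> simp)

omit [DecidableEq n] in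
theorem upper_mem_schwartzGroup (b : Matrix (Fin 2) (Fin 2) ℤ)
    (hb : (b.map (Int.cast : ℤ → ℚ)).IsSymm) :
    Sp2Q.upper (b.map (Int.cast : ℤ → ℚ)) hb ∈ schwartzGroup Q := by
  have hinv : (Sp2Q.upper (b.map (Int.cast : ℤ → ℚ)) hb)⁻¹ =
      Sp2Q.upper ((-b).map (Int.cast : ℤ → ℚ)) (by
        rw [Matrix.map_neg _ (fun x => Int.cast_neg x)]; exact hb.neg) := by
    rw [inv_eq_iff_mul_eq_one]
    apply Subtype.ext
    change fromBlocks _ _ _ _ * fromBlocks _ _ _ _ = 1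
    rw [fromBlocks_multiply, ← fromBlocks_one]
    congr 1
    · simp
    · ext i j; simp
    · simp
    · simp
  rintro δ (rfl | rfl) φ hφ
  · exact ⟨_, hφ.upper b, fun Ω _ => thetaSum_slash_upper 4 φ _ _ Ω⟩
  · rw [hinv]
    exact ⟨_, hφ.upper (-b), fun Ω _ => thetaSum_slash_upper 4 φ _ _ Ω⟩

omit [DecidableEq n] in
theorem leviZ_mem_schwartzGroup (a : GL (Fin 2) ℤ) : leviZ a ∈ schwartzGroup Q := by
  have hinv : (leviZ a)⁻¹ = leviZ a⁻¹ := by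
    rw [inv_eq_iff_mul_eq_one, ← SpZ.toQ_levi, ← SpZ.toQ_levi, ← map_mul]
    convert map_one SpZ.toQ
    apply Subtype.ext
    change fromBlocks _ _ _ _ * fromBlocks _ _ _ _ = 1
    rw [fromBlocks_multiply, ← fromBlocks_one]
    congr 1 <;> simp [← transpose_mul]
  have key : ∀ (a : GL (Fin 2) ℤ) φ, IsSchwartz φ → ∃ φ', IsSchwartz φ' ∧
      ∀ Ω ∈ siegelHalfSpace, slash 4 (thetaSum Q φ) (leviZ a) Ω = thetaSum Q φ' Ω := by
    intro a φ hφ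
    refine ⟨_, hφ.levi a⁻¹ 1, fun Ω _ => ?_⟩
    simp_rw [one_mul]
    exact slash_leviZ φ a Ω
  rintro δ (rfl | rfl)
  · exact key a
  · rw [hinv]
    exact key a⁻¹

theorem inversion_mem_schwartzGroup (hQ : Q.IsSymm) (hpos : (Q.map (Int.cast : ℤ → ℝ)).PosDef)
    (hcard : Fintype.card n = 8) : Sp2Q.inversion ∈ schwartzGroup Q := by
  have key : ∀ φ, IsSchwartz φ → ∃ φ', IsSchwartz φ' ∧
      ∀ Ω ∈ siegelHalfSpace, slash 4 (thetaSum Q φ) Sp2Q.inversion Ω = thetaSum Q φ' Ω := by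
    intro φ hφ
    obtain ⟨M, hM, hsupp⟩ := hφ.supp
    obtain ⟨R, hR, hper⟩ := hφ.per
    exact ⟨_, hφ.partialFourier hpos hM hR hper, fun Ω hΩ =>
      thetaSum_slash_inversion hQ hpos hcard hM hR hφ.toLatticeBdd (fun N hN i => hsupp N hN i 1)
        (IsSchwartz.setCol_per hper) hΩ⟩
  -- The inversion has order dividing four, so its inverse is its cube.
  have hinv : Sp2Q.inversion⁻¹ = Sp2Q.inversion * Sp2Q.inversion * Sp2Q.inversion := by
    rw [inv_eq_iff_mul_eq_one, show Sp2Q.inversion = Sp2Q.embSL (mkSL 0 1 (-1) 0 (by simp)) from rfl,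
      ← map_mul, ← map_mul, ← map_mul]
    convert map_one Sp2Q.embSL
    apply sl_ext <;> simp [sl_mul_apply]
  rintro δ (rfl | rfl) φ hφ
  · exact key φ hφ
  · obtain ⟨φ₁, h₁, e₁⟩ := key φ hφ
    obtain ⟨φ₂, h₂, e₂⟩ := key φ₁ h₁
    obtain ⟨φ₃, h₃, e₃⟩ := key φ₂ h₂
    refine ⟨φ₃, h₃, fun Ω hΩ => ?_⟩
    rw [hinv, slash_mul _ _ _ _ hΩ, ← e₃ Ω hΩ]
    refine slash_congr 4 (fun Ω hΩ => ?_) _ hΩ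
    rw [slash_mul _ _ _ _ hΩ, ← e₂ Ω hΩ]
    exact slash_congr 4 e₁ _ hΩ

/-- This is the generator theorem at level one, where the embedded `SL₂(ℤ)` is generated by `S` and
`T`. A theta series slashed by any element of `Sp₂(ℤ)` is therefore the theta series of another
Schwartz function, and so bounded on `Im Ω > Y₀`. -/
theorem sp2Z_le_schwartzGroup (hQ : Q.IsSymm) (hpos : (Q.map (Int.cast : ℤ → ℝ)).PosDef)
    (hcard : Fintype.card n = 8) : Sp2Z ≤ schwartzGroup Q := by
  intro g hg
  have hint : ∀ i j, ∃ m : ℤ, (g : Matrix Idx Idx ℚ) i j = m := fun i j => by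
    obtain ⟨m, hm⟩ := hg i j
    exact ⟨m, by simpa using hm⟩
  refine mem_of_gamma0_generators (N := 1) upper_mem_schwartzGroup leviZ_mem_schwartzGroup
    (fun σ _ => ?_) hint (fun i j => by
      obtain ⟨m, hm⟩ := hint (Sum.inr i) (Sum.inl j)
      exact ⟨m, by simpa using hm⟩)
  let H := (schwartzGroup Q).comap (Sp2Q.embSL.comp (SpecialLinearGroup.map (Int.castRingHom ℚ)))
  change σ ∈ H
  have htop : H = ⊤ := by
    rw [← top_le_iff, ← SpecialLinearGroup.SL2Z_generators, Subgroup.closure_le]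
    rintro τ (rfl | rfl)
    · rw [SetLike.mem_coe, Subgroup.mem_comap, MonoidHom.comp_apply]
      have : SpecialLinearGroup.map (Int.castRingHom ℚ) ModularGroup.S = (mkSL 0 1 (-1) 0 (by simp))⁻¹ := by
        rw [eq_inv_iff_mul_eq_one, show ModularGroup.S = mkSL 0 (-1) 1 0 (by simp) from rfl]
        apply sl_ext <;> simp [sl_mul_apply]
      rw [this, map_inv]
      exact inv_mem (inversion_mem_schwartzGroup hQ hpos hcard)
    · rw [SetLike.mem_coe, Subgroup.mem_comap, MonoidHom.comp_apply]
      have : SpecialLinearGroup.map (Int.castRingHom ℚ) ModularGroup.T = mkSL 1 1 0 1 (by simp) := by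
        rw [show ModularGroup.T = mkSL 1 1 0 1 (by simp) from rfl]
        apply sl_ext <;> simp
      rw [this, embSL_upper]
      convert upper_mem_schwartzGroup (Q := Q) !![0, 0; 0, 1] _ using 2
      · ext i j; fin_cases i <;> fin_cases j <;> simp
      · ext i j; fin_cases i <;> fin_cases j <;> simp
  rw [htop]
  trivial

end

noncomputable section

/-! ## Hecke operators -/

/-- A complete set of representatives of `Γ \ Γ'`, or more generally of `Γ \ ΓΓ'`. -/
structure IsCosetReps {ι : Type*} (Γ Γ' : Subgroup Sp2Q) (r : ι → Sp2Q) : Prop where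
  mem : ∀ i, r i ∈ Γ'
  surj : ∀ x ∈ Γ', ∃ i, x * (r i)⁻¹ ∈ Γ
  inj : ∀ i j, r i * (r j)⁻¹ ∈ Γ → i = j

theorem IsCosetReps.mul_right {ι : Type*} {Γ Γ' : Subgroup Sp2Q} {r : ι → Sp2Q}
    (h : IsCosetReps Γ Γ' r) {δ : Sp2Q} (hδ : δ ∈ Γ') : IsCosetReps Γ Γ' fun i => r i * δ where
  mem := fun i => mul_mem (h.mem i) hδ
  surj := fun x hx => by
    obtain ⟨i, hi⟩ := h.surj (x * δ⁻¹) (mul_mem hx (inv_mem hδ))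
    exact ⟨i, by rwa [_root_.mul_inv_rev, ← mul_assoc]⟩
  inj := fun i j hij => h.inj i j (by
    rwa [_root_.mul_inv_rev, mul_assoc, mul_inv_cancel_left] at hij)

/-- Invariance of `f` under `Γ` makes the summand independent of the representative picked by
`Quotient.out`. -/
theorem heckeOperator_eq_sum {ι : Type*} [Fintype ι] {k : ℤ} {Γ Γ' : Subgroup Sp2Q} {r : ι → Sp2Q}
    (h : IsCosetReps Γ Γ' r) {f : Matrix (Fin 2) (Fin 2) ℂ → ℂ}
    (hf : Γ ≤ slashStabilizer k f) {Ω : Matrix (Fin 2) (Fin 2) ℂ} (hΩ : Ω ∈ siegelHalfSpace) :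
    heckeOperator k Γ 1 Γ' f Ω = ∑ i, slash k f (r i) Ω := by
  rw [heckeOperator, ← finsum_eq_sum_of_fintype fun i => slash k f (r i) Ω,
    ← finsum_mem_univ fun i => slash k f (r i) Ω]
  symm
  refine finsum_mem_eq_of_bijOn (fun i => Quotient.mk (QuotientGroup.rightRel Γ) (r i)) ⟨?_, ?_, ?_⟩ ?_
  · intro i _
    refine ⟨r i, ?_, rfl⟩
    rw [DoubleCoset.mem_doubleCoset]
    exact ⟨1, one_mem _, r i, h.mem i, by simp⟩
  · intro i _ j _ hij
    have := Quotient.exact hij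
    change QuotientGroup.rightRel Γ _ _ at this
    rw [QuotientGroup.rightRel_apply] at this
    exact (h.inj j i this).symm
  · rintro _ ⟨x, hx, rfl⟩
    rw [DoubleCoset.mem_doubleCoset] at hx
    obtain ⟨γ, hγ, y, hy, rfl⟩ := hx
    obtain ⟨i, hi⟩ := h.surj y hy
    refine ⟨i, trivial, Quotient.sound ?_⟩
    change QuotientGroup.rightRel Γ _ _
    rw [QuotientGroup.rightRel_apply, mul_one, mul_assoc]
    exact mul_mem hγ hi
  · intro i _
    have := Quotient.exact (Quotient.out_eq (Quotient.mk (QuotientGroup.rightRel Γ) (r i)))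
    change QuotientGroup.rightRel Γ _ _ at this
    rw [QuotientGroup.rightRel_apply] at this
    set y := (Quotient.mk (QuotientGroup.rightRel Γ) (r i)).out
    rw [show r i = (r i * y⁻¹) * y by group, slash_mul _ _ _ _ hΩ]
    exact slash_congr k (hf this) y hΩ

theorem slash_sum {ι : Type*} (s : Finset ι) (k : ℤ) (f : ι → Matrix (Fin 2) (Fin 2) ℂ → ℂ)
    (γ : Sp2Q) (Ω : Matrix (Fin 2) (Fin 2) ℂ) :
    slash k (fun Ω => ∑ i ∈ s, f i Ω) γ Ω = ∑ i ∈ s, slash k (f i) γ Ω := by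
  simp only [slash]
  rw [Finset.mul_sum]

/-- Right multiplication by an element of `Γ'` turns one system of representatives into another. -/
theorem le_slashStabilizer_heckeOperator {ι : Type*} [Fintype ι] {k : ℤ} {Γ Γ' : Subgroup Sp2Q}
    {r : ι → Sp2Q} (h : IsCosetReps Γ Γ' r) {f : Matrix (Fin 2) (Fin 2) ℂ → ℂ}
    (hf : Γ ≤ slashStabilizer k f) : Γ' ≤ slashStabilizer k (heckeOperator k Γ 1 Γ' f) := by
  intro δ hδ Ω hΩ
  rw [heckeOperator_eq_sum (h.mul_right hδ) hf hΩ,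
    slash_congr k (fun Ω hΩ => heckeOperator_eq_sum h hf hΩ) δ hΩ, slash_sum]
  exact Finset.sum_congr rfl fun i _ => (slash_mul _ _ _ _ hΩ).symm

/-! ## Coset representatives -/

theorem inv_apply_entries (g : Sp2Q) (i j : Idx) :
    ((g⁻¹ : Sp2Q) : Matrix Idx Idx ℚ) i j = (if i.isLeft = j.isLeft then 1 else -1) *
      (g : Matrix Idx Idx ℚ) j.swap i.swap := by
  rw [SymplecticGroup.coe_inv]
  conv_lhs => rw [← fromBlocks_toBlocks (g : Matrix Idx Idx ℚ)]
  rcases i with i | i <;> rcases j with j | j <;>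
    simp [Matrix.J, fromBlocks_transpose, fromBlocks_multiply, fromBlocks_neg, toBlocks₁₁,
      toBlocks₁₂, toBlocks₂₁, toBlocks₂₂]

theorem mul_inv_apply_entries (g h : Sp2Q) (i j : Idx) :
    ((g * h⁻¹ : Sp2Q) : Matrix Idx Idx ℚ) i j = ∑ l, (g : Matrix Idx Idx ℚ) i l *
      ((if l.isLeft = j.isLeft then 1 else -1) * (h : Matrix Idx Idx ℚ) j.swap l.swap) := by
  change ((g : Matrix Idx Idx ℚ) * ((h⁻¹ : Sp2Q) : Matrix Idx Idx ℚ)) i j = _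
  rw [Matrix.mul_apply]
  simp_rw [inv_apply_entries]

section Reps

variable {p : ℕ} [NeZero p]

/-- Entries of elements of `Γ₀'(p)`. -/
theorem gamma0'_entry {g : Sp2Q} (hg : g ∈ gamma0' p) (i j : Idx) :
    ∃ m : ℤ, (g : Matrix Idx Idx ℚ) i j = m := by
  obtain ⟨m, hm⟩ := hg.2 i j
  exact ⟨m, by simpa using hm⟩

/-- The `(1,3)` entry is the only one of the paramodular pattern that allows a denominator. -/
theorem mem_gamma0'_iff {g : Sp2Q} (hg : g ∈ paramodular p) :
    g ∈ gamma0' p ↔ ∃ m : ℤ, (g : Matrix Idx Idx ℚ) (Sum.inl 0) (Sum.inr 0) = m := by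
  refine ⟨fun h => gamma0'_entry h _ _, fun h => ⟨hg, fun i j => ?_⟩⟩
  obtain ⟨m, hm⟩ := hg i j
  rcases i with i | i <;> rcases j with j | j <;> fin_cases i <;> fin_cases j <;>
    simp [paramodularPattern] at hm ⊢ <;>
    first
      | exact h
      | exact ⟨m, hm⟩
      | exact ⟨m * p, by push_cast; exact hm⟩

theorem mem_iwahori_iff {g : Sp2Q} (hg : g ∈ gamma0' p) :
    g ∈ iwahori p ↔ ∃ m : ℤ, (g : Matrix Idx Idx ℚ) (Sum.inr 1) (Sum.inl 1) = p * m := by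
  constructor
  · intro h
    obtain ⟨m, hm⟩ := h (Sum.inr 1) (Sum.inl 1)
    exact ⟨m, by rw [hm]; simp [iwahoriPattern, mul_comm]⟩
  · rintro ⟨k, hk⟩ i j
    obtain ⟨m, hm⟩ := hg.1 i j
    obtain ⟨m', hm'⟩ := hg.2 i j
    rcases i with i | i <;> rcases j with j | j <;> fin_cases i <;> fin_cases j <;>
      simp [iwahoriPattern, paramodularPattern] at hm hm' ⊢ <;>
      first
        | exact ⟨m, hm⟩
        | exact ⟨m', hm'⟩
        | exact ⟨k, by rw [hk, mul_comm]⟩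

theorem iwahori_le : iwahori p ≤ gamma0' p := by
  intro g hg
  refine ⟨fun i j => ?_, fun i j => ?_⟩
  · obtain ⟨m, hm⟩ := hg i j
    have hp : (p : ℚ) ≠ 0 := Nat.cast_ne_zero.2 (NeZero.ne p)
    rcases i with i | i <;> rcases j with j | j <;> fin_cases i <;> fin_cases j <;>
      simp [iwahoriPattern, paramodularPattern] at hm ⊢ <;>
      first
        | exact ⟨m, hm⟩
        | exact ⟨m * p, by rw [hm]; push_cast; field_simp⟩
  · obtain ⟨m, hm⟩ := hg i j
    rcases i with i | i <;> rcases j with j | j <;> fin_cases i <;> fin_cases j <;>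
      simp [iwahoriPattern] at hm ⊢ <;>
      first
        | exact ⟨m, hm⟩
        | exact ⟨m * p, by rw [hm]; push_cast; rfl⟩

/-- The coset of `g` is the point `(g₄₂ : g₄₄)` of `ℙ¹(𝔽_p)`. Modulo `p` the `(4,2)` entry of `g
h⁻¹` is the determinant of two such points, since the other contributions contain `(4,1)` entries,
which `p` divides. -/
theorem mul_inv_mem_iwahori_iff {g h : Sp2Q} (hg : g ∈ gamma0' p) (hh : h ∈ gamma0' p) {a b a' b' : ℤ}
    (ha : (g : Matrix Idx Idx ℚ) (Sum.inr 1) (Sum.inl 1) = a)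
    (hb : (g : Matrix Idx Idx ℚ) (Sum.inr 1) (Sum.inr 1) = b)
    (ha' : (h : Matrix Idx Idx ℚ) (Sum.inr 1) (Sum.inl 1) = a')
    (hb' : (h : Matrix Idx Idx ℚ) (Sum.inr 1) (Sum.inr 1) = b') :
    g * h⁻¹ ∈ iwahori p ↔ (p : ℤ) ∣ a * b' - b * a' := by
  rw [mem_iwahori_iff (mul_mem hg (inv_mem hh)), mul_inv_apply_entries]
  obtain ⟨x, hx⟩ := hg.1 (Sum.inr 1) (Sum.inl 0)
  obtain ⟨x', hx'⟩ := hh.1 (Sum.inr 1) (Sum.inl 0)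
  obtain ⟨y, hy⟩ := gamma0'_entry hg (Sum.inr 1) (Sum.inr 0)
  obtain ⟨y', hy'⟩ := gamma0'_entry hh (Sum.inr 1) (Sum.inr 0)
  simp [paramodularPattern] at hx hx'
  simp [Fin.sum_univ_two, ha, hb, ha', hb', hx, hx', hy, hy']
  constructor
  · rintro ⟨m, hm⟩
    refine ⟨m - x * y' + y * x', ?_⟩
    have : ((a * b' - b * a' : ℤ) : ℚ) = ((p * (m - x * y' + y * x') : ℤ) : ℚ) := by
      push_cast; linear_combination hm
    exact_mod_cast this
  · rintro ⟨m, hm⟩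
    refine ⟨m + x * y' - y * x', ?_⟩
    have : ((a * b' - b * a' : ℤ) : ℚ) = ((p * m : ℤ) : ℚ) := by rw [hm]
    push_cast at this ⊢
    linear_combination this

/-- Here the coset is the point `(g₁₁ : p g₁₃)` of `ℙ¹(𝔽_p)`; the remaining contributions to the
`(1,3)` entry of `g h⁻¹` are integral. -/
theorem mul_inv_mem_gamma0'_iff {g h : Sp2Q} (hg : g ∈ paramodular p) (hh : h ∈ paramodular p)
    {a b a' b' : ℤ} (ha : (g : Matrix Idx Idx ℚ) (Sum.inl 0) (Sum.inl 0) = a)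
    (hb : (g : Matrix Idx Idx ℚ) (Sum.inl 0) (Sum.inr 0) = b / p)
    (ha' : (h : Matrix Idx Idx ℚ) (Sum.inl 0) (Sum.inl 0) = a')
    (hb' : (h : Matrix Idx Idx ℚ) (Sum.inl 0) (Sum.inr 0) = b' / p) :
    g * h⁻¹ ∈ gamma0' p ↔ (p : ℤ) ∣ b * a' - a * b' := by
  have hp : (p : ℚ) ≠ 0 := Nat.cast_ne_zero.2 (NeZero.ne p)
  rw [mem_gamma0'_iff (mul_mem hg (inv_mem hh)), mul_inv_apply_entries]
  obtain ⟨x, hx⟩ := hg (Sum.inl 0) (Sum.inl 1)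
  obtain ⟨x', hx'⟩ := hh (Sum.inl 0) (Sum.inl 1)
  obtain ⟨y, hy⟩ := hg (Sum.inl 0) (Sum.inr 1)
  obtain ⟨y', hy'⟩ := hh (Sum.inl 0) (Sum.inr 1)
  simp [paramodularPattern] at hx hx' hy hy'
  simp [Fin.sum_univ_two, ha, hb, ha', hb', hx, hx', hy, hy']
  constructor
  · rintro ⟨m, hm⟩
    refine ⟨m + x * y' - y * x', ?_⟩
    field_simp at hm
    have : ((b * a' - a * b' : ℤ) : ℚ) = ((p * (m + x * y' - y * x') : ℤ) : ℚ) := by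
      push_cast; linear_combination hm
    exact_mod_cast this
  · rintro ⟨m, hm⟩
    refine ⟨m - x * y' + y * x', ?_⟩
    have : ((b * a' - a * b' : ℤ) : ℚ) = ((p * m : ℤ) : ℚ) := by rw [hm]
    push_cast at this ⊢
    field_simp
    linear_combination this

/-- Representatives of `B(p) \ Γ₀'(p)`. -/
def iwahoriRep (p : ℕ) : Option (Fin p) → Sp2Q
  | none => 1
  | some x => Sp2Q.inversion * Sp2Q.upper !![0, 0; 0, (x : ℕ)] (isSymm_diag 0 _)

omit [NeZero p] in
theorem coe_iwahoriRep_some (x : Fin p) : ((iwahoriRep p (some x) : Sp2Q) : Matrix Idx Idx ℚ) =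
    fromBlocks !![1, 0; 0, 0] !![0, 0; 0, 1] !![0, 0; 0, -1] !![1, 0; 0, -((x : ℕ) : ℚ)] := by
  change fromBlocks !![1, 0; 0, 0] !![0, 0; 0, 1] !![0, 0; 0, -1] !![1, 0; 0, 0] *
    fromBlocks 1 !![0, 0; 0, ((x : ℕ) : ℚ)] 0 1 = _
  rw [fromBlocks_multiply]
  congr 1 <;> ext i j <;> fin_cases i <;> fin_cases j <;> simp

theorem iwahoriRep_mem (i : Option (Fin p)) : iwahoriRep p i ∈ gamma0' p := by
  rcases i with _ | x
  · exact one_mem _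
  · refine ⟨fun i j => ?_, fun i j => ?_⟩ <;> rw [coe_iwahoriRep_some] <;>
    rcases i with i | i <;> rcases j with j | j <;> fin_cases i <;> fin_cases j <;>
      simp [paramodularPattern] <;>
      first
        | (refine ⟨0, ?_⟩; simp; done)
        | (refine ⟨1, ?_⟩; simp; done)
        | (refine ⟨-1, ?_⟩; simp; done)
        | (refine ⟨-(x : ℕ), ?_⟩; simp)

theorem exists_fin_dvd (hp : p.Prime) {a : ℤ} (b : ℤ) (ha : ¬ (p : ℤ) ∣ a) :
    ∃ x : Fin p, (p : ℤ) ∣ b - a * (x : ℕ) := by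
  have : Fact p.Prime := ⟨hp⟩
  have ha' : (a : ZMod p) ≠ 0 := by rwa [Ne, ZMod.intCast_zmod_eq_zero_iff_dvd]
  refine ⟨⟨((b : ZMod p) / a).val, ZMod.val_lt _⟩, ?_⟩
  rw [← ZMod.intCast_zmod_eq_zero_iff_dvd]
  push_cast
  rw [ZMod.natCast_zmod_val]
  field_simp
  ring

omit [NeZero p] in
theorem fin_eq_of_dvd {x y : Fin p} (h : (p : ℤ) ∣ ((x : ℕ) : ℤ) - (y : ℕ)) : x = y := by
  have h1 : ((x : ℕ) : ℤ) ≡ (y : ℕ) [ZMOD p] := ((Int.modEq_iff_dvd).2 h).symm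
  have h2 := (Int.natCast_modEq_iff).1 h1
  exact Fin.ext (Nat.ModEq.eq_of_lt_of_lt h2 x.2 y.2)

/-- The representatives realize the points `(0 : 1)` and `(-1 : -x)` of `ℙ¹(𝔽_p)`, each point once.
-/
theorem isCosetReps_iwahori (hp : p.Prime) :
    IsCosetReps (iwahori p) (gamma0' p) (iwahoriRep p) := by
  have h1 : ∀ x : Fin p, ((iwahoriRep p (some x) : Sp2Q) : Matrix Idx Idx ℚ) (Sum.inr 1) (Sum.inl 1) =
      ((-1 : ℤ) : ℚ) := fun x => by rw [coe_iwahoriRep_some]; simp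
  have h2 : ∀ x : Fin p, ((iwahoriRep p (some x) : Sp2Q) : Matrix Idx Idx ℚ) (Sum.inr 1) (Sum.inr 1) =
      ((-(x : ℕ) : ℤ) : ℚ) := fun x => by rw [coe_iwahoriRep_some]; simp
  have h3 : ((iwahoriRep p none : Sp2Q) : Matrix Idx Idx ℚ) (Sum.inr 1) (Sum.inl 1) = ((0 : ℤ) : ℚ) := by
    simp [iwahoriRep]
  have h4 : ((iwahoriRep p none : Sp2Q) : Matrix Idx Idx ℚ) (Sum.inr 1) (Sum.inr 1) = ((1 : ℤ) : ℚ) := by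
    simp [iwahoriRep]
  have hp1 : ¬ (p : ℤ) ∣ 1 := fun h =>
    (Nat.prime_iff_prime_int.1 hp).not_isUnit (isUnit_of_dvd_one h)
  refine ⟨iwahoriRep_mem, fun g hg => ?_, ?_⟩
  · obtain ⟨a, ha⟩ := gamma0'_entry hg (Sum.inr 1) (Sum.inl 1)
    obtain ⟨b, hb⟩ := gamma0'_entry hg (Sum.inr 1) (Sum.inr 1)
    by_cases hpa : (p : ℤ) ∣ a
    · exact ⟨none, (mul_inv_mem_iwahori_iff hg (iwahoriRep_mem _) ha hb h3 h4).2 (by simpa using hpa)⟩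
    · obtain ⟨x, hx⟩ := exists_fin_dvd hp b hpa
      refine ⟨some x, (mul_inv_mem_iwahori_iff hg (iwahoriRep_mem _) ha hb (h1 x) (h2 x)).2 ?_⟩
      convert hx using 1
      ring
  · rintro (_ | x) (_ | y) h
    · rfl
    · rw [mul_inv_mem_iwahori_iff (iwahoriRep_mem _) (iwahoriRep_mem _) h3 h4 (h1 y) (h2 y)] at h
      exact (hp1 (by simpa using h)).elim
    · rw [mul_inv_mem_iwahori_iff (iwahoriRep_mem _) (iwahoriRep_mem _) (h1 x) (h2 x) h3 h4] at h
      exact (hp1 (by simpa using h)).elim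
    · rw [mul_inv_mem_iwahori_iff (iwahoriRep_mem _) (iwahoriRep_mem _) (h1 x) (h2 x) (h1 y) (h2 y)] at h
      rw [fin_eq_of_dvd (p := p) (x := y) (y := x) (by convert h using 1; ring)]

/-- The permutation matrix of order two. -/
def swapGL : GL (Fin 2) ℤ := ⟨!![0, 1; 1, 0], !![0, 1; 1, 0], by
  ext i j; fin_cases i <;> fin_cases j <;> simp, by
  ext i j; fin_cases i <;> fin_cases j <;> simp⟩

/-- Representatives of `Γ₀'(p) \ K(p)`. -/
def paramodularRep (p : ℕ) [NeZero p] : Option (Fin p) → Sp2Q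
  | none => leviZ swapGL * Sp2Q.inversion * leviZ swapGL *
      Sp2Q.levi (diagGL p 1 (Nat.cast_ne_zero.2 (NeZero.ne p)) one_ne_zero)
  | some x => Sp2Q.upper !![((x : ℕ) : ℚ) / p, 0; 0, 0] (isSymm_diag _ 0)

theorem coe_leviZ_swapGL : ((leviZ swapGL : Sp2Q) : Matrix Idx Idx ℚ) =
    fromBlocks !![0, 1; 1, 0] 0 0 !![0, 1; 1, 0] := by
  rw [← SpZ.toQ_levi]
  change (fromBlocks !![0, 1; 1, 0] 0 0 (!![0, 1; 1, 0])ᵀ).map (Int.castRingHom ℚ) = _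
  rw [fromBlocks_map]
  congr 1 <;> ext i j <;> fin_cases i <;> fin_cases j <;> simp

theorem coe_paramodularRep_none : ((paramodularRep p none : Sp2Q) : Matrix Idx Idx ℚ) =
    fromBlocks !![0, 0; 0, 1] !![1 / (p : ℚ), 0; 0, 0] !![-(p : ℚ), 0; 0, 0] !![0, 0; 0, 1] := by
  change (leviZ swapGL : Sp2Q).1 * fromBlocks !![1, 0; 0, 0] !![0, 0; 0, 1] !![0, 0; 0, -1] !![1, 0; 0, 0] *
    (leviZ swapGL : Sp2Q).1 * fromBlocks !![(p : ℚ), 0; 0, 1] 0 0 (!![(p : ℚ)⁻¹, 0; 0, (1 : ℚ)⁻¹])ᵀ = _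
  rw [coe_leviZ_swapGL, fromBlocks_multiply, fromBlocks_multiply, fromBlocks_multiply]
  congr 1 <;> ext i j <;> fin_cases i <;> fin_cases j <;> simp [Matrix.vecMul, dotProduct]

theorem coe_paramodularRep_some (x : Fin p) : ((paramodularRep p (some x) : Sp2Q) : Matrix Idx Idx ℚ) =
    fromBlocks 1 !![((x : ℕ) : ℚ) / p, 0; 0, 0] 0 1 := rfl

theorem paramodularRep_mem (i : Option (Fin p)) : paramodularRep p i ∈ paramodular p := by
  have hp : (p : ℚ) ≠ 0 := Nat.cast_ne_zero.2 (NeZero.ne p)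
  rcases i with _ | x
  · intro i j
    rw [coe_paramodularRep_none]
    rcases i with i | i <;> rcases j with j | j <;> fin_cases i <;> fin_cases j <;>
      simp [paramodularPattern, hp] <;>
      first
        | (refine ⟨0, ?_⟩; simp; done)
        | (refine ⟨1, ?_⟩; simp; done)
        | (refine ⟨-1, ?_⟩; simp)
  · intro i j
    rw [coe_paramodularRep_some]
    rcases i with i | i <;> rcases j with j | j <;> fin_cases i <;> fin_cases j <;>
      simp [paramodularPattern, hp] <;>
      first
        | (refine ⟨0, ?_⟩; simp; done)
        | (refine ⟨1, ?_⟩; simp; done)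
        | (refine ⟨(x : ℕ), ?_⟩; simp [div_eq_mul_inv])

/-- The representatives realize the points `(0 : 1)` and `(1 : x)` of `ℙ¹(𝔽_p)`, each point once. -/
theorem isCosetReps_paramodular (hp : p.Prime) :
    IsCosetReps (gamma0' p) (paramodular p) (paramodularRep p) := by
  have h1 : ∀ x : Fin p, ((paramodularRep p (some x) : Sp2Q) : Matrix Idx Idx ℚ) (Sum.inl 0) (Sum.inl 0) =
      ((1 : ℤ) : ℚ) := fun x => by rw [coe_paramodularRep_some]; simp
  have h2 : ∀ x : Fin p, ((paramodularRep p (some x) : Sp2Q) : Matrix Idx Idx ℚ) (Sum.inl 0) (Sum.inr 0) =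
      (((x : ℕ) : ℤ) : ℚ) / p := fun x => by rw [coe_paramodularRep_some]; simp
  have h3 : ((paramodularRep p none : Sp2Q) : Matrix Idx Idx ℚ) (Sum.inl 0) (Sum.inl 0) = ((0 : ℤ) : ℚ) := by
    rw [coe_paramodularRep_none]; simp
  have h4 : ((paramodularRep p none : Sp2Q) : Matrix Idx Idx ℚ) (Sum.inl 0) (Sum.inr 0) =
      ((1 : ℤ) : ℚ) / p := by
    rw [coe_paramodularRep_none]; simp
  have hp1 : ¬ (p : ℤ) ∣ 1 := fun h =>
    (Nat.prime_iff_prime_int.1 hp).not_isUnit (isUnit_of_dvd_one h)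
  refine ⟨paramodularRep_mem, fun g hg => ?_, ?_⟩
  · obtain ⟨a, ha⟩ := hg (Sum.inl 0) (Sum.inl 0)
    obtain ⟨b, hb⟩ := hg (Sum.inl 0) (Sum.inr 0)
    simp [paramodularPattern] at ha hb
    rw [← div_eq_mul_inv] at hb
    by_cases hpa : (p : ℤ) ∣ a
    · exact ⟨none, (mul_inv_mem_gamma0'_iff hg (paramodularRep_mem _) ha hb h3 h4).2 (by simpa using hpa)⟩
    · obtain ⟨x, hx⟩ := exists_fin_dvd hp b hpa
      exact ⟨some x, (mul_inv_mem_gamma0'_iff hg (paramodularRep_mem _) ha hb (h1 x) (h2 x)).2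
        (by simpa using hx)⟩
  · rintro (_ | x) (_ | y) h
    · rfl
    · rw [mul_inv_mem_gamma0'_iff (paramodularRep_mem _) (paramodularRep_mem _) h3 h4 (h1 y) (h2 y)] at h
      exact (hp1 (by simpa using h)).elim
    · rw [mul_inv_mem_gamma0'_iff (paramodularRep_mem _) (paramodularRep_mem _) (h1 x) (h2 x) h3 h4] at h
      exact (hp1 (by simpa using h)).elim
    · rw [mul_inv_mem_gamma0'_iff (paramodularRep_mem _) (paramodularRep_mem _) (h1 x) (h2 x) (h1 y) (h2 y)] at h
      rw [fin_eq_of_dvd (p := p) (x := x) (y := y) (by convert h using 1; ring)]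

end Reps

end

/-! ### Character sums, column functions and the trace as a theta series. -/

noncomputable section

variable {n : Type*} [Fintype n] {Q : Matrix n n ℤ}

theorem ratExp_zero : ratExp 0 = 1 := by simpa using ratExp_int 0

theorem ratExp_eq_one_iff {t : ℚ} : ratExp t = 1 ↔ ∃ m : ℤ, t = m := by
  refine ⟨fun h => ?_, fun ⟨m, hm⟩ => by rw [hm, ratExp_int]⟩
  rw [ratExp, Complex.exp_eq_one_iff] at h
  obtain ⟨m, hm⟩ := h
  refine ⟨m, ?_⟩
  rw [mul_comm (m : ℂ)] at hm
  have := mul_left_cancel₀ Complex.two_pi_I_ne_zero hm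
  exact_mod_cast this

theorem ratExp_nat_mul (k : ℕ) (t : ℚ) : ratExp (k * t) = ratExp t ^ k := by
  rw [ratExp, ratExp, ← Complex.exp_nat_mul]
  push_cast
  congr 1
  ring

open scoped Classical in
-- A geometric series in a `p`-th root of unity. It turns a sum over coset representatives into an
-- integrality condition on `q`.
theorem sum_ratExp {p : ℕ} {t : ℚ} (ht : ∃ m : ℤ, p * t = m) :
    ∑ x : Fin p, ratExp ((x : ℕ) * t) = if ∃ m : ℤ, t = m then (p : ℂ) else 0 := by
  simp_rw [ratExp_nat_mul]
  split_ifs with h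
  · rw [ratExp_eq_one_iff.2 h]
    simp
  · have h1 : ratExp t ≠ 1 := mt ratExp_eq_one_iff.1 h
    obtain ⟨m, hm⟩ := ht
    rw [Fin.sum_univ_eq_sum_range fun x => ratExp t ^ x, geom_sum_eq h1, ← ratExp_nat_mul, hm,
      ratExp_int, sub_self, zero_div]

section Cols

variable {m : Type*}

theorem IsSchwartzCol.add {M R : ℕ} {f g : (m → ℚ) → ℂ} (hf : IsSchwartzCol M R f)
    (hg : IsSchwartzCol M R g) : IsSchwartzCol M R fun x => f x + g x where
  supp := fun x hx => by
    by_cases h : f x = 0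
    · exact hg.supp x (by simpa [h] using hx)
    · exact hf.supp x h
  per := fun x v => by rw [hf.per, hg.per]
  bdd := by
    obtain ⟨C, hC⟩ := hf.bdd
    obtain ⟨C', hC'⟩ := hg.bdd
    exact ⟨C + C', fun x => (norm_add_le _ _).trans (add_le_add (hC x) (hC' x))⟩

theorem IsSchwartzCol.const_mul {M R : ℕ} {f : (m → ℚ) → ℂ} (hf : IsSchwartzCol M R f) (c : ℂ) :
    IsSchwartzCol M R fun x => c * f x where
  supp := fun x hx => hf.supp x (right_ne_zero_of_mul hx)
  per := fun x v => by rw [hf.per]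
  bdd := by
    obtain ⟨C, hC⟩ := hf.bdd
    exact ⟨‖c‖ * C, fun x => by rw [norm_mul]; gcongr; exact hC x⟩

theorem IsSchwartzCol.of_supp {M R M' : ℕ} {f : (m → ℚ) → ℂ} (hf : IsSchwartzCol M R f) (hM : 0 < M)
    (hM' : 0 < M') (h : M ∣ M') : IsSchwartzCol M' R f where
  supp := fun x hx i => by
    obtain ⟨k, rfl⟩ := h
    obtain ⟨t, ht⟩ := hf.supp x hx i
    have hk : (k : ℚ) ≠ 0 := by
      rintro h
      rw [Nat.cast_eq_zero] at h
      simp [h] at hM'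
    refine ⟨t * k, ?_⟩
    rw [ht]
    push_cast
    field_simp
  per := hf.per
  bdd := hf.bdd

theorem IsSchwartzCol.isSchwartz {M R M' R' : ℕ} {f g : (m → ℚ) → ℂ} (hf : IsSchwartzCol M R f)
    (hg : IsSchwartzCol M' R' g) (hM : 0 < M) (hM' : 0 < M') (hR : 0 < R) (hR' : 0 < R') :
    IsSchwartz (colProd f g) where
  toLatticeBdd := hf.latticeBdd hg hM hM'
  per := ⟨R * R', by positivity, fun N V => by
    rw [colProd, colProd]
    congr 1
    · refine Eq.trans ?_ (hf.per (N.col 0) fun i => R' * V i 0)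
      congr 1
      ext i
      simp
      ring
    · refine Eq.trans ?_ (hg.per (N.col 1) fun i => R * V i 1)
      congr 1
      ext i
      simp
      ring⟩

end Cols

theorem thetaSum_sum [DecidableEq n] {ι : Type*} (hpos : (Q.map (Int.cast : ℤ → ℝ)).PosDef) (s : Finset ι)
    {φ : ι → Matrix n (Fin 2) ℚ → ℂ} (hφ : ∀ i ∈ s, LatticeBdd (φ i))
    {Ω : Matrix (Fin 2) (Fin 2) ℂ} (hΩ : Ω ∈ siegelHalfSpace) :
    ∑ i ∈ s, thetaSum Q (φ i) Ω = thetaSum Q (fun N => ∑ i ∈ s, φ i N) Ω := by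
  have h := hasSum_sum fun i hi => (hφ i hi).hasSum hpos hΩ
  rw [← h.tsum_eq, thetaSum]
  exact tsum_congr fun N => (Finset.sum_mul _ _ _).symm

theorem theta_eq_latticeTheta (Ω : Matrix (Fin 2) (Fin 2) ℂ) : theta Q Ω = latticeTheta Q Ω := by
  have hinj : Function.Injective fun V : Matrix n (Fin 2) ℤ => V.map (Int.cast : ℤ → ℚ) :=
    Matrix.map_injective Int.cast_injective
  rw [latticeTheta, thetaSum, ← hinj.tsum_eq]
  · rw [theta]
    refine tsum_congr fun N => ?_
    rw [colProd_ind_eq_one, one_mul, thetaTerm]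
    congr 1
    have : (gramMat Q (N.map (Int.cast : ℤ → ℚ))).map (Rat.cast : ℚ → ℂ) =
        (Nᵀ * Q * N).map (Int.cast : ℤ → ℂ) := by
      ext i j; simp [gramMat, Matrix.mul_apply]
    rw [this]
    ring
  · intro N hN
    obtain ⟨V, rfl⟩ := exists_of_colProd_ind_ne_zero (left_ne_zero_of_mul hN)
    exact ⟨V, rfl⟩

/-! ## The trace of the theta series -/

open scoped Classical in
/-- The first factor of the function whose theta series is the trace. -/
def trFst (p : ℕ) (Q : Matrix n n ℤ) (x : n → ℚ) : ℂ :=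
  (if x ∈ intLattice n ∧ ∃ m : ℤ, quad Q x = p * m then 1 else 0) +
    p * ind (dualLattice Q) ((p : ℚ)⁻¹ • x)

open scoped Classical in
/-- The second factor of the function whose theta series is the trace. -/
def trSnd (p : ℕ) (Q : Matrix n n ℤ) (y : n → ℚ) : ℂ :=
  p * ind (intLattice n) y + if y ∈ dualLattice Q ∧ ∃ m : ℤ, quad Q y = m then 1 else 0

variable [DecidableEq n] {p : ℕ}

theorem quad_add_int (hQ : IsEvenForm Q) {y v : n → ℚ} (hy : y ∈ dualLattice Q) (hv : v ∈ intLattice n) :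
    ∃ m : ℤ, quad Q (y + v) = quad Q y + m := by
  obtain ⟨m₁, h₁⟩ := quad_int hQ hv
  obtain ⟨m₂, h₂⟩ := bil_int_dual hv hy
  refine ⟨m₁ + m₂, ?_⟩
  rw [quad_add hQ.1, h₁, bil_comm hQ.1, h₂]
  push_cast
  ring

theorem isSchwartzCol_dual (hQ : IsLevelForm p Q) (hp : 0 < p) {F : ℚ → ℂ}
    (hF : ∀ (t : ℚ) (m : ℤ), F (t + m) = F t) (hb : ∃ C, ∀ t, ‖F t‖ ≤ C) :
    IsSchwartzCol p 1 fun y => ind (dualLattice Q) y * F (quad Q y) where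
  supp := fun x hx i => by
    by_cases h : x ∈ dualLattice Q
    · obtain ⟨v, hv⟩ := hQ.smul_dual x h
      refine ⟨v i, ?_⟩
      have := congrFun hv i
      simp only [Pi.smul_apply, smul_eq_mul] at this
      have hd' : (p : ℚ) ≠ 0 := by positivity
      field_simp
      linarith
    · exact (left_ne_zero_of_mul hx (ind_of_notMem h)).elim
  per := fun x v => by
    have hv : (fun i => (v i : ℚ)) ∈ intLattice n := ⟨v, rfl⟩
    have hx : (fun i => x i + ((1 : ℕ) : ℚ) * v i) = x + fun i => (v i : ℚ) := by ext i; simp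
    rw [hx]
    by_cases h : x ∈ dualLattice Q
    · obtain ⟨m, hm⟩ := quad_add_int hQ.even h hv
      rw [ind_of_mem h, ind_of_mem (add_mem h (intLattice_le_dualLattice hv)), hm, hF]
    · rw [ind_of_notMem h, ind_of_notMem (by
        rwa [(dualLattice Q).add_mem_cancel_right (intLattice_le_dualLattice hv)]), zero_mul, zero_mul]
  bdd := by
    obtain ⟨C, hC⟩ := hb
    refine ⟨C, fun x => ?_⟩
    by_cases h : x ∈ dualLattice Q
    · rw [ind_of_mem h, one_mul]; exact hC _
    · rw [ind_of_notMem h, zero_mul, norm_zero]; exact (norm_nonneg _).trans (hC 0)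

theorem isSchwartzCol_trSnd (hQ : IsLevelForm p Q) (hp : 0 < p) :
    IsSchwartzCol p 1 (trSnd p Q) := by
  classical
  have h1 : IsSchwartzCol p 1 (ind (intLattice n)) :=
    isSchwartzCol_ind_int.of_supp one_pos hp (one_dvd _)
  have h2 : IsSchwartzCol p 1 fun y => ind (dualLattice Q) y *
      (fun t : ℚ => if ∃ m : ℤ, t = m then (1 : ℂ) else 0) (quad Q y) := by
    refine isSchwartzCol_dual hQ hp (F := fun t : ℚ => if ∃ m : ℤ, t = m then (1 : ℂ) else 0)
      (fun t m => ?_) ⟨1, fun t => ?_⟩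
    · have : (∃ k : ℤ, t + m = k) ↔ ∃ k : ℤ, t = k :=
        ⟨fun ⟨k, hk⟩ => ⟨k - m, by push_cast; linarith⟩, fun ⟨k, hk⟩ => ⟨k + m, by push_cast; linarith⟩⟩
      simp only [this]
    · split_ifs <;> simp
  convert (h1.const_mul p).add h2 using 2 with y
  rw [trSnd]
  congr 1
  by_cases h : y ∈ dualLattice Q
  · simp [ind_of_mem h, h]
  · simp [ind_of_notMem h, h]

theorem isSchwartzCol_smul_dual (hQ : IsLevelForm p Q) (hp : 0 < p) :
    IsSchwartzCol 1 p fun x : n → ℚ => ind (dualLattice Q) ((p : ℚ)⁻¹ • x) := by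
  have hp' : (p : ℚ) ≠ 0 := by positivity
  refine ⟨fun x h i => ?_, fun x v => ?_, 1, fun x => ?_⟩
  · by_cases hx : (p : ℚ)⁻¹ • x ∈ dualLattice Q
    · have := hQ.smul_dual _ hx
      rw [smul_inv_smul₀ hp'] at this
      obtain ⟨v, rfl⟩ := this
      exact ⟨v i, by simp⟩
    · exact (h (ind_of_notMem hx)).elim
  · have hx : (fun i => x i + (p : ℚ) * v i) = x + (p : ℚ) • fun i => (v i : ℚ) := by ext i; simp
    rw [hx, smul_add, inv_smul_smul₀ hp']
    have hD : (fun i => (v i : ℚ)) ∈ dualLattice Q := intLattice_le_dualLattice ⟨v, rfl⟩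
    by_cases h : (p : ℚ)⁻¹ • x ∈ dualLattice Q
    · rw [ind_of_mem h, ind_of_mem (add_mem h hD)]
    · rw [ind_of_notMem h, ind_of_notMem (by rwa [(dualLattice Q).add_mem_cancel_right hD])]
  · by_cases h : (p : ℚ)⁻¹ • x ∈ dualLattice Q
    · simp [ind_of_mem h]
    · simp [ind_of_notMem h]

theorem isSchwartzCol_trFst (hQ : IsLevelForm p Q) (hp : 0 < p) :
    IsSchwartzCol 1 p (trFst p Q) := by
  classical
  have hp' : (p : ℚ) ≠ 0 := by positivity
  have hmem : ∀ v : n → ℤ, (fun i => (v i : ℚ)) ∈ intLattice n := fun v => ⟨v, rfl⟩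
  have hx : ∀ (x : n → ℚ) (v : n → ℤ),
      (fun i => x i + (p : ℚ) * v i) = x + (p : ℚ) • fun i => (v i : ℚ) := by
    intro x v; ext i; simp
  have hpmem : ∀ v : n → ℤ, (p : ℚ) • (fun i => (v i : ℚ)) ∈ intLattice n :=
    fun v => ⟨(p : ℤ) • v, by ext i; simp⟩
  have h1 : IsSchwartzCol 1 p fun x : n → ℚ =>
      if x ∈ intLattice n ∧ ∃ m : ℤ, quad Q x = p * m then (1 : ℂ) else 0 := by
    refine ⟨fun x h i => ?_, fun x v => ?_, 1, fun x => by split_ifs <;> simp⟩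
    · by_cases hx : x ∈ intLattice n
      · obtain ⟨v, rfl⟩ := hx
        exact ⟨v i, by simp⟩
      · simp [hx] at h
    · rw [hx]
      refine if_congr ?_ rfl rfl
      rw [(intLattice n).add_mem_cancel_right (hpmem v)]
      refine and_congr_right fun h => ?_
      obtain ⟨m₁, h₁⟩ := bil_int_dual (Q := Q) h (intLattice_le_dualLattice (hmem v))
      obtain ⟨m₂, h₂⟩ := quad_int hQ.even (hmem v)
      rw [quad_add hQ.even.1, quad_smul, bil_smul_right, h₁, h₂]
      exact ⟨fun ⟨m, hm⟩ => ⟨m - p * m₂ - m₁, by push_cast; linarith⟩,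
        fun ⟨m, hm⟩ => ⟨m + p * m₂ + m₁, by push_cast; linarith⟩⟩
  exact h1.add ((isSchwartzCol_smul_dual hQ hp).const_mul p)

variable [NeZero p]

theorem iwahori_le_slashStabilizer (hQ : IsLevelForm p Q) (hp : p.Prime) :
    iwahori p ≤ slashStabilizer 4 (theta Q) := by
  intro g hg
  have hΓ := iwahori_le hg
  have h : g ∈ slashStabilizer 4 (latticeTheta Q) := by
    refine mem_slashStabilizer_latticeTheta hQ hp hΓ.2 fun i j => ?_
    obtain ⟨m, hm⟩ := hg (Sum.inr i) (Sum.inl j)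
    refine ⟨m, ?_⟩
    rw [hm]
    fin_cases i <;> fin_cases j <;> simp [iwahoriPattern, mul_comm]
  rwa [show theta Q = latticeTheta Q from funext theta_eq_latticeTheta]

/-- The first step of the trace. -/
theorem heckeOperator_iwahori (hQ : IsLevelForm p Q) (hp : p.Prime) {Ω : Matrix (Fin 2) (Fin 2) ℂ}
    (hΩ : Ω ∈ siegelHalfSpace) : heckeOperator 4 (iwahori p) 1 (gamma0' p) (theta Q) Ω =
      thetaSum Q (colProd (ind (intLattice n)) fun y => (p : ℂ)⁻¹ * trSnd p Q y) Ω := by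
  classical
  have hp0 : (p : ℂ) ≠ 0 := Nat.cast_ne_zero.2 hp.ne_zero
  rw [heckeOperator_eq_sum (isCosetReps_iwahori hp) (iwahori_le_slashStabilizer hQ hp) hΩ]
  -- The identity contributes `1_L`. The inversion followed by translation by `x` contributes `p⁻²
  -- 1_{L^#} e(x q)`, and the sum over `x` detects `q ∈ ℤ`.
  let h : Option (Fin p) → (n → ℚ) → ℂ := fun i => i.elim (ind (intLattice n)) fun x y =>
    ((p : ℂ) ^ 2)⁻¹ * (ind (dualLattice Q) y * ratExp ((x : ℕ) * quad Q y))
  have hcol : ∀ i, IsSchwartzCol p 1 (h i) := by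
    rintro (_ | x)
    · exact isSchwartzCol_ind_int.of_supp one_pos hp.pos (one_dvd _)
    · refine (isSchwartzCol_dual hQ hp.pos (F := fun t => ratExp ((x : ℕ) * t)) (fun t m => ?_)
        ⟨1, fun t => (norm_ratExp _).le⟩).const_mul _
      exact ratExp_eq_of_sub ⟨(x : ℕ) * m, by push_cast; ring⟩
  have hterm : ∀ i, slash 4 (theta Q) (iwahoriRep p i) Ω =
      thetaSum Q (colProd (ind (intLattice n)) (h i)) Ω := by
    rw [show theta Q = latticeTheta Q from funext theta_eq_latticeTheta]
    rintro (_ | x)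
    · exact slash_one _ _ _
    · rw [iwahoriRep, slash_mul _ _ _ _ hΩ,
        slash_congr 4 (fun Ω hΩ => latticeTheta_slash_inversion hQ hΩ) _ hΩ, slash_upper_colProd]
      congr 2
      · ext y
        simp [ratExp_zero]
      · ext y
        exact mul_assoc _ _ _
  rw [Finset.sum_congr rfl fun i _ => hterm i,
    thetaSum_sum hQ.pos _ (fun i _ => isSchwartzCol_ind_int.latticeBdd (hcol i) one_pos hp.pos) hΩ]
  congr 1
  ext N
  simp only [colProd]
  rw [← Finset.mul_sum]
  congr 1
  set y := N.col 1
  rw [Fintype.sum_option]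
  simp only [h, Option.elim]
  rw [← Finset.mul_sum, ← Finset.mul_sum, trSnd]
  by_cases hy : y ∈ dualLattice Q
  · rw [ind_of_mem hy, sum_ratExp (hQ.quad_dual y hy)]
    simp only [hy, true_and]
    split_ifs <;> field_simp <;> ring
  · have hy' : y ∉ intLattice n := fun h' => hy (intLattice_le_dualLattice h')
    simp [ind_of_notMem hy, ind_of_notMem hy', hy]

/-- The trace of the theta series is a theta series. -/
theorem paramodularTrace_eq (hQ : IsLevelForm p Q) (hp : p.Prime) {Ω : Matrix (Fin 2) (Fin 2) ℂ}
    (hΩ : Ω ∈ siegelHalfSpace) : paramodularTrace 4 p (theta Q) Ω =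
      thetaSum Q (colProd (trFst p Q) (trSnd p Q)) Ω := by
  classical
  have hp0 : (p : ℂ) ≠ 0 := Nat.cast_ne_zero.2 hp.ne_zero
  have hpq : (p : ℚ) ≠ 0 := Nat.cast_ne_zero.2 hp.ne_zero
  have hsnd : IsSchwartzCol p 1 fun y => (p : ℂ)⁻¹ * trSnd p Q y :=
    (isSchwartzCol_trSnd hQ hp.pos).const_mul _
  rw [paramodularTrace, heckeOperator_eq_sum (isCosetReps_paramodular hp)
    (le_slashStabilizer_heckeOperator (isCosetReps_iwahori hp) (iwahori_le_slashStabilizer hQ hp)) hΩ]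
  -- The inversion in the first variable gives `p⁻² 1_{L^#}`, and scaling by `p` in weight four
  -- multiplies it by `p⁴`, whence `p²`. The translations by `x / p` only twist `1_L`.
  let h : Option (Fin p) → (n → ℚ) → ℂ := fun i => i.elim
    (fun x => (p : ℂ) ^ 2 * ind (dualLattice Q) ((p : ℚ)⁻¹ • x)) fun x y =>
      ind (intLattice n) y * ratExp (((x : ℕ) : ℚ) / p * quad Q y)
  have hcol : ∀ i, LatticeBdd (colProd (h i) fun y => (p : ℂ)⁻¹ * trSnd p Q y) := by
    rintro (_ | x)
    · exact ((isSchwartzCol_smul_dual hQ hp.pos).const_mul _).latticeBdd hsnd one_pos hp.pos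
    · convert (isSchwartzCol_ind_int.latticeBdd hsnd one_pos hp.pos).mul_unit
        (χ := fun N => ratExp (((x : ℕ) : ℚ) / p * quad Q (N.col 0))) (fun N => norm_ratExp _) using 2
      simp only [h, Option.elim, colProd]
      ring
  have hterm : ∀ i, slash 4 (heckeOperator 4 (iwahori p) 1 (gamma0' p) (theta Q)) (paramodularRep p i) Ω =
      thetaSum Q (colProd (h i) fun y => (p : ℂ)⁻¹ * trSnd p Q y) Ω := by
    intro i
    rw [slash_congr 4 (fun Ω hΩ => heckeOperator_iwahori hQ hp hΩ) _ hΩ]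
    have hswap : ∀ (f g : (n → ℚ) → ℂ) (Ω : Matrix (Fin 2) (Fin 2) ℂ),
        slash 4 (thetaSum Q (colProd f g)) (leviZ swapGL) Ω = thetaSum Q (colProd g f) Ω :=
      fun f g Ω => slash_swap_colProd f g rfl rfl Ω
    rcases i with _ | x
    · have e1 : ∀ Ω ∈ siegelHalfSpace, slash 4 (thetaSum Q (colProd (ind (intLattice n))
          fun y => (p : ℂ)⁻¹ * trSnd p Q y)) (leviZ swapGL * Sp2Q.inversion) Ω =
          thetaSum Q (colProd (fun y => (p : ℂ)⁻¹ * trSnd p Q y)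
            fun y => ((p : ℂ) ^ 2)⁻¹ * ind (dualLattice Q) y) Ω := by
        intro Ω hΩ
        rw [slash_mul _ _ _ _ hΩ, slash_congr 4 (fun Ω _ => hswap _ _ Ω) _ hΩ,
          slash_inversion_colProd hQ.even.1 hQ.pos hQ.card hp.pos one_pos one_pos hsnd
          isSchwartzCol_ind_int hΩ, latticeFourier_ind_int hQ]
      have e2 : ∀ Ω ∈ siegelHalfSpace, slash 4 (thetaSum Q (colProd (ind (intLattice n))
          fun y => (p : ℂ)⁻¹ * trSnd p Q y)) (leviZ swapGL * Sp2Q.inversion * leviZ swapGL) Ω =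
          thetaSum Q (colProd (fun y => ((p : ℂ) ^ 2)⁻¹ * ind (dualLattice Q) y)
            (fun y => (p : ℂ)⁻¹ * trSnd p Q y)) Ω := by
        intro Ω hΩ
        rw [slash_mul _ _ _ _ hΩ, slash_congr 4 e1 _ hΩ, hswap]
      rw [paramodularRep, slash_mul _ _ _ _ hΩ, slash_congr 4 e2 _ hΩ, slash_levi_colProd]
      congr 2
      · ext x
        simp only [h, Option.elim]
        push_cast
        rw [← mul_assoc]
        congr 1
        rw [zpow_ofNat]
        field_simp
      · ext x
        simp
    · rw [paramodularRep, slash_upper_colProd]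
      congr 2
      ext y
      simp [ratExp_zero]
  rw [Finset.sum_congr rfl fun i _ => hterm i, thetaSum_sum hQ.pos _ (fun i _ => hcol i) hΩ]
  congr 1
  ext N
  simp only [colProd]
  rw [← Finset.sum_mul, ← mul_assoc]
  congr 1
  set x := N.col 0
  rw [Fintype.sum_option]
  simp only [h, Option.elim]
  rw [← Finset.mul_sum, trFst]
  by_cases hx : x ∈ intLattice n
  · obtain ⟨k, hk⟩ := quad_int hQ.even hx
    -- On `L` the form `q` is integral, so summing the twists by `x / p` detects `p ∣ q`.
    have hs : ∑ i : Fin p, ratExp (((i : ℕ) : ℚ) / p * quad Q x) =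
        if ∃ m : ℤ, quad Q x = p * m then (p : ℂ) else 0 := by
      have := sum_ratExp (p := p) (t := quad Q x / p) ⟨k, by rw [hk]; field_simp⟩
      rw [Finset.sum_congr rfl fun (i : Fin p) _ => (by congr 1; ring :
        ratExp (((i : ℕ) : ℚ) / p * quad Q x) = ratExp ((i : ℕ) * (quad Q x / p))), this]
      refine if_congr (exists_congr fun m => ?_) rfl rfl
      rw [div_eq_iff hpq, mul_comm]
    rw [hs, ind_of_mem hx]
    simp only [hx, true_and]
    split_ifs <;>
      (field_simp; ring)
  · rw [ind_of_notMem hx]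
    simp only [hx, false_and, if_false]
    field_simp
    ring

end

/-! ### Modularity of the trace. -/

noncomputable section

variable {n : Type*} [Fintype n] [DecidableEq n] {Q : Matrix n n ℤ} {p : ℕ} [NeZero p]

/-- The trace of the theta series is a Siegel modular form for the paramodular group. -/
theorem isSiegelModularForm_paramodularTrace (hQ : IsLevelForm p Q) (hp : p.Prime) :
    IsSiegelModularForm 4 (paramodular p) (paramodularTrace 4 p (theta Q)) where
  holo := by
    have h := ((isSchwartzCol_trFst hQ hp.pos).latticeBdd (isSchwartzCol_trSnd hQ hp.pos) one_pos
      hp.pos).differentiableOn hQ.pos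
    exact h.congr fun x hx => paramodularTrace_eq hQ hp hx
  slash_eq := fun γ hγ => le_slashStabilizer_heckeOperator (isCosetReps_paramodular hp)
    (le_slashStabilizer_heckeOperator (isCosetReps_iwahori hp) (iwahori_le_slashStabilizer hQ hp)) hγ
  bdd := by
    intro Y hY γ hγ
    obtain ⟨φ, hφ, he⟩ := sp2Z_le_schwartzGroup hQ.even.1 hQ.pos hQ.card hγ γ (by simp) _
      ((isSchwartzCol_trFst hQ hp.pos).isSchwartz (isSchwartzCol_trSnd hQ hp.pos) one_pos hp.pos
        hp.pos one_pos)
    obtain ⟨C, hC⟩ := hφ.toLatticeBdd.bounded hQ.pos hY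
    refine ⟨C, fun Ω hΩ hYΩ => ?_⟩
    rw [slash_congr 4 (fun Ω hΩ => paramodularTrace_eq hQ hp hΩ) γ hΩ, he Ω hΩ]
    exact hC Ω hΩ hYΩ

end

noncomputable section

/-! ## Uniqueness of Fourier coefficients -/

/-- The point `x = 0` gives absolute summability, so the series converges uniformly on the torus,
with sum zero. The inner product with one character is continuous and isolates its coefficient. -/
theorem fourier_coeff_eq_zero {ι d : Type*} [Fintype d] {k : ι → d → ℤ} (hk : Function.Injective k)
    {c : ι → ℂ} (h : ∀ x : d → ℝ, HasSum (fun i => c i *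
      Complex.exp (2 * Real.pi * Complex.I * ∑ j, (k i j : ℂ) * x j)) 0) (i : ι) : c i = 0 := by
  classical
  have hsum : Summable fun i => ‖c i‖ := by
    have := (h 0).summable.norm
    simpa using this
  have hC : Summable fun i => c i • UnitAddTorus.mFourier (k i) :=
    Summable.of_norm (by simpa [norm_smul, UnitAddTorus.mFourier_norm] using hsum)
  have hzero : HasSum (fun i => c i • UnitAddTorus.mFourier (k i)) 0 := by
    have hs := hC.hasSum
    convert hs using 1
    ext x
    have hx : ∃ v : d → ℝ, x = fun j => (v j : UnitAddCircle) := by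
      choose v hv using fun j => QuotientAddGroup.mk_surjective (x j)
      exact ⟨v, funext fun j => (hv j).symm⟩
    obtain ⟨v, rfl⟩ := hx
    have h1 := hs.map (ContinuousMap.evalCLM ℂ fun j => (v j : UnitAddCircle))
      (ContinuousLinearMap.continuous _)
    have h2 : HasSum (fun i => c i * Complex.exp (2 * Real.pi * Complex.I * ∑ j, (k i j : ℂ) * v j))
        ((∑' i, c i • UnitAddTorus.mFourier (k i)) fun j => (v j : UnitAddCircle)) := by
      refine h1.congr_fun fun i => ?_
      change _ = c i * UnitAddTorus.mFourier (k i) _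
      rw [mFourier_coe]
    exact (h v).unique h2
  let μ : MeasureTheory.Measure (UnitAddTorus d) :=
    MeasureTheory.Measure.pi fun _ => (AddCircle.haarAddCircle : MeasureTheory.Measure UnitAddCircle)
  let e (m : d → ℤ) : MeasureTheory.Lp ℂ 2 μ := ContinuousMap.toLp 2 μ ℂ (UnitAddTorus.mFourier m)
  let L : C(UnitAddTorus d, ℂ) →L[ℂ] ℂ := (innerSL ℂ (e (k i))).comp (ContinuousMap.toLp 2 μ ℂ)
  have hin := hzero.mapL L
  have hon : ∀ a b, inner ℂ (e a) (e b) = if a = b then (1 : ℂ) else 0 :=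
    orthonormal_iff_ite.1 (UnitAddTorus.orthonormal_mFourier (d := d))
  have hval : ∀ j, L (c j • UnitAddTorus.mFourier (k j)) = if j = i then c i else 0 := by
    intro j
    rw [map_smul]
    change c j • inner ℂ (e (k i)) (e (k j)) = _
    rw [hon]
    by_cases hij : j = i
    · subst hij; simp
    · have hne : k i ≠ k j := fun h => hij (hk h).symm
      simp [hij, hne]
  rw [map_zero] at hin
  exact ((hasSum_ite_eq i (c i)).congr_fun fun j => (hval j)).unique hin |>.symm ▸ rfl

theorem paramodularIndices_int {N : ℕ} (T : paramodularIndices N) :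
    ∃ k : Fin 3 → ℤ, (T.1 0 0 = k 0 ∧ 2 * T.1 0 1 = k 1) ∧ T.1 1 1 = k 2 := by
  obtain ⟨hs, -, hT⟩ := T.2.1
  have hsym : T.1 1 0 = T.1 0 1 := congrFun (congrFun hs 0) 1
  obtain ⟨a, ha⟩ := hT ![1, 0]
  obtain ⟨b, hb⟩ := hT ![0, 1]
  obtain ⟨c, hc⟩ := hT ![1, 1]
  simp [dotProduct, mulVec, Fin.sum_univ_two] at ha hb hc
  refine ⟨![a, c - a - b, b], ⟨ha, ?_⟩, hb⟩
  simp
  rw [hsym] at hc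
  linarith

/-- The Fourier coefficients are determined by the function. -/
theorem IsFourierExpansion.unique {N : ℕ} {f : Matrix (Fin 2) (Fin 2) ℂ → ℂ}
    {a b : paramodularIndices N → ℂ} (ha : IsFourierExpansion N f a) (hb : IsFourierExpansion N f b) :
    a = b := by
  choose k hk using paramodularIndices_int (N := N)
  have hinj : Function.Injective k := by
    intro T S hTS
    have hT := hk T
    have hS := hk S
    rw [hTS] at hT
    have h00 : T.1 0 0 = S.1 0 0 := by rw [hT.1.1, hS.1.1]
    have h01 : T.1 0 1 = S.1 0 1 := by linarith [hT.1.2, hS.1.2]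
    have h11 : T.1 1 1 = S.1 1 1 := by rw [hT.2, hS.2]
    have hTs : T.1 1 0 = T.1 0 1 := congrFun (congrFun T.2.1.1 0) 1
    have hSs : S.1 1 0 = S.1 0 1 := congrFun (congrFun S.2.1.1 0) 1
    apply Subtype.ext
    ext i j
    fin_cases i <;> fin_cases j
    · exact h00
    · exact h01
    · exact (hTs.trans h01).trans hSs.symm
    · exact h11
  -- The factor `exp(-2π tr T)` from restricting to `Im Ω = 1`. It never vanishes, so it can be
  -- removed from the vanishing coefficients.
  let w : paramodularIndices N → ℂ := fun T =>
    Complex.exp (2 * Real.pi * Complex.I * (Complex.I * (k T 0 + k T 2)))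
  have key : ∀ T, (a T - b T) * w T = 0 := by
    refine fourier_coeff_eq_zero hinj fun x => ?_
    have hΩ : (!![(x 0 : ℂ) + Complex.I, x 1; x 1, x 2 + Complex.I]) ∈ siegelHalfSpace := by
      constructor
      · ext i j; fin_cases i <;> fin_cases j <;> simp
      · have : (!![(x 0 : ℂ) + Complex.I, x 1; x 1, x 2 + Complex.I]).map Complex.im = 1 := by
          ext i j; fin_cases i <;> fin_cases j <;> simp
        rw [this]
        exact PosDef.one
    have h := (ha _ hΩ).sub (hb _ hΩ)
    rw [sub_self] at h
    refine h.congr_fun fun T => ?_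
    rw [← sub_mul, mul_assoc, ← Complex.exp_add]
    congr 2
    have hT := hk T
    have hs : T.1 1 0 = T.1 0 1 := congrFun (congrFun T.2.1.1 0) 1
    have h0 : (T.1 0 0 : ℂ) = k T 0 := by exact_mod_cast congrArg (Rat.cast : ℚ → ℂ) hT.1.1
    have h1 : 2 * (T.1 0 1 : ℂ) = k T 1 := by exact_mod_cast congrArg (Rat.cast : ℚ → ℂ) hT.1.2
    have h2 : (T.1 1 1 : ℂ) = k T 2 := by exact_mod_cast congrArg (Rat.cast : ℚ → ℂ) hT.2
    simp [trace_fin_two, Matrix.mul_apply, Fin.sum_univ_two, Fin.sum_univ_three, hs, h0, h2, ← h1]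
    ring
  ext T
  have := key T
  rwa [mul_eq_zero_iff_right (Complex.exp_ne_zero _), sub_eq_zero] at this

/-! ## Fourier expansion of the trace -/

variable {n : Type*} [Fintype n] [DecidableEq n] {Q : Matrix n n ℤ} {p : ℕ}

/-- If `x ∈ pL^#` then `x ∈ L` and `q(x) = p · (p q(x/p))` lies in `pℤ`, so the second term lives
inside the set of the first. -/
theorem trFst_supp (hQ : IsLevelForm p Q) (hp : 0 < p) {x : n → ℚ} (h : trFst p Q x ≠ 0) :
    x ∈ intLattice n ∧ ∃ m : ℤ, quad Q x = p * m := by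
  by_contra hne
  have hp' : (p : ℚ) ≠ 0 := by positivity
  rw [trFst, if_neg hne, zero_add] at h
  have hd : (p : ℚ)⁻¹ • x ∈ dualLattice Q := by
    by_contra hd
    exact h (by rw [ind_of_notMem hd, mul_zero])
  apply hne
  have h1 := hQ.smul_dual _ hd
  rw [smul_inv_smul₀ hp'] at h1
  obtain ⟨m, hm⟩ := hQ.quad_dual _ hd
  refine ⟨h1, m, ?_⟩
  rw [← hm, quad_smul]
  field_simp

theorem trSnd_supp (hQ : IsLevelForm p Q) {y : n → ℚ} (h : trSnd p Q y ≠ 0) :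
    y ∈ dualLattice Q ∧ ∃ m : ℤ, quad Q y = m := by
  by_contra hne
  rw [trSnd, if_neg hne, add_zero] at h
  have hd : y ∈ intLattice n := by
    by_contra hd
    exact h (by rw [ind_of_notMem hd, mul_zero])
  exact hne ⟨intLattice_le_dualLattice hd, quad_int hQ.even hd⟩

/-- The index `½ Nᵀ Q N` of a term of the theta series. -/
def thetaIndex (Q : Matrix n n ℤ) (N : Matrix n (Fin 2) ℚ) : Matrix (Fin 2) (Fin 2) ℚ :=
  (1 / 2 : ℚ) • gramMat Q N

omit [DecidableEq n] in
theorem quad_mulVec (N : Matrix n (Fin 2) ℚ) (v : Fin 2 → ℚ) :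
    v ⬝ᵥ thetaIndex Q N *ᵥ v = quad Q (N *ᵥ v) := by
  rw [thetaIndex, smul_mulVec, dotProduct_smul, gramMat, ← mulVec_mulVec, ← mulVec_mulVec,
    dotProduct_mulVec, vecMul_transpose, quad, bil, smul_eq_mul]
  ring

/-- The diagonal entries are `q(x) ∈ pℤ` and `q(y) ∈ ℤ`, and twice the off-diagonal entry is a
pairing of `L` with `L^#`. -/
theorem thetaIndex_mem (hQ : IsLevelForm p Q) (hp : 0 < p) {N : Matrix n (Fin 2) ℚ}
    (h : colProd (trFst p Q) (trSnd p Q) N ≠ 0) : thetaIndex Q N ∈ paramodularIndices p := by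
  obtain ⟨h0, m₀, hm₀⟩ := trFst_supp hQ hp (left_ne_zero_of_mul h)
  obtain ⟨h1, m₁, hm₁⟩ := trSnd_supp hQ (right_ne_zero_of_mul h)
  obtain ⟨m₂, hm₂⟩ := bil_int_dual h0 h1
  refine ⟨⟨?_, ?_, fun v => ?_⟩, m₀, ?_⟩
  · rw [Matrix.IsSymm, thetaIndex, transpose_smul, gramMat]
    simp only [transpose_mul, transpose_transpose, Matrix.mul_assoc]
    rw [← transpose_map, hQ.even.1.eq]
  · have hr : (thetaIndex Q N).map (Rat.cast : ℚ → ℝ) =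
        (1 / 2 : ℝ) • ((N.map (Rat.cast : ℚ → ℝ))ᴴ * Q.map (Int.cast : ℤ → ℝ) * N.map (Rat.cast : ℚ → ℝ)) := by
      ext i j
      simp [thetaIndex, gramMat, Matrix.mul_apply]
    rw [hr]
    exact (hQ.pos.posSemidef.conjTranspose_mul_mul_same _).smul (by norm_num)
  · rw [quad_mulVec]
    have : N *ᵥ (fun i => (v i : ℚ)) = (v 0 : ℚ) • N.col 0 + (v 1 : ℚ) • N.col 1 := by
      ext i; simp [mulVec, dotProduct, Fin.sum_univ_two]; ring
    rw [this, quad_add hQ.even.1, quad_smul, quad_smul, bil_smul_left, bil_smul_right, hm₀, hm₁, hm₂]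
    exact ⟨v 0 ^ 2 * (p * m₀) + v 1 ^ 2 * m₁ + v 0 * (v 1 * m₂), by push_cast; ring⟩
  · rw [← hm₀, thetaIndex, Matrix.smul_apply, gramMat_apply, quad, smul_eq_mul]
    ring

/-- The terms with nonzero weight and given index. -/
def traceFiber (p : ℕ) (Q : Matrix n n ℤ) (T : Matrix (Fin 2) (Fin 2) ℚ) : Set (Matrix n (Fin 2) ℚ) :=
  {N | colProd (trFst p Q) (trSnd p Q) N ≠ 0 ∧ thetaIndex Q N = T}

/-- Regroup the absolutely convergent theta series by the value of the index `½ N'QN`. -/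
theorem isFourierExpansion_paramodularTrace [NeZero p] (hQ : IsLevelForm p Q) (hp : p.Prime) :
    IsFourierExpansion p (paramodularTrace 4 p (theta Q)) fun T =>
      ∑' N : traceFiber p Q T.1, colProd (trFst p Q) (trSnd p Q) N.1 := by
  intro Ω hΩ
  set Φ := colProd (trFst p Q) (trSnd p Q)
  rw [paramodularTrace_eq hQ hp hΩ]
  have h := ((isSchwartzCol_trFst hQ hp.pos).latticeBdd (isSchwartzCol_trSnd hQ hp.pos) one_pos
      hp.pos).hasSum hQ.pos hΩ
  rw [← hasSum_subtype_iff_of_support_subset (s := Function.support Φ)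
    fun N hN => left_ne_zero_of_mul hN] at h
  let g : Function.support Φ → paramodularIndices p := fun N => ⟨_, thetaIndex_mem hQ hp.pos N.2⟩
  refine (h.tsum_fiberwise g).congr_fun fun T => ?_
  let e : g ⁻¹' {T} ≃ traceFiber p Q T.1 :=
    ⟨fun N => ⟨N.1.1, N.1.2, congrArg Subtype.val N.2⟩,
      fun N => ⟨⟨N.1, N.2.1⟩, Subtype.ext N.2.2⟩, fun _ => rfl, fun _ => rfl⟩
  rw [← tsum_mul_right, ← e.tsum_eq]
  refine tsum_congr fun N => ?_
  change Φ N.1.1 * _ = Φ N.1.1 * thetaTerm Q N.1.1 Ω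
  have hT : T.1 = thetaIndex Q N.1.1 := (congrArg Subtype.val N.2).symm
  rw [hT, thetaTerm]
  congr 2
  have : (thetaIndex Q N.1.1).map (Rat.cast : ℚ → ℂ) =
      (1 / 2 : ℂ) • (gramMat Q N.1.1).map (Rat.cast : ℚ → ℂ) := by
    ext i j; simp [thetaIndex]
  rw [this, Matrix.smul_mul, trace_smul, smul_eq_mul]
  ring

end

noncomputable section

open Complex

/-! ## Anisotropy of the discriminant form -/

variable {n : Type*} [Fintype n] [DecidableEq n] {Q : Matrix n n ℤ} {p : ℕ} {y : n → ℚ}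

/-- The indicator function of `ℤⁿ + ℤy`, for `y` of order `p` modulo `ℤⁿ`. -/
def gluedInd (p : ℕ) (y x : n → ℚ) : ℂ := ∑ r : Fin p, ind (intLattice n) (x - ((r : ℕ) : ℚ) • y)

omit [Fintype n] [DecidableEq n] in
theorem gluedInd_exists {x : n → ℚ} (h : gluedInd p y x ≠ 0) :
    ∃ r : Fin p, x - ((r : ℕ) : ℚ) • y ∈ intLattice n := by
  by_contra hne
  push Not at hne
  exact h (Finset.sum_eq_zero fun r _ => ind_of_notMem (hne r))

omit [Fintype n] [DecidableEq n] in
-- `y` has exact order `p` modulo `ℤⁿ`, so the classes of its multiples are distinct and at most one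
-- term of the sum is nonzero.
theorem gluedInd_eq_one (hp : p.Prime) (hy : (p : ℚ) • y ∈ intLattice n) (hyL : y ∉ intLattice n)
    {x : n → ℚ} {r : Fin p} (h : x - ((r : ℕ) : ℚ) • y ∈ intLattice n) : gluedInd p y x = 1 := by
  rw [gluedInd, Finset.sum_eq_single r (fun s _ hsr => ?_) (by simp), ind_of_mem h]
  refine ind_of_notMem fun hs => hsr ?_
  by_contra hne
  apply hyL
  have hcop : IsCoprime ((s : ℕ) - (r : ℕ) : ℤ) p := by
    refine IsCoprime.symm ((Nat.prime_iff_prime_int.1 hp).coprime_iff_not_dvd.2 fun hd => hne ?_)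
    have h0 := Int.eq_zero_of_abs_lt_dvd hd (by rw [abs_lt]; omega)
    exact Fin.ext (by omega)
  obtain ⟨a, b, hab⟩ := hcop
  have h1 : (((s : ℕ) - (r : ℕ) : ℤ) : ℚ) • y ∈ intLattice n := by
    have := sub_mem h hs
    convert this using 1
    push_cast
    module
  have h2 : ∀ (c : ℤ) (z : n → ℚ), z ∈ intLattice n → (c : ℚ) • z ∈ intLattice n := fun c z hz => by
    rw [Int.cast_smul_eq_zsmul]; exact zsmul_mem hz c
  have h3 := add_mem (h2 a _ h1) (h2 b _ hy)
  convert h3 using 1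
  rw [smul_smul, smul_smul, ← add_smul]
  have : (a : ℚ) * (((s : ℕ) - (r : ℕ) : ℤ) : ℚ) + b * p = 1 := by exact_mod_cast hab
  rw [this, one_smul]

open scoped Classical in
-- For `z` in the dual lattice each `r` contributes one term, from the class of `r y`, and the sum
-- over `r` is a character sum equal to `p` or `0`. The normalization is `1/√(det Q) = 1/p`, so the
-- transform is an indicator function as well.
theorem latticeFourier_gluedInd (hdet : Q.det = (p : ℤ) ^ 2) (hp : 0 < p)
    (hpy : (p : ℚ) • y ∈ intLattice n) :
    latticeFourier Q p 1 (gluedInd p y) = fun z =>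
      if z ∈ dualLattice Q ∧ ∃ m : ℤ, bil Q y z = m then 1 else 0 := by
  have hpq : (p : ℚ) ≠ 0 := by positivity
  have hpC : (p : ℂ) ≠ 0 := by exact_mod_cast hp.ne'
  ext z
  rw [latticeFourier, inDual_one_iff]
  by_cases hz : z ∈ dualLattice Q
  swap
  · simp [hz]
  have hsq : √(Q.det : ℝ) = p := by
    rw [hdet]; push_cast; exact Real.sqrt_sq (by positivity)
  obtain ⟨v, hv⟩ := hpy
  have hterm : ∀ r : Fin p, ∑ k : n → Fin (1 * p),
      ind (intLattice n) ((fun i => ((k i : ℕ) : ℚ) / p) - ((r : ℕ) : ℚ) • y) *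
        ratExp (bil Q (fun i => ((k i : ℕ) : ℚ) / p) z) = ratExp ((r : ℕ) * bil Q y z) := by
    intro r
    have hvi : ∀ i, y i = v i / p := fun i => by
      have := congrFun hv i
      simp only [Pi.smul_apply, smul_eq_mul] at this
      field_simp
      linarith
    have hiff : ∀ k : n → Fin (1 * p), (fun i => ((k i : ℕ) : ℚ) / p) - ((r : ℕ) : ℚ) • y ∈
        intLattice n ↔ ∀ i, (p : ℤ) ∣ (k i : ℕ) - (r : ℕ) * v i := by
      intro k
      constructor
      · rintro ⟨w, hw⟩ i
        refine ⟨w i, ?_⟩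
        have := congrFun hw i
        simp only [Pi.sub_apply, Pi.smul_apply, smul_eq_mul, hvi] at this
        field_simp at this
        have h2 : (((k i : ℕ) - (r : ℕ) * v i : ℤ) : ℚ) = ((p * w i : ℤ) : ℚ) := by
          push_cast; linarith
        exact_mod_cast h2
      · intro h
        choose w hw using h
        refine ⟨w, ?_⟩
        ext i
        have h2 : (((k i : ℕ) - (r : ℕ) * v i : ℤ) : ℚ) = ((p * w i : ℤ) : ℚ) := by rw [hw]
        push_cast at h2
        simp only [Pi.sub_apply, Pi.smul_apply, smul_eq_mul, hvi]
        field_simp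
        linarith
    have hp' : (p : ℤ) ≠ 0 := by exact_mod_cast hp.ne'
    let k₀ : n → Fin (1 * p) := fun i => ⟨((r : ℕ) * v i % p).toNat, by
      have := Int.emod_lt_of_pos ((r : ℕ) * v i) (by exact_mod_cast hp : (0 : ℤ) < p)
      have := Int.emod_nonneg ((r : ℕ) * v i) hp'
      omega⟩
    have hk₀ : ∀ i, ((k₀ i : ℕ) : ℤ) = (r : ℕ) * v i % p := fun i =>
      Int.toNat_of_nonneg (Int.emod_nonneg _ hp')
    have hmem : (fun i => ((k₀ i : ℕ) : ℚ) / p) - ((r : ℕ) : ℚ) • y ∈ intLattice n := by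
      rw [hiff]
      intro i
      rw [hk₀, ← Int.neg_dvd, Int.neg_dvd, ← dvd_neg, neg_sub]
      exact Int.dvd_self_sub_emod
    rw [Finset.sum_eq_single k₀ (fun k _ hk => ?_) (by simp), ind_of_mem hmem, one_mul]
    · apply ratExp_eq_of_sub
      obtain ⟨m, hm⟩ := bil_int_dual hmem hz
      exact ⟨m, by rw [← hm, bil_sub_left, bil_smul_left]⟩
    · rw [ind_of_notMem, zero_mul]
      intro h
      apply hk
      rw [hiff] at h hmem
      ext i
      have h1 := dvd_sub (h i) (hmem i)
      have h2 := (k i).2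
      have h3 := (k₀ i).2
      have h0 := Int.eq_zero_of_abs_lt_dvd h1 (by rw [abs_lt]; omega)
      omega
  have hsum : ∑ k : n → Fin (1 * p), gluedInd p y (fun i => ((k i : ℕ) : ℚ) / p) *
      ratExp (bil Q (fun i => ((k i : ℕ) : ℚ) / p) z) = ∑ r : Fin p, ratExp ((r : ℕ) * bil Q y z) := by
    simp only [gluedInd, Finset.sum_mul]
    rw [Finset.sum_comm]
    exact Finset.sum_congr rfl fun r _ => hterm r
  have hint : ∃ m : ℤ, p * bil Q y z = m := by
    obtain ⟨m, hm⟩ := bil_int_dual ⟨v, hv⟩ hz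
    exact ⟨m, by rw [← hm, bil_smul_left]⟩
  rw [if_pos hz, hsum, sum_ratExp hint, hsq]
  simp only [hz, true_and]
  split_ifs <;> simp [hpC]

/-- The discriminant form of a quaternary even form of determinant `p ^ 2` and level `p` is
anisotropic. -/
theorem mem_intLattice_of_quad_int (hQ : IsEvenForm Q) (hpos : (Q.map (Int.cast : ℤ → ℝ)).PosDef)
    (hcard : Fintype.card n = 4) (hdet : Q.det = (p : ℤ) ^ 2) (hp : p.Prime)
    (hdual : ∀ y ∈ dualLattice Q, (p : ℚ) • y ∈ intLattice n) (hy : y ∈ dualLattice Q)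
    (hq : ∃ m : ℤ, quad Q y = m) : y ∈ intLattice n := by
  classical
  by_contra hyL
  have hpq : (p : ℚ) ≠ 0 := Nat.cast_ne_zero.2 hp.ne_zero
  -- `ψ` is the indicator function of `M = ℤⁿ + ℤy` and `χ` that of its dual. Integrality of `q(y)`
  -- makes `M` even and contained in its dual.
  set ψ := gluedInd p y
  set χ : (n → ℚ) → ℂ := fun z => if z ∈ dualLattice Q ∧ ∃ m : ℤ, bil Q y z = m then 1 else 0 with hχ
  have hF : latticeFourier Q p 1 ψ = χ := latticeFourier_gluedInd hdet hp.pos (hdual y hy)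
  have hyy : bil Q y y = 2 * quad Q y := by rw [quad]; ring
  have hcase : ∀ x, ψ x = 0 ∨ (ψ x = 1 ∧ χ x = 1 ∧ ∃ m : ℤ, bil Q x x = 2 * m) := by
    intro x
    by_cases h : ψ x = 0
    · exact Or.inl h
    · obtain ⟨r, hr⟩ := gluedInd_exists h
      obtain ⟨m, hm⟩ := hq
      have hx : x = (x - ((r : ℕ) : ℚ) • y) + ((r : ℕ) : ℚ) • y := by abel
      have hry : ((r : ℕ) : ℚ) • y ∈ dualLattice Q := by
        rw [Nat.cast_smul_eq_nsmul]; exact nsmul_mem hy _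
      have h1 : x ∈ dualLattice Q := by
        have := add_mem (intLattice_le_dualLattice (Q := Q) hr) hry
        rwa [← hx] at this
      have h2 : ∃ m : ℤ, bil Q y x = m := by
        obtain ⟨k, hk⟩ := bil_int_dual hr hy
        refine ⟨k + (r : ℕ) * (2 * m), ?_⟩
        have h : bil Q x y = bil Q (x - ((r : ℕ) : ℚ) • y + ((r : ℕ) : ℚ) • y) y :=
          congrArg (bil Q · y) hx
        rw [bil_add_left, bil_smul_left, hk, hyy, hm] at h
        rw [bil_comm hQ.1, h]
        push_cast
        ring
      have h3 : ∃ m : ℤ, bil Q x x = 2 * m := by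
        obtain ⟨k, hk⟩ := quad_int hQ hr
        obtain ⟨l, hl⟩ := bil_int_dual hr hry
        refine ⟨k + (r : ℕ) ^ 2 * m + l, ?_⟩
        have h := congrArg (quad Q) hx
        rw [quad_add hQ.1, quad_smul, hk, hl, hm] at h
        have : bil Q x x = 2 * quad Q x := by rw [quad]; ring
        rw [this, h]
        push_cast
        ring
      exact Or.inr ⟨gluedInd_eq_one hp (hdual y hy) hyL hr, if_pos ⟨h1, h2⟩, h3⟩
  have hsupp : ∀ x, ψ x ≠ 0 → ∀ i, ∃ m : ℤ, x i = m / p := by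
    intro x hx i
    obtain ⟨r, w, hw⟩ := gluedInd_exists hx
    obtain ⟨v, hv⟩ := hdual y hy
    refine ⟨p * w i + (r : ℕ) * v i, ?_⟩
    have h1 := congrFun hw i
    have h2 := congrFun hv i
    simp only [Pi.sub_apply, Pi.smul_apply, smul_eq_mul] at h1 h2
    push_cast
    rw [← h1, ← h2]
    field_simp
    ring
  have hper : ∀ x (v : n → ℤ), ψ (fun i => x i + (1 : ℕ) * v i) = ψ x := by
    intro x v
    refine Finset.sum_congr rfl fun r _ => ?_
    have hx : (fun i => x i + ((1 : ℕ) : ℚ) * v i) - ((r : ℕ) : ℚ) • y =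
        (x - ((r : ℕ) : ℚ) • y) + fun i => (v i : ℚ) := by ext i; simp; ring
    rw [hx]
    have h := (isSchwartzCol_ind_int (n := n)).per (x - ((r : ℕ) : ℚ) • y) v
    rw [← h]
    congr 1
    ext i
    simp
  let F : ℂ → ℂ := fun ω => ∑' x, ψ x * cexp (Real.pi * I * ((bil Q x x : ℚ) * ω))
  have hinv : ∀ ω : ℂ, 0 < ω.im →
      HasSum (fun x => χ x * cexp (Real.pi * I * ((bil Q x x : ℚ) * (-1 / ω)))) (-ω ^ 2 * F ω) ∧
      HasSum (fun x => ψ x * cexp (Real.pi * I * ((bil Q x x : ℚ) * ω))) (F ω) := by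
    intro ω hω
    have hω0 : ω ≠ 0 := fun h => by simp [h] at hω
    obtain ⟨t, h1, h2⟩ := summable_column_dual_and_hasSum hQ.1 hpos (j := 2) (by rw [hcard]) hp.pos
      one_pos hsupp hper hω 0 0
    simp only [bil_zero_left, Rat.cast_zero, mul_zero, zero_add, zero_div, add_zero, hF,
      sub_zero, ne_eq, OfNat.ofNat_ne_zero, not_false_eq_true, zero_pow] at h1 h2
    have hFω : F ω = (-I * ω)⁻¹ ^ 2 * t := h2.tsum_eq
    refine ⟨?_, hFω ▸ h2⟩
    have ht : -ω ^ 2 * F ω = t := by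
      rw [hFω, inv_pow, mul_pow, neg_sq, I_sq]
      field_simp
    rw [ht]
    refine h1.congr_fun fun x => ?_
    congr 2
    ring
  have hreal : ∀ x, cexp (Real.pi * I * ((bil Q x x : ℚ) * I)) =
      ((Real.exp (-Real.pi * (bil Q x x : ℚ)) : ℝ) : ℂ) := by
    intro x
    push_cast
    congr 1
    linear_combination (Real.pi * (bil Q x x : ℚ) : ℂ) * I_sq
  -- At `ω = i` the factor `-ω²` is `1`, so the sums over `M` and over its dual agree. Their terms
  -- are positive and one lattice contains the other, so the lattices are equal.
  have hψχ : χ = ψ := by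
    obtain ⟨h1, h2⟩ := hinv I (by simp)
    rw [I_sq, neg_neg, one_mul, show -1 / I = I by rw [div_I]; ring] at h1
    have h3 := h1.sub h2
    rw [sub_self] at h3
    have h4 : ∀ x, ∃ d : ℝ, 0 ≤ d ∧ χ x - ψ x = d := by
      intro x
      rcases hcase x with h | ⟨h, h', -⟩
      · rw [h, sub_zero, hχ]
        dsimp only
        split_ifs
        · exact ⟨1, zero_le_one, by simp⟩
        · exact ⟨0, le_rfl, by simp⟩
      · exact ⟨0, le_rfl, by rw [h, h']; simp⟩
    choose d hd hd' using h4
    have h5 : HasSum (fun x => d x * Real.exp (-Real.pi * (bil Q x x : ℚ))) 0 := by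
      rw [← Complex.hasSum_ofReal]
      rw [ofReal_zero]
      refine h3.congr_fun fun x => ?_
      rw [← sub_mul, hd', hreal]
      push_cast
      rfl
    rw [hasSum_zero_iff_of_nonneg fun x => mul_nonneg (hd x) (Real.exp_pos _).le] at h5
    ext x
    have := congrFun h5 x
    simp only [Pi.zero_apply, mul_eq_zero, (Real.exp_pos _).ne', or_false] at this
    rw [← sub_eq_zero, hd', this, ofReal_zero]
  have hS : ∀ ω : ℂ, 0 < ω.im → F (-1 / ω) = -ω ^ 2 * F ω := fun ω hω => by
    have := (hinv ω hω).1
    rw [hψχ] at this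
    exact this.tsum_eq
  have hT : ∀ ω : ℂ, F (ω + 1) = F ω := by
    intro ω
    refine tsum_congr fun x => ?_
    rcases hcase x with h | ⟨-, -, m, hm⟩
    · rw [h, zero_mul, zero_mul]
    · congr 1
      rw [hm, Complex.exp_eq_exp_iff_exists_int]
      exact ⟨m, by push_cast; ring⟩
  -- The path `i ↦ 1 + i ↦ (1 + i)/2 ↦ i`, by `ω + 1` and then twice by `-1/ω + 1`, closes up with
  -- total factor `-1`. Hence `F(i) = 0`.
  have e1 : F (1 + I) = F I := by rw [add_comm, hT]
  have e2 : F ((1 + I) / 2) = -(1 + I) ^ 2 * F (1 + I) := by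
    rw [← hS (1 + I) (by simp), ← hT (-1 / (1 + I))]
    congr 1
    have : (1 + I) ≠ 0 := fun h => by simpa using congrArg Complex.im h
    field_simp
    linear_combination I_sq
  have e3 : F I = -((1 + I) / 2) ^ 2 * F ((1 + I) / 2) := by
    rw [← hS ((1 + I) / 2) (by simp), ← hT (-1 / ((1 + I) / 2))]
    congr 1
    have : (1 + I) ≠ 0 := fun h => by simpa using congrArg Complex.im h
    field_simp
    linear_combination I_sq
  have hF0 : F I = 0 := by
    rw [e2, e1] at e3
    have : ((1 + I) / 2) ^ 2 * (1 + I) ^ 2 = -1 := by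
      linear_combination (I ^ 2 / 4 + I + 5 / 4) * I_sq
    have h2 : F I = -F I := by linear_combination e3 + F I * this
    linear_combination h2 / 2
  have h6 := (hinv I (by simp)).2
  rw [hF0] at h6
  have h7 : ∀ x, ∃ d : ℝ, 0 ≤ d ∧ ψ x = d := by
    intro x
    rcases hcase x with h | ⟨h, -⟩
    · exact ⟨0, le_rfl, by simp [h]⟩
    · exact ⟨1, zero_le_one, by simp [h]⟩
  choose d hd hd' using h7
  have h8 : HasSum (fun x => d x * Real.exp (-Real.pi * (bil Q x x : ℚ))) 0 := by
    rw [← Complex.hasSum_ofReal, ofReal_zero]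
    refine h6.congr_fun fun x => ?_
    rw [hd', hreal]
    push_cast
    rfl
  rw [hasSum_zero_iff_of_nonneg fun x => mul_nonneg (hd x) (Real.exp_pos _).le] at h8
  -- A vanishing sum of nonnegative terms has no nonzero term, but the zero vector contributes `1`.
  have h9 := congrFun h8 0
  simp only [Pi.zero_apply, mul_eq_zero, (Real.exp_pos _).ne', or_false] at h9
  have h10 : ψ 0 = 1 := gluedInd_eq_one hp (hdual y hy) hyL (r := ⟨0, hp.pos⟩) (by simp [zero_mem])
  rw [hd', h9] at h10
  simp at h10

end

noncomputable section

/-! ## Sums of two quaternary forms -/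

/-- Two quaternary even forms of determinant `p ^ 2` with product `p`. -/
structure IsLevelPair (p : ℕ) (A E : Matrix (Fin 4) (Fin 4) ℤ) : Prop where
  even_left : IsEvenForm A
  even_right : IsEvenForm E
  pos_left : (A.map (Int.cast : ℤ → ℝ)).PosDef
  pos_right : (E.map (Int.cast : ℤ → ℝ)).PosDef
  det_left : A.det = (p : ℤ) ^ 2
  det_right : E.det = (p : ℤ) ^ 2
  mul_left : E * A = (p : ℤ) • (1 : Matrix (Fin 4) (Fin 4) ℤ)
  mul_right : A * E = (p : ℤ) • (1 : Matrix (Fin 4) (Fin 4) ℤ)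

variable {p : ℕ} {A B E : Matrix (Fin 4) (Fin 4) ℤ}

theorem IsLevelPair.symm (h : IsLevelPair p A E) : IsLevelPair p E A :=
  ⟨h.even_right, h.even_left, h.pos_right, h.pos_left, h.det_right, h.det_left, h.mul_right, h.mul_left⟩

theorem map_smul_one {S : Type*} [Ring S] (p : ℕ) :
    ((p : ℤ) • (1 : Matrix (Fin 4) (Fin 4) ℤ)).map (Int.cast : ℤ → S) = (p : S) • 1 := by
  ext i j
  rw [map_apply, Matrix.smul_apply, Matrix.smul_apply, Matrix.one_apply, Matrix.one_apply]
  split_ifs <;> simp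

/-- `E` is the integral matrix `p A⁻¹`, of determinant `p⁴ / p² = p²`. Thus `A` and `E` play
symmetric roles, and what is proved for one holds for the other. -/
theorem exists_isLevelPair (hp : 0 < p) (hA : IsEvenForm A) (hpos : (A.map (Int.cast : ℤ → ℝ)).PosDef)
    (hdet : A.det = (p : ℤ) ^ 2) (hlevel : IsEvenRatForm ((p : ℚ) • (A.map (Int.cast : ℤ → ℚ))⁻¹)) :
    ∃ E, IsLevelPair p A E := by
  obtain ⟨E, hE, h⟩ := hlevel
  have hinj : Function.Injective fun M : Matrix (Fin 4) (Fin 4) ℤ => M.map (Int.cast : ℤ → ℚ) :=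
    Matrix.map_injective Int.cast_injective
  have hmap : ∀ M N : Matrix (Fin 4) (Fin 4) ℤ, (M * N).map (Int.cast : ℤ → ℚ) =
      M.map (Int.cast : ℤ → ℚ) * N.map (Int.cast : ℤ → ℚ) := fun M N =>
    Matrix.map_mul (f := Int.castRingHom ℚ)
  have hp' : (p : ℤ) ≠ 0 := by exact_mod_cast hp.ne'
  have hdetQ : IsUnit (A.map (Int.cast : ℤ → ℚ)).det := by
    have : (A.map (Int.cast : ℤ → ℚ)).det = (A.det : ℤ) := (Int.cast_det A).symm
    rw [this, hdet]
    exact (isUnit_iff_ne_zero).2 (by exact_mod_cast pow_ne_zero 2 hp')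
  have hl : E * A = (p : ℤ) • (1 : Matrix (Fin 4) (Fin 4) ℤ) := hinj (by
    dsimp only
    rw [hmap, ← h, Matrix.smul_mul, nonsing_inv_mul _ hdetQ, map_smul_one])
  have hr : A * E = (p : ℤ) • (1 : Matrix (Fin 4) (Fin 4) ℤ) := hinj (by
    dsimp only
    rw [hmap, ← h, Matrix.mul_smul, mul_nonsing_inv _ hdetQ, map_smul_one])
  have hEdet : E.det = (p : ℤ) ^ 2 := by
    have := congrArg det hl
    rw [det_mul, det_smul, det_one, hdet, Fintype.card_fin, mul_one] at this
    exact mul_right_cancel₀ (pow_ne_zero 2 hp') (by rw [this]; ring)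
  have hEpos : (E.map (Int.cast : ℤ → ℝ)).PosDef := by
    have h1 : E.map (Int.cast : ℤ → ℝ) * A.map (Int.cast : ℤ → ℝ) = (p : ℝ) • 1 := by
      have : (E * A).map (Int.cast : ℤ → ℝ) = E.map (Int.cast : ℤ → ℝ) * A.map (Int.cast : ℤ → ℝ) :=
        Matrix.map_mul (f := Int.castRingHom ℝ)
      rw [← this, hl, map_smul_one]
    have hu : IsUnit (A.map (Int.cast : ℤ → ℝ)).det := hpos.det_pos.ne'.isUnit
    have h2 : E.map (Int.cast : ℤ → ℝ) = (p : ℝ) • (A.map (Int.cast : ℤ → ℝ))⁻¹ := by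
      rw [← mul_nonsing_inv_cancel_right _ (E.map (Int.cast : ℤ → ℝ)) hu, h1, Matrix.smul_mul, one_mul]
    rw [h2]
    exact hpos.inv.smul (by exact_mod_cast hp)
  exact ⟨E, hA, hE, hpos, hEpos, hdet, hEdet, hl, hr⟩

theorem IsLevelPair.mulVec_mulVec (h : IsLevelPair p A E) (x : Fin 4 → ℚ) :
    E.map (Int.cast : ℤ → ℚ) *ᵥ A.map (Int.cast : ℤ → ℚ) *ᵥ x = (p : ℚ) • x := by
  have : (E * A).map (Int.cast : ℤ → ℚ) = E.map (Int.cast : ℤ → ℚ) * A.map (Int.cast : ℤ → ℚ) :=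
    Matrix.map_mul (f := Int.castRingHom ℚ)
  rw [Matrix.mulVec_mulVec, ← this, h.mul_left, map_smul_one, smul_mulVec, one_mulVec]

theorem mulVec_int {n : Type*} [Fintype n] (Q : Matrix n n ℤ) {x : n → ℚ} (hx : x ∈ intLattice n) :
    Q.map (Int.cast : ℤ → ℚ) *ᵥ x ∈ intLattice n := by
  obtain ⟨v, rfl⟩ := hx
  exact mem_intLattice.2 ⟨Q *ᵥ v, by ext i; simp [mulVec, dotProduct]⟩

/-- The quadratic form of `E` at `A x` is `p` times that of `A` at `x`. -/
theorem IsLevelPair.quad_mulVec (h : IsLevelPair p A E) (x : Fin 4 → ℚ) :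
    quad E (A.map (Int.cast : ℤ → ℚ) *ᵥ x) = p * quad A x := by
  rw [quad, bil, h.mulVec_mulVec, dotProduct_smul, dotProduct_comm, quad, bil, smul_eq_mul]
  ring

theorem IsLevelPair.smul_dual (h : IsLevelPair p A E) {y : Fin 4 → ℚ} (hy : y ∈ dualLattice A) :
    (p : ℚ) • y ∈ intLattice (Fin 4) := by
  rw [← h.mulVec_mulVec]
  exact mulVec_int E hy

theorem IsLevelPair.quad_dual (h : IsLevelPair p A E) {y : Fin 4 → ℚ} (hy : y ∈ dualLattice A) :
    ∃ m : ℤ, p * quad A y = m := by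
  rw [← h.quad_mulVec]
  exact quad_int h.even_right hy

theorem IsLevelPair.mem_intLattice (h : IsLevelPair p A E) (hp : p.Prime) {y : Fin 4 → ℚ}
    (hy : y ∈ dualLattice A) (hq : ∃ m : ℤ, quad A y = m) : y ∈ intLattice (Fin 4) :=
  mem_intLattice_of_quad_int h.even_left h.pos_left rfl h.det_left hp (fun _ => h.smul_dual) hy hq

/-- This is anisotropy for the partner form: `A` carries `p⁻¹x` into the dual lattice of `E`, where
the quadratic form of `E` takes the integral value `q(x) / p`. -/
theorem IsLevelPair.inv_smul_mem_dualLattice (h : IsLevelPair p A E) (hp : p.Prime) {x : Fin 4 → ℚ}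
    (hx : x ∈ intLattice (Fin 4)) (hq : ∃ m : ℤ, quad A x = p * m) :
    (p : ℚ)⁻¹ • x ∈ dualLattice A := by
  have hp' : (p : ℚ) ≠ 0 := Nat.cast_ne_zero.2 hp.ne_zero
  change A.map (Int.cast : ℤ → ℚ) *ᵥ ((p : ℚ)⁻¹ • x) ∈ intLattice (Fin 4)
  refine h.symm.mem_intLattice hp ?_ ?_
  · change E.map (Int.cast : ℤ → ℚ) *ᵥ _ ∈ intLattice (Fin 4)
    rwa [h.mulVec_mulVec, smul_inv_smul₀ hp']
  · obtain ⟨m, hm⟩ := hq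
    refine ⟨m, ?_⟩
    rw [h.quad_mulVec, quad_smul, hm]
    field_simp

section blocks

variable {k l : Type*} [Fintype k] [Fintype l] {P : Matrix k k ℤ} {R : Matrix l l ℤ}

omit [Fintype k] [Fintype l] in
theorem mem_intLattice_sum {x : k ⊕ l → ℚ} :
    x ∈ intLattice (k ⊕ l) ↔ x ∘ Sum.inl ∈ intLattice k ∧ x ∘ Sum.inr ∈ intLattice l := by
  constructor
  · rintro ⟨v, rfl⟩
    exact ⟨mem_intLattice.2 ⟨v ∘ Sum.inl, rfl⟩, mem_intLattice.2 ⟨v ∘ Sum.inr, rfl⟩⟩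
  · rintro ⟨⟨v, hv⟩, ⟨w, hw⟩⟩
    refine mem_intLattice.2 ⟨Sum.elim v w, ?_⟩
    ext (i | i)
    · exact congrFun hv i
    · exact congrFun hw i

theorem fromBlocks_map_mulVec (x : k ⊕ l → ℚ) :
    (fromBlocks P 0 0 R).map (Int.cast : ℤ → ℚ) *ᵥ x =
      Sum.elim (P.map (Int.cast : ℤ → ℚ) *ᵥ (x ∘ Sum.inl)) (R.map (Int.cast : ℤ → ℚ) *ᵥ (x ∘ Sum.inr)) := by
  rw [fromBlocks_map, fromBlocks_mulVec]
  simp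

theorem mem_dualLattice_fromBlocks {x : k ⊕ l → ℚ} :
    x ∈ dualLattice (fromBlocks P 0 0 R) ↔
      x ∘ Sum.inl ∈ dualLattice P ∧ x ∘ Sum.inr ∈ dualLattice R := by
  change (fromBlocks P 0 0 R).map (Int.cast : ℤ → ℚ) *ᵥ x ∈ intLattice (k ⊕ l) ↔ _
  rw [mem_intLattice_sum, fromBlocks_map_mulVec]
  rfl

theorem quad_fromBlocks (x : k ⊕ l → ℚ) :
    quad (fromBlocks P 0 0 R) x = quad P (x ∘ Sum.inl) + quad R (x ∘ Sum.inr) := by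
  rw [quad, bil, fromBlocks_map_mulVec]
  nth_rw 1 [← Sum.elim_comp_inl_inr x]
  rw [sumElim_dotProduct_sumElim, add_div]
  rfl

end blocks

variable {E' : Matrix (Fin 4) (Fin 4) ℤ}

theorem IsLevelPair.isLevelForm_fromBlocks (hA : IsLevelPair p A E) (hB : IsLevelPair p B E') :
    IsLevelForm p (fromBlocks A 0 0 B) where
  even := by
    refine ⟨?_, ?_⟩
    · rw [Matrix.IsSymm, fromBlocks_transpose, hA.even_left.1.eq, hB.even_left.1.eq]
      simp
    · rintro (i | i)
      · exact hA.even_left.2 i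
      · exact hB.even_left.2 i
  pos := by
    rw [fromBlocks_map]
    have hz : (0 : Matrix (Fin 4) (Fin 4) ℤ).map (Int.cast : ℤ → ℝ) = 0 := by ext; simp
    rw [hz]
    have := hA.pos_left.isUnit.invertible
    -- With zero off-diagonal blocks the Schur complement criterion gives semidefiniteness;
    -- invertibility upgrades it.
    have h : (fromBlocks (A.map (Int.cast : ℤ → ℝ)) 0 0 (B.map (Int.cast : ℤ → ℝ))).PosSemidef := by
      have := (hA.pos_left.fromBlocks₁₁ (0 : Matrix (Fin 4) (Fin 4) ℝ) (B.map (Int.cast : ℤ → ℝ))).2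
        (by simpa using hB.pos_left.posSemidef)
      simpa using this
    rw [h.posDef_iff_isUnit, isUnit_fromBlocks_zero₂₁]
    exact ⟨hA.pos_left.isUnit, hB.pos_left.isUnit⟩
  card := rfl
  det := by
    rw [det_fromBlocks_zero₂₁, hA.det_left, hB.det_left]
    ring
  smul_dual := fun y hy => by
    rw [mem_dualLattice_fromBlocks] at hy
    exact mem_intLattice_sum.2 ⟨hA.smul_dual hy.1, hB.smul_dual hy.2⟩
  quad_dual := fun y hy => by
    rw [mem_dualLattice_fromBlocks] at hy
    obtain ⟨a, ha⟩ := hA.quad_dual hy.1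
    obtain ⟨b, hb⟩ := hB.quad_dual hy.2
    exact ⟨a + b, by rw [quad_fromBlocks, mul_add, ha, hb]; push_cast; rfl⟩

end

open Complex

noncomputable section

/-! ## Divisibility of the Fourier coefficients -/

section fiber

variable {n : Type*} [Fintype n] [DecidableEq n] {Q : Matrix n n ℤ} {p : ℕ}

theorem one_mem_siegelHalfSpace : !![I, 0; 0, I] ∈ siegelHalfSpace := by
  refine ⟨by ext i j; fin_cases i <;> fin_cases j <;> simp, ?_⟩
  have : (!![I, 0; 0, I] : Matrix (Fin 2) (Fin 2) ℂ).map Complex.im = 1 := by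
    ext i j; fin_cases i <;> fin_cases j <;> simp
  rw [this]
  exact PosDef.one

omit [DecidableEq n] in
theorem trFst_int (x : n → ℚ) : ∃ m : ℤ, trFst p Q x = m := by
  rw [trFst]
  by_cases h : (p : ℚ)⁻¹ • x ∈ dualLattice Q
  · rw [ind_of_mem h]
    split_ifs
    · exact ⟨1 + p, by push_cast; ring⟩
    · exact ⟨p, by push_cast; ring⟩
  · rw [ind_of_notMem h]
    split_ifs
    · exact ⟨1, by simp⟩
    · exact ⟨0, by simp⟩

omit [DecidableEq n] in
theorem trSnd_int (x : n → ℚ) : ∃ m : ℤ, trSnd p Q x = m := by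
  rw [trSnd]
  by_cases h : x ∈ intLattice n
  · rw [ind_of_mem h]
    split_ifs
    · exact ⟨p + 1, by push_cast; ring⟩
    · exact ⟨p, by push_cast; ring⟩
  · rw [ind_of_notMem h]
    split_ifs
    · exact ⟨1, by simp⟩
    · exact ⟨0, by simp⟩

omit [DecidableEq n] in
theorem colProd_trace_int (N : Matrix n (Fin 2) ℚ) :
    ∃ m : ℤ, colProd (trFst p Q) (trSnd p Q) N = m := by
  obtain ⟨a, ha⟩ := trFst_int (p := p) (Q := Q) (N.col 0)
  obtain ⟨b, hb⟩ := trSnd_int (p := p) (Q := Q) (N.col 1)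
  exact ⟨a * b, by rw [colProd, ha, hb]; push_cast; rfl⟩

/-- A nonzero weight is a nonzero integer, hence of norm at least one, and all terms of a fibre
share the same exponential. Convergence of the series at `Ω = i` leaves room for finitely many. -/
theorem finite_traceFiber (hQ : IsLevelForm p Q) (hp : 0 < p) (T : Matrix (Fin 2) (Fin 2) ℚ) :
    (traceFiber p Q T).Finite := by
  have h := (((isSchwartzCol_trFst hQ hp).latticeBdd (isSchwartzCol_trSnd hQ hp) one_pos
      hp).summable_norm hQ.pos one_mem_siegelHalfSpace).subtype (traceFiber p Q T)
  set c := ‖cexp (Real.pi * I * (((2 : ℚ) • T).map (Rat.cast : ℚ → ℂ) * !![I, 0; 0, I]).trace)‖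
  have hc : c ≠ 0 := norm_ne_zero_iff.2 (Complex.exp_ne_zero _)
  have h' : Summable fun _ : traceFiber p Q T => c := by
    refine Summable.of_nonneg_of_le (fun _ => norm_nonneg _) (fun N => ?_) h
    have hN : gramMat Q N.1 = (2 : ℚ) • T := by
      have : thetaIndex Q N.1 = T := N.2.2
      refine Eq.trans ?_ (congrArg ((2 : ℚ) • ·) this)
      rw [thetaIndex, smul_smul]
      norm_num
    change c ≤ ‖_ * thetaTerm Q N.1 _‖
    rw [norm_mul, thetaTerm, hN]
    refine le_mul_of_one_le_left (norm_nonneg _) ?_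
    obtain ⟨m, hm⟩ := colProd_trace_int (p := p) (Q := Q) N.1
    have h0 := N.2.1
    rw [hm] at h0 ⊢
    rw [Complex.norm_intCast]
    exact_mod_cast Int.one_le_abs (by exact_mod_cast h0 : m ≠ 0)
  refine Set.not_infinite.1 fun hinf => hc ?_
  have := hinf.to_subtype
  exact (summable_const_iff c).1 h'

theorem ind_congr {n : Type*} {S : AddSubgroup (n → ℚ)} {x y : n → ℚ} (h : x ∈ S ↔ y ∈ S) :
    ind S x = ind S y := by
  by_cases hx : x ∈ S
  · rw [ind_of_mem hx, ind_of_mem (h.1 hx)]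
  · rw [ind_of_notMem hx, ind_of_notMem fun hy => hx (h.2 hy)]

omit [DecidableEq n] in
-- The weight sees only lattice memberships and values of `q` on the columns, so every sign symmetry
-- of the form preserves it.
theorem colProd_trace_congr {N N' : Matrix n (Fin 2) ℚ}
    (hi : ∀ j, N.col j ∈ intLattice n ↔ N'.col j ∈ intLattice n)
    (hd : ∀ j (c : ℚ), c • N.col j ∈ dualLattice Q ↔ c • N'.col j ∈ dualLattice Q)
    (hq : ∀ j, quad Q (N.col j) = quad Q (N'.col j)) :
    colProd (trFst p Q) (trSnd p Q) N = colProd (trFst p Q) (trSnd p Q) N' := by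
  have hd1 : N.col 1 ∈ dualLattice Q ↔ N'.col 1 ∈ dualLattice Q := by simpa using hd 1 1
  rw [colProd, colProd, trFst, trFst, trSnd, trSnd, ind_congr (hi 1), ind_congr (hd 0 _)]
  classical
  congr 2
  · exact if_congr (and_congr (hi 0) (by rw [hq])) rfl rfl
  · exact if_congr (and_congr hd1 (by rw [hq])) rfl rfl

omit [DecidableEq n] in
theorem colProd_trace_neg (N : Matrix n (Fin 2) ℚ) :
    colProd (trFst p Q) (trSnd p Q) (-N) = colProd (trFst p Q) (trSnd p Q) N := by
  have hcol : ∀ j, (-N).col j = -N.col j := fun j => rfl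
  refine colProd_trace_congr (fun j => ?_) (fun j c => ?_) fun j => ?_ <;> rw [hcol]
  · exact neg_mem_iff
  · rw [smul_neg]
    exact neg_mem_iff
  · rw [← neg_one_smul ℚ, quad_smul]
    norm_num

end fiber

section flip

variable {k l : Type*} [Fintype k] [Fintype l] {P : Matrix k k ℤ} {R : Matrix l l ℤ} {p : ℕ}

/-- The sign change of the first block of coordinates. -/
def flipVec (x : k ⊕ l → ℚ) : k ⊕ l → ℚ := Sum.elim (-(x ∘ Sum.inl)) (x ∘ Sum.inr)

/-- The sign change of the first block of rows. -/
def flipRows (N : Matrix (k ⊕ l) (Fin 2) ℚ) : Matrix (k ⊕ l) (Fin 2) ℚ :=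
  of fun i j => flipVec (N.col j) i

omit [Fintype k] [Fintype l] in
theorem flipRows_inl (N : Matrix (k ⊕ l) (Fin 2) ℚ) (i : k) (j : Fin 2) :
    flipRows N (Sum.inl i) j = -N (Sum.inl i) j := rfl

omit [Fintype k] [Fintype l] in
theorem flipRows_inr (N : Matrix (k ⊕ l) (Fin 2) ℚ) (i : l) (j : Fin 2) :
    flipRows N (Sum.inr i) j = N (Sum.inr i) j := rfl

omit [Fintype k] [Fintype l] in
theorem flipRows_flipRows (N : Matrix (k ⊕ l) (Fin 2) ℚ) : flipRows (flipRows N) = N := by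
  ext (i | i) j <;> simp [flipRows_inl, flipRows_inr]

omit [Fintype k] [Fintype l] in
theorem flipRows_neg (N : Matrix (k ⊕ l) (Fin 2) ℚ) : flipRows (-N) = -flipRows N := by
  ext (i | i) j <;> simp [flipRows_inl, flipRows_inr]

theorem bil_flipVec (x y : k ⊕ l → ℚ) :
    bil (fromBlocks P 0 0 R) (flipVec x) (flipVec y) = bil (fromBlocks P 0 0 R) x y := by
  rw [bil, bil, fromBlocks_map_mulVec, fromBlocks_map_mulVec]
  simp only [dotProduct, Fintype.sum_sum_type]
  simp [flipVec, mulVec_neg]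

omit [Fintype k] [Fintype l] in
theorem flipVec_mem_intLattice_iff {x : k ⊕ l → ℚ} :
    flipVec x ∈ intLattice (k ⊕ l) ↔ x ∈ intLattice (k ⊕ l) := by
  rw [mem_intLattice_sum, mem_intLattice_sum]
  exact and_congr_left fun _ => neg_mem_iff

theorem flipVec_mem_dualLattice_iff {x : k ⊕ l → ℚ} :
    flipVec x ∈ dualLattice (fromBlocks P 0 0 R) ↔ x ∈ dualLattice (fromBlocks P 0 0 R) := by
  rw [mem_dualLattice_fromBlocks, mem_dualLattice_fromBlocks]
  exact and_congr_left fun _ => neg_mem_iff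

theorem colProd_flipRows (N : Matrix (k ⊕ l) (Fin 2) ℚ) :
    colProd (trFst p (fromBlocks P 0 0 R)) (trSnd p (fromBlocks P 0 0 R)) (flipRows N) =
      colProd (trFst p (fromBlocks P 0 0 R)) (trSnd p (fromBlocks P 0 0 R)) N := by
  have hcol : ∀ j, (flipRows N).col j = flipVec (N.col j) := fun j => rfl
  have hs : ∀ (c : ℚ) (x : k ⊕ l → ℚ), c • flipVec x = flipVec (c • x) := fun c x => by
    ext (i | i) <;> simp [flipVec]
  refine colProd_trace_congr (fun j => ?_) (fun j c => ?_) fun j => ?_ <;> rw [hcol]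
  · exact flipVec_mem_intLattice_iff
  · rw [hs]
    exact flipVec_mem_dualLattice_iff
  · rw [quad, bil_flipVec, quad]

theorem thetaIndex_flipRows (N : Matrix (k ⊕ l) (Fin 2) ℚ) :
    thetaIndex (fromBlocks P 0 0 R) (flipRows N) = thetaIndex (fromBlocks P 0 0 R) N := by
  rw [thetaIndex, thetaIndex]
  congr 1
  ext i j
  rw [gramMat_apply, gramMat_apply]
  exact bil_flipVec _ _

theorem thetaIndex_neg {n : Type*} [Fintype n] (Q : Matrix n n ℤ) (N : Matrix n (Fin 2) ℚ) :
    thetaIndex Q (-N) = thetaIndex Q N := by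
  simp [thetaIndex, gramMat]

open scoped Classical in
/-- The orbit of a matrix under the sign changes of the two blocks of rows. -/
def signOrbit (N : Matrix (k ⊕ l) (Fin 2) ℚ) : Finset (Matrix (k ⊕ l) (Fin 2) ℚ) :=
  {N, -N, flipRows N, -flipRows N}

theorem mem_signOrbit {N N' : Matrix (k ⊕ l) (Fin 2) ℚ} :
    N' ∈ signOrbit N ↔ N' = N ∨ N' = -N ∨ N' = flipRows N ∨ N' = -flipRows N := by
  simp [signOrbit]

theorem signOrbit_eq {N N' : Matrix (k ⊕ l) (Fin 2) ℚ} (h : N' ∈ signOrbit N) :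
    signOrbit N' = signOrbit N := by
  ext L
  rw [mem_signOrbit] at h
  rcases h with rfl | rfl | rfl | rfl <;>
    simp only [mem_signOrbit, neg_neg, flipRows_neg, flipRows_flipRows] <;> tauto

/-- A nonzero entry in the first block separates `N` from `-N` and from `flipRows N`; one in the
second block separates `N` from `-flipRows N`. -/
theorem card_signOrbit {N : Matrix (k ⊕ l) (Fin 2) ℚ} (h1 : ∃ i j, N (Sum.inl i) j ≠ 0)
    (h2 : ∃ i j, N (Sum.inr i) j ≠ 0) : (signOrbit N).card = 4 := by
  obtain ⟨i, j, hij⟩ := h1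
  obtain ⟨i', j', hij'⟩ := h2
  have hl : ∀ L L' : Matrix (k ⊕ l) (Fin 2) ℚ, L (Sum.inl i) j ≠ L' (Sum.inl i) j → L ≠ L' :=
    fun L L' h h' => h (by rw [h'])
  have hr : ∀ L L' : Matrix (k ⊕ l) (Fin 2) ℚ, L (Sum.inr i') j' ≠ L' (Sum.inr i') j' → L ≠ L' :=
    fun L L' h h' => h (by rw [h'])
  have e1 : N ≠ -N := hl _ _ (by simpa [self_eq_neg] using hij)
  have e2 : N ≠ flipRows N := hl _ _ (by simpa [flipRows_inl, self_eq_neg] using hij)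
  have e3 : N ≠ -flipRows N := hr _ _ (by simpa [flipRows_inr, self_eq_neg] using hij')
  have e4 : -N ≠ flipRows N := fun h => e3 (by rw [← h, neg_neg])
  have e5 : -N ≠ -flipRows N := fun h => e2 (neg_injective h)
  have e6 : flipRows N ≠ -flipRows N := hl _ _ (by simpa [flipRows_inl, eq_comm, self_eq_neg] using hij)
  classical
  rw [signOrbit, Finset.card_insert_of_notMem, Finset.card_insert_of_notMem,
    Finset.card_insert_of_notMem, Finset.card_singleton]
  · simpa using e6
  · simp [e4, e5]
  · simp [e1, e2, e3]

end flip

variable {p : ℕ} {A B E E' : Matrix (Fin 4) (Fin 4) ℤ}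

/-- A vector with a vanishing block is a vector for one quaternary form, and anisotropy applies to
that form and to its partner. -/
theorem IsLevelPair.mem_of_zero (hA : IsLevelPair p A E) (hB : IsLevelPair p B E') (hp : p.Prime)
    {x : Fin 4 ⊕ Fin 4 → ℚ} (hx : x ∘ Sum.inl = 0 ∨ x ∘ Sum.inr = 0) :
    (x ∈ dualLattice (fromBlocks A 0 0 B) → (∃ m : ℤ, quad (fromBlocks A 0 0 B) x = m) →
      x ∈ intLattice (Fin 4 ⊕ Fin 4)) ∧
    (x ∈ intLattice (Fin 4 ⊕ Fin 4) → (∃ m : ℤ, quad (fromBlocks A 0 0 B) x = p * m) →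
      (p : ℚ)⁻¹ • x ∈ dualLattice (fromBlocks A 0 0 B)) := by
  have h0 : ∀ Q : Matrix (Fin 4) (Fin 4) ℤ, quad Q 0 = 0 := fun Q => by
    rw [quad, bil_zero_left, zero_div]
  rw [mem_dualLattice_fromBlocks, mem_dualLattice_fromBlocks, mem_intLattice_sum, quad_fromBlocks]
  change _ ∧ (_ → _ → (p : ℚ)⁻¹ • (x ∘ Sum.inl) ∈ _ ∧ (p : ℚ)⁻¹ • (x ∘ Sum.inr) ∈ _)
  rcases hx with hx | hx <;> rw [hx, h0]
  · rw [zero_add, smul_zero]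
    exact ⟨fun h hq => ⟨zero_mem _, hB.mem_intLattice hp h.2 hq⟩,
      fun h hq => ⟨zero_mem _, hB.inv_smul_mem_dualLattice hp h.2 hq⟩⟩
  · rw [add_zero, smul_zero]
    exact ⟨fun h hq => ⟨hA.mem_intLattice hp h.1 hq, zero_mem _⟩,
      fun h hq => ⟨hA.inv_smul_mem_dualLattice hp h.1 hq, zero_mem _⟩⟩

/-- Both indicators occurring in each factor equal one, so the factors are `1 + p` and `p + 1`. For
odd `p` the product is divisible by four. -/
theorem IsLevelPair.colProd_of_zero (hA : IsLevelPair p A E) (hB : IsLevelPair p B E') (hp : p.Prime)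
    {N : Matrix (Fin 4 ⊕ Fin 4) (Fin 2) ℚ}
    (hN : (∀ i j, N (Sum.inl i) j = 0) ∨ ∀ i j, N (Sum.inr i) j = 0)
    (h : colProd (trFst p (fromBlocks A 0 0 B)) (trSnd p (fromBlocks A 0 0 B)) N ≠ 0) :
    colProd (trFst p (fromBlocks A 0 0 B)) (trSnd p (fromBlocks A 0 0 B)) N = (p + 1) ^ 2 := by
  have hQ := hA.isLevelForm_fromBlocks hB
  have hz : ∀ j, N.col j ∘ Sum.inl = 0 ∨ N.col j ∘ Sum.inr = 0 := fun j =>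
    hN.imp (fun h => funext fun i => h i j) fun h => funext fun i => h i j
  have h0 := trFst_supp hQ hp.pos (left_ne_zero_of_mul h)
  have h1 := trSnd_supp hQ (right_ne_zero_of_mul h)
  rw [colProd, trFst, trSnd, if_pos h0, if_pos h1,
    ind_of_mem ((hA.mem_of_zero hB hp (hz 0)).2 h0.1 h0.2),
    ind_of_mem ((hA.mem_of_zero hB hp (hz 1)).1 h1.1 h1.2)]
  ring

/-- The Fourier coefficients of the trace are divisible by four. -/
theorem IsLevelPair.four_dvd_tsum_traceFiber (hA : IsLevelPair p A E) (hB : IsLevelPair p B E')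
    (hp : p.Prime) (hodd : Odd p) (T : Matrix (Fin 2) (Fin 2) ℚ) :
    ∃ m : ℤ, ∑' N : traceFiber p (fromBlocks A 0 0 B) T,
      colProd (trFst p (fromBlocks A 0 0 B)) (trSnd p (fromBlocks A 0 0 B)) N.1 = 4 * m := by
  classical
  set Q := fromBlocks A 0 0 B
  set Φ := colProd (trFst p Q) (trSnd p Q) with hΦ
  have hfin := finite_traceFiber (hA.isLevelForm_fromBlocks hB) hp.pos T
  let F := hfin.toFinset
  have hF : ∀ N, N ∈ F ↔ Φ N ≠ 0 ∧ thetaIndex Q N = T := fun N => hfin.mem_toFinset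
  have hsum : ∑' N : traceFiber p Q T, Φ N.1 = ∑ N ∈ F, Φ N := by
    rw [← Finset.tsum_subtype F Φ]
    exact (Equiv.setCongr hfin.coe_toFinset.symm).tsum_eq (fun N : (F : Set _) => Φ N.1)
  have hdvd : ∀ z : ℂ, (∃ m : ℤ, z = 4 * m) ↔ z ∈ AddSubgroup.zmultiples (4 : ℂ) := fun z => by
    rw [AddSubgroup.mem_zmultiples_iff]
    exact exists_congr fun m => by rw [zsmul_eq_mul, mul_comm, eq_comm]
  -- The matrices with a vanishing block, where sign orbits can have fewer than four elements and
  -- the value of the weight itself is needed.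
  let Z : Matrix (Fin 4 ⊕ Fin 4) (Fin 2) ℚ → Prop := fun N =>
    (∀ i j, N (Sum.inl i) j = 0) ∨ ∀ i j, N (Sum.inr i) j = 0
  rw [hsum, hdvd, ← Finset.sum_filter_add_sum_filter_not F Z]
  refine add_mem (sum_mem fun N hN => ?_) ?_
  · rw [Finset.mem_filter, hF] at hN
    rw [← hdvd, hΦ, hA.colProd_of_zero hB hp hN.2 hN.1.1]
    obtain ⟨r, rfl⟩ := hodd
    exact ⟨(r + 1) ^ 2, by push_cast; ring⟩
  -- Off `Z` the fibre is a union of sign orbits, each with four elements and constant integral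
  -- weight.
  · rw [← Finset.sum_fiberwise_of_maps_to fun N hN => Finset.mem_image_of_mem signOrbit hN]
    refine sum_mem fun O hO => ?_
    obtain ⟨N, hN, rfl⟩ := Finset.mem_image.1 hO
    have hinv : ∀ L ∈ signOrbit N, Φ L = Φ N ∧ thetaIndex Q L = thetaIndex Q N ∧ (Z L ↔ Z N) := by
      intro L hL
      rw [mem_signOrbit] at hL
      rcases hL with rfl | rfl | rfl | rfl
      · exact ⟨rfl, rfl, Iff.rfl⟩
      · exact ⟨colProd_trace_neg _, thetaIndex_neg _ _, by simp [Z]⟩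
      · exact ⟨colProd_flipRows _, thetaIndex_flipRows _, by simp [Z, flipRows_inl, flipRows_inr]⟩
      · exact ⟨(colProd_trace_neg _).trans (colProd_flipRows _),
          (thetaIndex_neg _ _).trans (thetaIndex_flipRows _), by simp [Z, flipRows_inl, flipRows_inr]⟩
    have hO : {L ∈ F.filter (¬Z ·) | signOrbit L = signOrbit N} = signOrbit N := by
      ext L
      rw [Finset.mem_filter]
      constructor
      · rintro ⟨-, h⟩
        rw [← h]
        exact mem_signOrbit.2 (Or.inl rfl)
      · intro h
        rw [Finset.mem_filter, hF] at hN ⊢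
        obtain ⟨e1, e2, e3⟩ := hinv L h
        rw [e1, e2, e3]
        exact ⟨hN, signOrbit_eq h⟩
    rw [hO, Finset.sum_congr rfl fun L hL => (hinv L hL).1, Finset.sum_const]
    have hZ := (Finset.mem_filter.1 hN).2
    simp only [Z, not_or] at hZ
    push Not at hZ
    rw [card_signOrbit hZ.1 hZ.2, ← hdvd]
    obtain ⟨m, hm⟩ := colProd_trace_int (p := p) (Q := Q) N
    exact ⟨m, by rw [hΦ, hm]; simp⟩

end

theorem theorem3p13 (p : ℕ) [hp : Fact p.Prime] (hodd : Odd p)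
    (A B : Matrix (Fin 4) (Fin 4) ℤ)
    (hA : IsEvenForm A) (hB : IsEvenForm B)
    (hApos : (A.map (Int.cast : ℤ → ℝ)).PosDef) (hBpos : (B.map (Int.cast : ℤ → ℝ)).PosDef)
    (hAdet : A.det = (p : ℤ) ^ 2) (hBdet : B.det = (p : ℤ) ^ 2)
    (hAlevel : IsEvenRatForm ((p : ℚ) • (A.map (Int.cast : ℤ → ℚ))⁻¹))
    (hBlevel : IsEvenRatForm ((p : ℚ) • (B.map (Int.cast : ℤ → ℚ))⁻¹)) :
    IsSiegelModularForm 4 (paramodular p)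
        (paramodularTrace 4 p (theta (Matrix.fromBlocks A 0 0 B))) ∧
      (∃ a : paramodularIndices p → ℂ,
        IsFourierExpansion p (paramodularTrace 4 p (theta (Matrix.fromBlocks A 0 0 B))) a) ∧
      ∀ a : paramodularIndices p → ℂ,
        IsFourierExpansion p (paramodularTrace 4 p (theta (Matrix.fromBlocks A 0 0 B))) a →
        ∀ T : paramodularIndices p, ∃ m : ℤ, a T = 4 * m := by
  obtain ⟨E, hAE⟩ := exists_isLevelPair hp.out.pos hA hApos hAdet hAlevel
  obtain ⟨E', hBE⟩ := exists_isLevelPair hp.out.pos hB hBpos hBdet hBlevel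
  have hQ := hAE.isLevelForm_fromBlocks hBE
  have hexp := isFourierExpansion_paramodularTrace hQ hp.out
  refine ⟨isSiegelModularForm_paramodularTrace hQ hp.out, ⟨_, hexp⟩, fun a ha T => ?_⟩
  -- The claim concerns every expansion; uniqueness reduces it to the explicit one.
  rw [ha.unique hexp]
  exact hAE.four_dvd_tsum_traceFiber hBE hp.out hodd T.1
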